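/- **Theorem (Intertwining operators).** Let $m\ge 3$, let $\mathcal{C}l_m\subset\mathcal{C}l_m(\mathbb{C})$ be the real and complex Clifford algebras generated by $\mathbb{R}^m$ with $x^2=-\|x\|^2$, let $\tilde{\ }$ be the reversion, and let $\|z\|=(\sum_A z_A^2)^{1/2}$ for $z=\sum_A z_Ae_A\in\mathcal{C}l_m$. For $k\ge 0$ let $\mathcal{H}_k$ and $\mathcal{M}_k$ be the spaces of $\mathcal{C}l_m(\mathbb{C})$-valued homogeneous polynomials $g(u)$ of degree $k$ on $\mathbb{R}^m$ with $\Delta_u g=0$ and with $D_ug=0$, respectively, where $D_u=\sum_i e_i\partial_{u_i}$. Put $D_x=\sum_i e_i\partial_{x_i}$, $\langle u,D_x\rangle=\sum_i u_i\partial_{x_i}$, $\langle D_u,D_x\rangle=\sum_i\partial_{u_i}\partial_{x_i}$, and, on $C^\infty(\mathbb{R}^m,\mathcal{M}_k)$, $$\mathcal{D}_3=D_x^3+\frac{4\langle u,D_x\rangle\langle D_u,D_x\rangle D_x}{m+2k}-\frac{4\|u\|^2\langle D_u,D_x\rangle^2D_x}{(m+2k)(m+2k-2)}-\frac{2u\langle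 D_u,D_x\rangle D_x^2}{m+2k}-\frac{8u\langle u,D_x\rangle\langle D_u,D_x\rangle^2}{(m+2k)(m+2k-2)}-\frac{8u^3\langle D_u,D_x\rangle^3}{(m+2k)(m+2k-2)(m+2k-4)}$$ (for $k=0$ all terms with $\langle D_u,D_x\rangle$ vanish, and $\mathcal{D}_3=D_x^3$), and, on $C^\infty(\mathbb{R}^m,\mathcal{H}_k)$ with $m+2k\neq 4$, $$\mathcal{D}_2=\Delta_x-\frac{4}{m+2k-2}\Big(\langle u,D_x\rangle-\frac{\|u\|^2\langle D_u,D_x\rangle}{m+2k-4}\Big)\langle D_u,D_x\rangle,\qquad \mathcal{D}_4=\mathcal{D}_2^2-\frac{8}{(m+2k-2)(m+2k-4)}\mathcal{D}_2\Delta_x .$$ Let $a,b,c,d\in\mathcal{C}l_m$ be products of vectors of $\mathbb{R}^m$ with $a\tilde b,\ c\tilde d,\ \tilde c a,\ \tilde d b\in\mathbb{R}^m$ and $\delta:=a\tilde d-b\tilde c\in\{1,-1\}$. Then, for all $x\in\mathbb{R}^m$ with $cx+d\ne0$ and all $u\in\mathbb{R}^m$, the element $cx+d$ is invertible with $\|cx+d\|>0$,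 and $$\phi(x)=(ax+b)(cx+d)^{-1},\qquad \omega=\omega(x,u)=\frac{(cx+d)\,u\,\widetilde{(cx+d)}}{\|cx+d\|^2}$$ are vectors in $\mathbb{R}^m$. Moreover: 1. There is a sign $\varepsilon\in\{1,-1\}$, depending only on $(a,b,c,d)$ and given by $\delta\,\widehat{(cx+d)}=\varepsilon\,(cx+d)$ for all $x$, where $\widehat{\ }$ is the main involution ($\hat v=-v$ on vectors); that is, $\varepsilon=\delta(-1)^p$ if $cx+d\neq 0$ is a product of $p$ vectors; such that for all $k\ge0$, all $f\in C^\infty(\mathbb{R}^m,\mathcal{M}_k)$, all $x$ with $cx+d\neq0$ and all $u$, $$\varepsilon\,\frac{\widetilde{cx+d}}{\|cx+d\|^{m+4}}\,(\mathcal{D}_3f)(\phi(x),\omega)=\mathcal{D}_{3,x,u}\left[\frac{\widetilde{cx+d}}{\|cx+d\|^{m-2}}\,f(\phi(x),\omega(x,u))\right].$$ 2. For all $k\ge0$ with $m+2k\ne4$, all $f\in C^\infty(\mathbb{R}^m,\mathcal{H}_k)$, all $x$ with $cx+d\neq0$ and all $u$, $$\|cx+d\|^{-m-4}\,(\mathcal{D}_4f)(\phi(x),\omega)=\mathcal{D}_{4,x,u}\Big[\|cx+d\|^{4-m}f(\phi(x),\omega(x,u))\Big].$$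 -/

import Mathlib

open scoped ContDiff

noncomputable section

namespace HigherSpin

/-- Euclidean space `ℝ^m`. -/
abbrev E (m : ℕ) : Type := EuclideanSpace ℝ (Fin m)

/-- The quadratic form `z ↦ -(z_1 ^ 2 + ⋯ + z_m ^ 2)` on `ℂ^m`. -/
def negSq (m : ℕ) : QuadraticForm ℂ (Fin m → ℂ) :=
  QuadraticMap.weightedSumSquares ℂ (fun _ : Fin m => (-1 : ℂ))

/-- The complex Clifford algebra `Cl_m(ℂ)`, in which `e_i e_j + e_j e_i = -2 δ_{ij}`. -/
abbrev Cl (m : ℕ) : Type := CliffordAlgebra (negSq m)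

/-- The embedding `ℝ^m ⊆ Cl_m(ℂ)`, `x ↦ ∑ x_i e_i`. -/
def vec {m : ℕ} (x : E m) : Cl m := CliffordAlgebra.ι (negSq m) (fun i => (x i : ℂ))

/-- The basis vector `e_i` of `ℝ^m`. -/
def e {m : ℕ} (i : Fin m) : E m := EuclideanSpace.single i 1

theorem vec_mul_self {m : ℕ} (x : E m) :
    vec x * vec x = algebraMap ℝ (Cl m) (-(‖x‖ ^ 2)) := by
  rw [vec, CliffordAlgebra.ι_sq_scalar, IsScalarTower.algebraMap_apply ℝ ℂ (Cl m)]
  congr 1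
  rw [EuclideanSpace.norm_sq_eq]
  simp [negSq, QuadraticMap.weightedSumSquares_apply, sq]

/-- The canonical linear isomorphism with the exterior algebra
(`e_{i_1} ⋯ e_{i_r} ↦ e_{i_1} ∧ ⋯ ∧ e_{i_r}` for `i_1 < ⋯ < i_r`). -/
def toExterior (m : ℕ) : Cl m ≃ₗ[ℂ] ExteriorAlgebra ℂ (Fin m → ℂ) :=
  letI : Invertible (2 : ℂ) := invertibleOfNonzero two_ne_zero
  CliffordAlgebra.equivExterior (negSq m)

/-- The coordinates `a_A` of `a = ∑_A a_A e_A`. -/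
def coords (m : ℕ) : Cl m ≃ₗ[ℂ] (Finset (Fin m) → ℂ) :=
  (toExterior m).trans (Pi.basisFun ℂ (Fin m)).ExteriorAlgebra.equivFun

/-- The (sup) norm of the coordinates. It only serves to do calculus with functions with values in
the finite dimensional space `Cl_m(ℂ)`; all norms are equivalent. -/
instance instNormedAddCommGroup (m : ℕ) : NormedAddCommGroup (Cl m) :=
  NormedAddCommGroup.induced (Cl m) (Finset (Fin m) → ℂ) (coords m).toLinearMap
    (coords m).injective

instance instNormedSpace (m : ℕ) : NormedSpace ℝ (Cl m) :=
  NormedSpace.induced ℝ (Cl m) (Finset (Fin m) → ℂ) ((coords m).toLinearMap.restrictScalars ℝ)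

/-- The scalar part (coefficient of `1`) of a Clifford number. -/
def scalarPart {m : ℕ} (z : Cl m) : ℂ := ExteriorAlgebra.algebraMapInv (toExterior m z)

/-- The Clifford norm of an element `z` of the real Clifford algebra `Cl_m ⊆ Cl_m(ℂ)`:
`‖z‖ ^ 2 = ∑_A z_A ^ 2` is the scalar part of `z z̄`, where `z̄` is the Clifford conjugate
(the anti-automorphism with `v̄ = -v` on vectors). -/
def clNorm {m : ℕ} (z : Cl m) : ℝ :=
  Real.sqrt (scalarPart (z * CliffordAlgebra.reverse (CliffordAlgebra.involute z))).re

/-! ### Möbius transformations -/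

/-- `z` is a vector, i.e. lies in `ℝ^m ⊆ Cl_m(ℂ)`. -/
def IsVec {m : ℕ} (z : Cl m) : Prop := ∃ v : E m, z = vec v

/-- `z` is a (finite) product of vectors in `ℝ^m`. -/
def IsVecProd {m : ℕ} (z : Cl m) : Prop := ∃ l : List (E m), z = (l.map vec).prod

/-- The inverse of `vec` on vectors (arbitrary elsewhere). -/
def toVec {m : ℕ} (z : Cl m) : E m := Function.invFun vec z

/-- The Ahlfors–Vahlen conditions on the matrix `(a, b; c, d)`. -/
structure IsVahlen {m : ℕ} (a b c d : Cl m) : Prop where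
  prod_a : IsVecProd a
  prod_b : IsVecProd b
  prod_c : IsVecProd c
  prod_d : IsVecProd d
  vec_ab : IsVec (a * CliffordAlgebra.reverse b)
  vec_cd : IsVec (c * CliffordAlgebra.reverse d)
  vec_ca : IsVec (CliffordAlgebra.reverse c * a)
  vec_db : IsVec (CliffordAlgebra.reverse d * b)
  det : a * CliffordAlgebra.reverse d - b * CliffordAlgebra.reverse c = 1 ∨
    a * CliffordAlgebra.reverse d - b * CliffordAlgebra.reverse c = -1

/-- `φ(x) = (ax + b)(cx + d)⁻¹`. -/
def moebius {m : ℕ} (a b c d : Cl m) (x : E m) : E m :=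
  toVec ((a * vec x + b) * Ring.inverse (c * vec x + d))

/-- `z u z̃ / ‖z‖ ^ 2`. -/
def rotate {m : ℕ} (z : Cl m) (u : E m) : E m :=
  toVec ((clNorm z ^ 2)⁻¹ • (z * vec u * CliffordAlgebra.reverse z))

/-! ### Differential operators on functions `F(x, u)` with values in `Cl_m(ℂ)` -/

section Operators

variable {m : ℕ}

/-- `∂F/∂x_i`. -/
def dX (i : Fin m) (F : E m → E m → Cl m) : E m → E m → Cl m :=
  fun x u => fderiv ℝ (fun x' => F x' u) x (e i)

/-- `∂F/∂u_i`. -/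
def dU (i : Fin m) (F : E m → E m → Cl m) : E m → E m → Cl m :=
  fun x u => fderiv ℝ (fun u' => F x u') u (e i)

/-- The Dirac operator `D_x = ∑ e_i ∂_{x_i}`. -/
def diracX (F : E m → E m → Cl m) : E m → E m → Cl m :=
  fun x u => ∑ i, vec (e i) * dX i F x u

/-- The Laplace operator `Δ_x`. -/
def lapX (F : E m → E m → Cl m) : E m → E m → Cl m :=
  fun x u => ∑ i, dX i (dX i F) x u

/-- `⟨u, D_x⟩ = ∑ u_i ∂_{x_i}`. -/
def uDx (F : E m → E m → Cl m) : E m → E m → Cl m :=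
  fun x u => ∑ i, u i • dX i F x u

/-- `⟨D_u, D_x⟩ = ∑ ∂_{u_i} ∂_{x_i}`. -/
def duDx (F : E m → E m → Cl m) : E m → E m → Cl m :=
  fun x u => ∑ i, dU i (dX i F) x u

/-- The third order higher spin operator `𝒟₃` on `C^∞(ℝ^m, ℳ_k)`. -/
def D3 (k : ℕ) (F : E m → E m → Cl m) : E m → E m → Cl m :=
  fun x u =>
    diracX (diracX (diracX F)) x u
      + (4 / ((m : ℝ) + 2 * k)) • uDx (duDx (diracX F)) x u
      - (4 * ‖u‖ ^ 2 / (((m : ℝ) + 2 * k) * (m + 2 * k - 2))) • duDx (duDx (diracX F)) x u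
      - (2 / ((m : ℝ) + 2 * k)) • (vec u * duDx (diracX (diracX F)) x u)
      - (8 / (((m : ℝ) + 2 * k) * (m + 2 * k - 2))) • (vec u * uDx (duDx (duDx F)) x u)
      - (8 / (((m : ℝ) + 2 * k) * (m + 2 * k - 2) * (m + 2 * k - 4))) •
          (vec u ^ 3 * duDx (duDx (duDx F)) x u)

/-- The higher spin Laplace operator `𝒟₂` on `C^∞(ℝ^m, ℋ_k)`. -/
def D2 (k : ℕ) (F : E m → E m → Cl m) : E m → E m → Cl m :=
  fun x u =>
    lapX F x u
      - (4 / ((m : ℝ) + 2 * k - 2)) •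
          (uDx (duDx F) x u - (‖u‖ ^ 2 / ((m : ℝ) + 2 * k - 4)) • duDx (duDx F) x u)

/-- The fourth order higher spin operator `𝒟₄` on `C^∞(ℝ^m, ℋ_k)`. -/
def D4 (k : ℕ) (F : E m → E m → Cl m) : E m → E m → Cl m :=
  fun x u =>
    D2 k (D2 k F) x u
      - (8 / (((m : ℝ) + 2 * k - 2) * (m + 2 * k - 4))) • D2 k (lapX F) x u

/-! ### The target spaces -/

/-- `g` is a `Cl_m(ℂ)`-valued homogeneous polynomial of degree `k` on `ℝ^m`. -/
def IsHomogPoly (k : ℕ) (g : E m → Cl m) : Prop :=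
  ∃ coeff : (Fin m → ℕ) → Cl m, ∀ u : E m,
    g u = ∑ α ∈ Finset.piAntidiag (Finset.univ : Finset (Fin m)) k, (∏ i, u i ^ α i) • coeff α

/-- `ℳ_k`: monogenic (`D_u g = 0`) homogeneous polynomials of degree `k`. -/
def IsMonogenicPoly (k : ℕ) (g : E m → Cl m) : Prop :=
  IsHomogPoly k g ∧ ∀ u, ∑ i, vec (e i) * fderiv ℝ g u (e i) = 0

/-- `ℋ_k`: harmonic (`Δ_u g = 0`) homogeneous polynomials of degree `k`. -/
def IsHarmonicPoly (k : ℕ) (g : E m → Cl m) : Prop :=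
  IsHomogPoly k g ∧ ∀ u, ∑ i, fderiv ℝ (fun v => fderiv ℝ g v (e i)) u (e i) = 0

/-- `f ∈ C^∞(ℝ^m, ℳ_k)`. -/
def IsSmoothMonogenic (k : ℕ) (f : E m → E m → Cl m) : Prop :=
  ContDiff ℝ ∞ (fun p : E m × E m => f p.1 p.2) ∧ ∀ x, IsMonogenicPoly k (f x)

/-- `f ∈ C^∞(ℝ^m, ℋ_k)`. -/
def IsSmoothHarmonic (k : ℕ) (f : E m → E m → Cl m) : Prop :=
  ContDiff ℝ ∞ (fun p : E m × E m => f p.1 p.2) ∧ ∀ x, IsHarmonicPoly k (f x)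

end Operators

end HigherSpin

end

open HigherSpin

/-! The Möbius group is generated by translations, similarities and special conformal maps, and near
a regular point a Vahlen matrix is explicitly such a product. With q = cx + d one has c = qv for a
vector v, so the denominator at x + h is q(1 + vh), and φ(x + h) = y + δ‖q‖⁻² R_q(h(1 + vh)⁻¹),
where R_q u = q u q̃ / ‖q‖² (`IsVahlen.exists_local`, `moebius_eq`). It suffices to verify the
intertwining relation at h = 0.

The outer map h ↦ y + μ R_q h with μ = δ‖q‖⁻² is harmless: contractions are rotation invariant, each
x-derivative contributes μ, and each Clifford vector moved past q̃ contributes the parity sign σ of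
q (`T3_Psi`, `T4_Psi`). This gives σμ³ for 𝒟₃ and μ⁴ for 𝒟₄, hence all the powers of ‖q‖ and the
sign ε = δσ.

The special conformal factor is embedded in the one-parameter family h ↦ h(1 + tvh)⁻¹. The weighted
pullback W(t, h, u) satisfies ∂_t W = K W for a first order operator K (`dt_flow`; `dt_twist_flow`
in the spinor case), and pulling back preserves homogeneity and the harmonic or monogenic condition
in u. A computation in the Weyl–Clifford algebra gives 𝒟K = K𝒟 + 2r⟨v,x⟩𝒟 on such functions, with r
= 3 or 4 the order of 𝒟 (`T3_KS`, `T4_K`); this is where the coefficients of 𝒟₃ and 𝒟₄ matter. Since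
𝒟 has no t in it, ∂_t 𝒟W = (K + 2r⟨v,x⟩)𝒟W, and the right side vanishes at h = 0, a fixed point of
the flow. So 𝒟W(t, 0, u) does not depend on t (`T3_const`, `T4_const`). At t = 1 it is the operator
applied to the full Möbius pullback, at t = 0 to the similarity pullback, and equating the two
proves the theorem. -/

noncomputable section

namespace HigherSpin

open CliffordAlgebra

/-! ### The Clifford algebra as a real algebra -/

section Clifford

variable {m : ℕ}

/-! The real module structure of `Cl m`, with the instances found at reducible transparency. -/

namespace CliffordModule

scoped instance instSMulCl : SMul ℝ (Cl m) := (instNormedSpace m).toModule.toDistribMulAction.toSMul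

scoped instance instMulActionCl : MulAction ℝ (Cl m) :=
  (instNormedSpace m).toModule.toDistribMulAction.toMulAction

scoped instance instFiniteDimensionalCl : FiniteDimensional ℝ (Cl m) := by
  have : FiniteDimensional ℂ (Cl m) := Module.Finite.equiv (coords m).symm
  exact Module.Finite.trans ℂ (Cl m)

end CliffordModule

open scoped CliffordModule

theorem algebraMap_cl (r : ℝ) : algebraMap ℝ (Cl m) r = r • (1 : Cl m) :=
  Algebra.algebraMap_eq_smul_one r

theorem reverse_real_smul (r : ℝ) (z : Cl m) : reverse (r • z) = r • reverse z :=
  (reverse (Q := negSq m)).map_smul_of_tower r z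

theorem involute_real_smul (r : ℝ) (z : Cl m) : involute (r • z) = r • involute z :=
  (involute (Q := negSq m)).toLinearMap.map_smul_of_tower r z

theorem vec_add (x y : E m) : vec (x + y) = vec x + vec y := by
  simp only [vec, ← map_add]
  congr 1
  ext i
  simp

theorem vec_smul (r : ℝ) (x : E m) : vec (r • x) = r • vec x := by
  have : vec (r • x) = (r : ℂ) • vec x := by
    simp only [vec, ← map_smul]
    congr 1
    ext i
    simp
  exact this

/-- `vec` as a linear map. -/
def vecL (m : ℕ) : E m →ₗ[ℝ] Cl m where
  toFun := vec
  map_add' := vec_add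
  map_smul' := vec_smul

theorem vecL_apply (x : E m) : vecL m x = vec x := rfl

theorem vec_neg (x : E m) : vec (-x) = -vec x := map_neg (vecL m) x

theorem vec_sub (x y : E m) : vec (x - y) = vec x - vec y := map_sub (vecL m) x y

theorem vec_zero : vec (0 : E m) = 0 := map_zero (vecL m)

theorem vec_sq (x : E m) : vec x * vec x = (-(‖x‖ ^ 2)) • (1 : Cl m) := by
  rw [vec_mul_self, algebraMap_cl]

theorem smul_one_injective {r s : ℝ} (h : r • (1 : Cl m) = s • (1 : Cl m)) : r = s := by
  have := smul_left_injective ℝ (one_ne_zero : (1 : Cl m) ≠ 0)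
  exact this h

theorem vec_injective : Function.Injective (vec : E m → Cl m) := by
  refine (injective_iff_map_eq_zero (vecL m)).2 fun x hx => ?_
  have h := vec_sq x
  rw [← vecL_apply, hx, mul_zero] at h
  have h' := smul_one_injective (m := m) (r := 0) (s := -(‖x‖ ^ 2)) (by rw [← h, zero_smul])
  have : ‖x‖ = 0 := by nlinarith
  simpa using this

theorem toVec_vec (x : E m) : toVec (vec x) = x :=
  Function.leftInverse_invFun vec_injective x

theorem vec_mul_add_swap (x y : E m) :
    vec x * vec y + vec y * vec x = (-2 * inner ℝ x y) • (1 : Cl m) := by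
  have h := vec_sq (x + y)
  rw [vec_add, add_mul, mul_add, mul_add, vec_sq, vec_sq, norm_add_sq_real] at h
  have : vec x * vec y + vec y * vec x = (-(‖x‖ ^ 2 + 2 * inner ℝ x y + ‖y‖ ^ 2)) • (1 : Cl m)
      - (-(‖x‖ ^ 2)) • (1 : Cl m) - (-(‖y‖ ^ 2)) • (1 : Cl m) := by
    rw [← h]; abel
  rw [this]
  module

theorem vec_mul_swap (x y : E m) :
    vec x * vec y = (-2 * inner ℝ x y) • (1 : Cl m) - vec y * vec x :=
  eq_sub_of_add_eq (vec_mul_add_swap x y)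

theorem vec_mul_vec_mul_vec (x y : E m) :
    vec x * vec y * vec x = vec ((‖x‖ ^ 2) • y - (2 * inner ℝ x y) • x) := by
  rw [vec_mul_swap x y, sub_mul, mul_assoc, vec_sq, vec_sub, vec_smul, vec_smul, smul_mul_assoc,
    one_mul, mul_smul_comm, mul_one]
  module

theorem reverse_vec (x : E m) : reverse (vec x) = vec x := reverse_ι _

theorem involute_vec (x : E m) : involute (vec x) = -vec x := involute_ι _

theorem IsVec.smul {z : Cl m} (r : ℝ) (hz : IsVec z) : IsVec (r • z) := by
  obtain ⟨w, rfl⟩ := hz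
  exact ⟨r • w, (vec_smul r w).symm⟩

theorem scalarPart_smul_one (r : ℝ) : scalarPart (r • (1 : Cl m)) = (r : ℂ) := by
  have : r • (1 : Cl m) = algebraMap ℂ (Cl m) r := (Algebra.algebraMap_eq_smul_one (r : ℂ)).symm
  rw [this, scalarPart, toExterior]
  -- The isomorphism with the exterior algebra is a change of quadratic form, which fixes scalars.
  have h := CliffordAlgebra.changeForm_algebraMap (Q := negSq m) (Q' := 0)
    (changeForm.associated_neg_proof (Q := negSq m)) (r : ℂ)
  refine (congrArg _ h).trans ?_
  exact ExteriorAlgebra.algebraMap_leftInverse _ _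

/-! ### Products of nonzero vectors -/

/-- `q` is a Clifford group element of parity sign `σ` and squared norm `n`. -/
structure IsLipschitz (q : Cl m) (σ n : ℝ) : Prop where
  pos : 0 < n
  sign : σ = 1 ∨ σ = -1
  mul_reverse : q * reverse q = (σ * n) • (1 : Cl m)
  reverse_mul : reverse q * q = (σ * n) • (1 : Cl m)
  involute_eq : involute q = σ • q
  conj : ∀ u : E m, IsVec (q * vec u * reverse q)
  conj' : ∀ u : E m, IsVec (reverse q * vec u * q)

namespace IsLipschitz

variable {p q : Cl m} {σ τ n l : ℝ}

theorem sign_sq (h : IsLipschitz q σ n) : σ * σ = 1 := by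
  rcases h.sign with h | h <;> simp [h]

theorem one : IsLipschitz (1 : Cl m) 1 1 where
  pos := one_pos
  sign := Or.inl rfl
  mul_reverse := by simp
  reverse_mul := by simp
  involute_eq := by simp
  conj u := ⟨u, by simp⟩
  conj' u := ⟨u, by simp⟩

theorem of_vec {v : E m} (hv : v ≠ 0) : IsLipschitz (vec v) (-1) (‖v‖ ^ 2) where
  pos := by positivity
  sign := Or.inr rfl
  mul_reverse := by rw [reverse_vec, vec_sq, neg_one_mul]
  reverse_mul := by rw [reverse_vec, vec_sq, neg_one_mul]
  involute_eq := by rw [involute_vec, neg_one_smul]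
  conj u := by rw [reverse_vec, vec_mul_vec_mul_vec]; exact ⟨_, rfl⟩
  conj' u := by rw [reverse_vec, vec_mul_vec_mul_vec]; exact ⟨_, rfl⟩

theorem mul (hq : IsLipschitz q σ n) (hp : IsLipschitz p τ l) :
    IsLipschitz (q * p) (σ * τ) (n * l) where
  pos := mul_pos hq.pos hp.pos
  sign := by
    rcases hq.sign with h | h <;> rcases hp.sign with h' | h' <;> simp [h, h']
  mul_reverse := by
    rw [reverse.map_mul, mul_assoc, ← mul_assoc p, hp.mul_reverse, smul_mul_assoc, one_mul,
      mul_smul_comm, hq.mul_reverse, smul_smul]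
    congr 1; ring
  reverse_mul := by
    rw [reverse.map_mul, mul_assoc, ← mul_assoc (reverse q), hq.reverse_mul, smul_mul_assoc,
      one_mul, mul_smul_comm, hp.reverse_mul, smul_smul]
    congr 1; ring
  involute_eq := by
    rw [map_mul, hq.involute_eq, hp.involute_eq, smul_mul_assoc, mul_smul_comm, smul_smul]
  conj u := by
    obtain ⟨w, hw⟩ := hp.conj u
    have : q * p * vec u * reverse (q * p) = q * vec w * reverse q := by
      rw [reverse.map_mul, ← hw]; simp only [mul_assoc]
    rw [this]; exact hq.conj w
  conj' u := by
    obtain ⟨w, hw⟩ := hq.conj' u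
    have : reverse (q * p) * vec u * (q * p) = reverse p * vec w * p := by
      rw [reverse.map_mul, ← hw]; simp only [mul_assoc]
    rw [this]; exact hp.conj' w

theorem ne_zero (h : IsLipschitz q σ n) : q ≠ 0 := by
  rintro rfl
  have := h.mul_reverse
  rw [zero_mul] at this
  have h' := smul_one_injective (m := m) (r := 0) (by rw [← this, zero_smul])
  rcases h.sign with hs | hs <;> rw [hs] at h' <;> linarith [h.pos]

/-- A nonzero product has no zero factor, and each nonzero vector lies in the Clifford group; the
properties are multiplicative. -/
theorem exists_of_isVecProd {q : Cl m} (h : IsVecProd q) (hq : q ≠ 0) :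
    ∃ σ n, IsLipschitz q σ n := by
  obtain ⟨l, rfl⟩ := h
  induction l with
  | nil => exact ⟨1, 1, by simpa using one⟩
  | cons v l ih =>
    simp only [List.map_cons, List.prod_cons] at hq ⊢
    have hv : v ≠ 0 := by
      rintro rfl
      exact hq (by rw [vec_zero, zero_mul])
    obtain ⟨τ, k, hk⟩ := ih (right_ne_zero_of_mul hq)
    exact ⟨_, _, (of_vec hv).mul hk⟩

theorem inv_scalar_mul (h : IsLipschitz q σ n) : (σ * n⁻¹) * (σ * n) = 1 := by
  have := h.sign_sq
  have hn := h.pos.ne'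
  field_simp
  nlinarith

theorem mul_inv (h : IsLipschitz q σ n) : q * ((σ * n⁻¹) • reverse q) = 1 := by
  rw [mul_smul_comm, h.mul_reverse, smul_smul, h.inv_scalar_mul, one_smul]

theorem inv_mul (h : IsLipschitz q σ n) : ((σ * n⁻¹) • reverse q) * q = 1 := by
  rw [smul_mul_assoc, h.reverse_mul, smul_smul, h.inv_scalar_mul, one_smul]

theorem isUnit (h : IsLipschitz q σ n) : IsUnit q :=
  ⟨⟨q, (σ * n⁻¹) • reverse q, h.mul_inv, h.inv_mul⟩, rfl⟩

theorem ring_inverse (h : IsLipschitz q σ n) : Ring.inverse q = (σ * n⁻¹) • reverse q :=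
  Ring.inverse_unit (⟨q, (σ * n⁻¹) • reverse q, h.mul_inv, h.inv_mul⟩ : (Cl m)ˣ)

/-- Conjugation is reversion after the main involution, so the parity sign enters twice and cancels:
q times its conjugate is the positive scalar n. -/
theorem clNorm_eq (h : IsLipschitz q σ n) : clNorm q = Real.sqrt n := by
  rw [clNorm, h.involute_eq, reverse_real_smul, mul_smul_comm, h.mul_reverse, smul_smul,
    ← mul_assoc, h.sign_sq, one_mul, scalarPart_smul_one, Complex.ofReal_re]

theorem clNorm_pos (h : IsLipschitz q σ n) : 0 < clNorm q := by
  rw [h.clNorm_eq]; exact Real.sqrt_pos.2 h.pos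

theorem clNorm_sq (h : IsLipschitz q σ n) : clNorm q ^ 2 = n := by
  rw [h.clNorm_eq, Real.sq_sqrt h.pos.le]

theorem vec_rotate (h : IsLipschitz q σ n) (u : E m) :
    vec (rotate q u) = n⁻¹ • (q * vec u * reverse q) := by
  obtain ⟨w, hw⟩ := (h.conj u).smul n⁻¹
  rw [rotate, h.clNorm_sq]
  change vec (toVec (n⁻¹ • (q * vec u * reverse q))) = _
  rw [hw, toVec_vec]

theorem rotate_mul (hq : IsLipschitz q σ n) (hp : IsLipschitz p τ l) (u : E m) :
    rotate (q * p) u = rotate q (rotate p u) := by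
  apply vec_injective
  rw [(hq.mul hp).vec_rotate, hq.vec_rotate, hp.vec_rotate, reverse.map_mul]
  simp only [mul_smul_comm, smul_mul_assoc, smul_smul, mul_assoc, mul_inv_rev]
  congr 1; ring

theorem norm_rotate (h : IsLipschitz q σ n) (u : E m) : ‖rotate q u‖ = ‖u‖ := by
  have h1 := vec_sq (rotate q u)
  have h2 : vec (rotate q u) * vec (rotate q u) = (-(‖u‖ ^ 2)) • (1 : Cl m) := by
    rw [h.vec_rotate, smul_mul_assoc, mul_smul_comm, smul_smul]
    have : q * vec u * reverse q * (q * vec u * reverse q)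
        = q * vec u * (reverse q * q) * vec u * reverse q := by simp only [mul_assoc]
    rw [this, h.reverse_mul, mul_smul_comm, mul_one, smul_mul_assoc, mul_assoc q, vec_sq,
      mul_smul_comm, mul_one, smul_mul_assoc, smul_mul_assoc, h.mul_reverse]
    simp only [smul_smul]
    congr 1
    have := h.sign_sq
    have hn := h.pos.ne'
    field_simp
    nlinarith
  have h3 := smul_one_injective (h1.symm.trans h2)
  have h4 : ‖rotate q u‖ ^ 2 = ‖u‖ ^ 2 := by linarith
  exact (sq_eq_sq₀ (norm_nonneg _) (norm_nonneg _)).1 h4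

/-- The isometry `u ↦ q u q̃ / ‖q‖ ^ 2`. -/
def rot (h : IsLipschitz q σ n) : E m →ₗᵢ[ℝ] E m where
  toFun := rotate q
  map_add' u v := vec_injective (by
    simp only [vec_add, h.vec_rotate, mul_add, add_mul, smul_add])
  map_smul' r u := vec_injective (by
    simp only [vec_smul, h.vec_rotate, mul_smul_comm, smul_mul_assoc, RingHom.id_apply]
    rw [smul_comm])
  norm_map' := h.norm_rotate

theorem rot_apply (h : IsLipschitz q σ n) (u : E m) : h.rot u = rotate q u := rfl

/-- The source of the sign in the relation for 𝒟₃: a vector passes q̃ at the cost of the rotation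
attached to q and the parity sign σ. -/
theorem vec_mul_reverse (h : IsLipschitz q σ n) (u : E m) :
    vec u * reverse q = σ • (reverse q * vec (h.rot u)) := by
  rw [rot_apply, h.vec_rotate, mul_smul_comm, smul_smul]
  have : reverse q * (q * vec u * reverse q) = reverse q * q * (vec u * reverse q) := by
    simp only [mul_assoc]
  rw [this, h.reverse_mul, smul_mul_assoc, one_mul, smul_smul]
  rw [h.inv_scalar_mul, one_smul]

end IsLipschitz

/-! ### Möbius transformations near a regular point -/

section Vahlen

variable {a b c d : Cl m} {δ : ℝ}

theorem IsLipschitz.eq_of_reverse_mul {q w y : Cl m} {σ n : ℝ} (h : IsLipschitz q σ n)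
    (hw : reverse q * w = y) : w = (σ * n⁻¹) • (q * y) := by
  rw [← hw, ← mul_assoc, h.mul_reverse, smul_mul_assoc, one_mul, smul_smul, h.inv_scalar_mul,
    one_smul]

theorem IsLipschitz.eq_of_mul_reverse {q w y : Cl m} {σ n : ℝ} (h : IsLipschitz q σ n)
    (hw : w * reverse q = y) : w = (σ * n⁻¹) • (y * q) := by
  rw [← hw, mul_assoc, h.reverse_mul, mul_smul_comm, mul_one, smul_smul, h.inv_scalar_mul,
    one_smul]

/-- Near a regular point `x`, with `q = cx + d`, the matrix `(a, b; c, d)` acts by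
`x + h ↦ y + δ / ‖q‖ ^ 2 * R_q (h (1 + v h)⁻¹)`. -/
theorem IsVahlen.exists_local (hV : IsVahlen a b c d)
    (hδ : a * reverse d - b * reverse c = δ • (1 : Cl m)) (x : E m)
    (hx : c * vec x + d ≠ 0) :
    ∃ (σ n : ℝ) (y v : E m), IsLipschitz (c * vec x + d) σ n ∧
      c = (c * vec x + d) * vec v ∧ a * vec x + b = vec y * (c * vec x + d) ∧
      a = vec y * c + (δ * (σ * n⁻¹)) • (c * vec x + d) := by
  by_cases hc : c = 0
  -- The affine case. Here q = d, and d̃ is invertible, so the determinant gives a as a multiple of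
  -- d and the condition on d̃b gives b as d times a vector. Thus ax + b = d·(vector), and y is the
  -- conjugate of that vector by d, with d⁻¹ = σn⁻¹d̃.
  · subst hc
    simp only [zero_mul, zero_add, map_zero, mul_zero, sub_zero] at hx hδ ⊢
    obtain ⟨σ, n, hq⟩ := IsLipschitz.exists_of_isVecProd hV.prod_d hx
    obtain ⟨w, hw⟩ := hV.vec_db
    have ha := hq.eq_of_mul_reverse hδ
    rw [smul_mul_assoc, one_mul, smul_smul] at ha
    have hb := hq.eq_of_reverse_mul hw
    obtain ⟨y, hy⟩ := ((hq.conj ((σ * n⁻¹ * δ) • x + (σ * n⁻¹) • w)).smul (σ * n⁻¹))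
    refine ⟨σ, n, y, 0, hq, by rw [vec_zero, mul_zero], ?_, ?_⟩
    · have h1 : a * vec x + b = d * vec ((σ * n⁻¹ * δ) • x + (σ * n⁻¹) • w) := by
        rw [vec_add, vec_smul, vec_smul, mul_add, mul_smul_comm, mul_smul_comm, ← hb]
        nth_rw 1 [ha]
        rw [smul_mul_assoc]
      rw [h1, ← hy, smul_mul_assoc, mul_assoc (d * _), hq.reverse_mul, mul_smul_comm, mul_one,
        smul_smul, hq.inv_scalar_mul, one_smul]
    · rw [mul_comm δ]; exact ha
  · obtain ⟨τ, l, hc'⟩ := IsLipschitz.exists_of_isVecProd hV.prod_c hc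
    obtain ⟨w, hw⟩ := hV.vec_ca
    have ha := hc'.eq_of_reverse_mul hw
    -- α = ac⁻¹: since c̃a = w, one has a = τl⁻¹cw, and c⁻¹ = τl⁻¹c̃.
    obtain ⟨α, hα⟩ := (hc'.conj w).smul ((τ * l⁻¹) * (τ * l⁻¹))
    have haα : a = vec α * c := by
      rw [← hα, smul_mul_assoc, mul_assoc (c * _), hc'.reverse_mul, mul_smul_comm, mul_one,
        smul_smul, mul_assoc, hc'.inv_scalar_mul, mul_one]
      exact ha
    obtain ⟨z, hz⟩ := hV.vec_cd
    have hz' : d * reverse c = vec z := by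
      rw [← reverse_vec z, ← hz, reverse.map_mul, reverse_reverse]
    have hdz := hc'.eq_of_mul_reverse hz'
    -- w' = c⁻¹d, so that q = c(x + w') factors through a vector.
    obtain ⟨w', hw'⟩ := (hc'.conj' z).smul ((τ * l⁻¹) * (τ * l⁻¹))
    have hd : d = c * vec w' := by
      have h1 : c * (reverse c * vec z * c) = c * reverse c * (vec z * c) := by
        simp only [mul_assoc]
      rw [← hw', mul_smul_comm, h1, hc'.mul_reverse, smul_mul_assoc, one_mul, smul_smul,
        mul_assoc, hc'.inv_scalar_mul, mul_one]
      exact hdz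
    have hq : c * vec x + d = c * vec (x + w') := by rw [hd, vec_add, mul_add]
    have hs : x + w' ≠ 0 := by
      intro h
      rw [hq, h, vec_zero, mul_zero] at hx
      exact hx rfl
    have hqL := hc'.mul (IsLipschitz.of_vec hs)
    rw [← hq] at hqL
    have hns : ‖x + w'‖ ^ 2 ≠ 0 := by
      have := norm_pos_iff.2 hs
      positivity
    -- v is the Clifford inverse of x + w', hence c = qv.
    set v : E m := (-(‖x + w'‖ ^ 2)⁻¹) • (x + w') with hv
    have hcv : c = (c * vec x + d) * vec v := by
      rw [hq, hv, vec_smul, mul_smul_comm, mul_assoc, vec_sq, mul_smul_comm, mul_one, smul_smul,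
        neg_mul_neg, inv_mul_cancel₀ hns, one_smul]
    have hvv : vec v * vec v = (-(‖x + w'‖ ^ 2)⁻¹) • (1 : Cl m) := by
      rw [vec_sq, hv, norm_smul, mul_pow]
      congr 1
      rw [norm_neg, Real.norm_of_nonneg (by positivity)]
      field_simp
    -- Solving the determinant relation for b; τl⁻¹c is the inverse of c̃.
    have hb : b = vec α * d - (δ * (τ * l⁻¹)) • c := by
      have h1 : b * reverse c = vec α * vec z - δ • (1 : Cl m) := by
        rw [← hδ, haα, mul_assoc, hz]; abel
      rw [hc'.eq_of_mul_reverse h1, sub_mul, smul_sub, mul_assoc (vec α), smul_mul_assoc, one_mul,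
        smul_smul, mul_comm (τ * l⁻¹) δ, ← mul_smul_comm, ← hdz]
    -- β = qvq⁻¹ = cq⁻¹. It enters because ax + b = αq − δτl⁻¹c, which forces y = α − δτl⁻¹β.
    obtain ⟨β, hβ⟩ := (hqL.conj v).smul
      ((τ * -1) * (l * ‖x + w'‖ ^ 2)⁻¹)
    have hβq : vec β * (c * vec x + d) = c := by
      rw [← hβ, smul_mul_assoc, mul_assoc _ (reverse _), hqL.reverse_mul, mul_smul_comm, mul_one,
        smul_smul, hqL.inv_scalar_mul, one_smul, ← hcv]
    refine ⟨_, _, α - (δ * (τ * l⁻¹)) • β, v, hqL, hcv, ?_, ?_⟩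
    · rw [vec_sub, vec_smul, sub_mul, smul_mul_assoc, hβq, mul_add, hb, haα, mul_assoc]
      abel
    · have h2 : vec β * c = (-(‖x + w'‖ ^ 2)⁻¹) • (c * vec x + d) := by
        nth_rw 1 [hcv]
        rw [← mul_assoc, hβq]
        nth_rw 1 [hcv]
        rw [mul_assoc, hvv, mul_smul_comm, mul_one]
      rw [vec_sub, vec_smul, sub_mul, smul_mul_assoc, h2, ← haα, smul_smul, mul_inv]
      have : δ * (τ * l⁻¹) * -(‖x + w'‖ ^ 2)⁻¹ = δ * (τ * -1 * (l⁻¹ * (‖x + w'‖ ^ 2)⁻¹)) := by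
        ring
      rw [this]
      abel

/-- The sign ε must not depend on x, so it is read off at one regular point. If d = 0, the
determinant forces c ≠ 0, and then c times a basis vector is nonzero. -/
theorem IsVahlen.exists_regular (hm : 0 < m) (hδ : δ = 1 ∨ δ = -1)
    (hdet : a * reverse d - b * reverse c = δ • (1 : Cl m)) (hV : IsVahlen a b c d) :
    ∃ x : E m, c * vec x + d ≠ 0 := by
  by_cases hd : d = 0
  · have hc : c ≠ 0 := by
      rintro rfl
      rw [hd, map_zero, mul_zero, mul_zero, sub_zero] at hdet
      have := smul_one_injective (m := m) (r := 0) (by rw [← hdet, zero_smul])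
      rcases hδ with h | h <;> rw [h] at this <;> norm_num at this
    obtain ⟨τ, l, hc'⟩ := IsLipschitz.exists_of_isVecProd hV.prod_c hc
    have he : (e ⟨0, hm⟩ : E m) ≠ 0 := by
      intro h
      have : ‖(e ⟨0, hm⟩ : E m)‖ = 1 := by simp [e]
      rw [h, norm_zero] at this
      exact zero_ne_one this
    exact ⟨e ⟨0, hm⟩, by rw [hd, add_zero]; exact (hc'.mul (IsLipschitz.of_vec he)).ne_zero⟩
  · exact ⟨0, by rwa [vec_zero, mul_zero, zero_add]⟩

end Vahlen

end Clifford

end HigherSpin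

namespace HigherSpin

/-! ### Operator calculus in two vector variables

A module with operators `X i`, `U i` (multiplication by coordinates), `P i`, `Q i` (the corresponding
partial derivatives) and `C i` (multiplication by the basis vectors of the Clifford algebra). -/

/-- The relations of the Weyl algebra in the variables `x, u` and of the Clifford algebra. -/
structure WeylClifford (m : ℕ) (M : Type*) [AddCommGroup M] [Module ℝ M] where
  X : Fin m → M →ₗ[ℝ] M
  U : Fin m → M →ₗ[ℝ] M
  C : Fin m → M →ₗ[ℝ] M
  P : Fin m → M →ₗ[ℝ] M
  Q : Fin m → M →ₗ[ℝ] M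
  X_X : ∀ i j z, X i (X j z) = X j (X i z)
  U_U : ∀ i j z, U i (U j z) = U j (U i z)
  P_P : ∀ i j z, P i (P j z) = P j (P i z)
  Q_Q : ∀ i j z, Q i (Q j z) = Q j (Q i z)
  U_X : ∀ i j z, U i (X j z) = X j (U i z)
  C_X : ∀ i j z, C i (X j z) = X j (C i z)
  C_U : ∀ i j z, C i (U j z) = U j (C i z)
  P_X : ∀ i j z, P i (X j z) = X j (P i z) + (if i = j then (1 : ℝ) else 0) • z
  P_U : ∀ i j z, P i (U j z) = U j (P i z)
  P_C : ∀ i j z, P i (C j z) = C j (P i z)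
  Q_X : ∀ i j z, Q i (X j z) = X j (Q i z)
  Q_U : ∀ i j z, Q i (U j z) = U j (Q i z) + (if i = j then (1 : ℝ) else 0) • z
  Q_C : ∀ i j z, Q i (C j z) = C j (Q i z)
  Q_P : ∀ i j z, Q i (P j z) = P j (Q i z)
  C_C : ∀ i j z, C i (C j z) = -C j (C i z) - (2 : ℝ) • (if i = j then (1 : ℝ) else 0) • z

namespace WeylClifford

variable {m : ℕ} {M : Type*} [AddCommGroup M] [Module ℝ M] (W : WeylClifford m M)

/-- The contraction `∑ S_i T_i`. -/
def con (S T : Fin m → M →ₗ[ℝ] M) : M →ₗ[ℝ] M := ∑ i, S i ∘ₗ T i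

/-- The linear combination `∑ v_i T_i`. -/
def lin (v : Fin m → ℝ) (T : Fin m → M →ₗ[ℝ] M) : M →ₗ[ℝ] M := ∑ i, v i • T i

theorem con_apply (S T : Fin m → M →ₗ[ℝ] M) (z : M) : con S T z = ∑ i, S i (T i z) := by
  simp [con]

theorem lin_apply (v : Fin m → ℝ) (T : Fin m → M →ₗ[ℝ] M) (z : M) :
    lin v T z = ∑ i, v i • T i z := by
  simp [lin]

theorem map_ite_zero (T : M →ₗ[ℝ] M) (p : Prop) [Decidable p] (z : M) :
    T (if p then z else 0) = if p then T z else 0 := by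
  split_ifs <;> simp

/-- `⟨u, D_x⟩` -/
def A : M →ₗ[ℝ] M := con W.U W.P
/-- `⟨D_u, D_x⟩` -/
def B : M →ₗ[ℝ] M := con W.Q W.P
/-- `Δ_x` -/
def L : M →ₗ[ℝ] M := con W.P W.P
/-- `Δ_u` -/
def H : M →ₗ[ℝ] M := con W.Q W.Q
/-- `‖u‖ ^ 2` -/
def R : M →ₗ[ℝ] M := con W.U W.U
/-- `‖x‖ ^ 2` -/
def N : M →ₗ[ℝ] M := con W.X W.X
/-- The Euler operator in `u` -/
def Eu : M →ₗ[ℝ] M := con W.U W.Q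
/-- The Euler operator in `x` -/
def Ex : M →ₗ[ℝ] M := con W.X W.P
/-- `⟨x, D_u⟩` -/
def XQ : M →ₗ[ℝ] M := con W.X W.Q
/-- `⟨x, u⟩` -/
def XU : M →ₗ[ℝ] M := con W.X W.U
/-- The Dirac operator in `x` -/
def D : M →ₗ[ℝ] M := con W.C W.P
/-- The Dirac operator in `u` -/
def G : M →ₗ[ℝ] M := con W.C W.Q
/-- Left multiplication by the vector `u` -/
def uh : M →ₗ[ℝ] M := con W.C W.U
/-- Left multiplication by the vector `x` -/
def xh : M →ₗ[ℝ] M := con W.C W.X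
/-- `⟨v, x⟩` -/
def xv (v : Fin m → ℝ) : M →ₗ[ℝ] M := lin v W.X
/-- `⟨v, u⟩` -/
def uv (v : Fin m → ℝ) : M →ₗ[ℝ] M := lin v W.U
/-- `⟨v, D_x⟩` -/
def pv (v : Fin m → ℝ) : M →ₗ[ℝ] M := lin v W.P
/-- `⟨v, D_u⟩` -/
def qv (v : Fin m → ℝ) : M →ₗ[ℝ] M := lin v W.Q
/-- Left multiplication by the vector `v` -/
def vh (v : Fin m → ℝ) : M →ₗ[ℝ] M := lin v W.C

theorem A_apply (z : M) : W.A z = ∑ i, W.U i (W.P i z) := con_apply ..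
theorem B_apply (z : M) : W.B z = ∑ i, W.Q i (W.P i z) := con_apply ..
theorem L_apply (z : M) : W.L z = ∑ i, W.P i (W.P i z) := con_apply ..
theorem H_apply (z : M) : W.H z = ∑ i, W.Q i (W.Q i z) := con_apply ..
theorem R_apply (z : M) : W.R z = ∑ i, W.U i (W.U i z) := con_apply ..
theorem N_apply (z : M) : W.N z = ∑ i, W.X i (W.X i z) := con_apply ..
theorem Eu_apply (z : M) : W.Eu z = ∑ i, W.U i (W.Q i z) := con_apply ..
theorem Ex_apply (z : M) : W.Ex z = ∑ i, W.X i (W.P i z) := con_apply ..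
theorem XQ_apply (z : M) : W.XQ z = ∑ i, W.X i (W.Q i z) := con_apply ..
theorem XU_apply (z : M) : W.XU z = ∑ i, W.X i (W.U i z) := con_apply ..
theorem D_apply (z : M) : W.D z = ∑ i, W.C i (W.P i z) := con_apply ..
theorem G_apply (z : M) : W.G z = ∑ i, W.C i (W.Q i z) := con_apply ..
theorem uh_apply (z : M) : W.uh z = ∑ i, W.C i (W.U i z) := con_apply ..
theorem xh_apply (z : M) : W.xh z = ∑ i, W.C i (W.X i z) := con_apply ..

/-! #### Commutators with the generators -/

section Generators

variable (j : Fin m) (z : M)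

theorem A_X : W.A (W.X j z) = W.X j (W.A z) + W.U j z := by
  simp [map_ite_zero, A_apply, P_X, U_X, Finset.sum_add_distrib]
theorem A_U : W.A (W.U j z) = W.U j (W.A z) := by
  simp [A_apply, P_U, W.U_U]
theorem A_P : W.A (W.P j z) = W.P j (W.A z) := by
  simp [A_apply, P_U, W.P_P]
theorem A_C : W.A (W.C j z) = W.C j (W.A z) := by
  simp [A_apply, P_C, C_U]
theorem Q_A : W.Q j (W.A z) = W.A (W.Q j z) + W.P j z := by
  simp [A_apply, Q_U, Q_P, Finset.sum_add_distrib]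
theorem B_X : W.B (W.X j z) = W.X j (W.B z) + W.Q j z := by
  simp [map_ite_zero, B_apply, P_X, Q_X, Finset.sum_add_distrib]
theorem B_U : W.B (W.U j z) = W.U j (W.B z) + W.P j z := by
  simp [B_apply, P_U, Q_U, Finset.sum_add_distrib]
theorem B_P : W.B (W.P j z) = W.P j (W.B z) := by
  simp [B_apply, Q_P, W.P_P]
theorem B_Q : W.B (W.Q j z) = W.Q j (W.B z) := by
  simp [B_apply, ← Q_P, W.Q_Q]
theorem B_C : W.B (W.C j z) = W.C j (W.B z) := by
  simp [B_apply, P_C, Q_C]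
theorem L_X : W.L (W.X j z) = W.X j (W.L z) + (2 : ℝ) • W.P j z := by
  simp [map_ite_zero, L_apply, P_X, Finset.sum_add_distrib]; module
theorem L_U : W.L (W.U j z) = W.U j (W.L z) := by
  simp [L_apply, P_U]
theorem L_P : W.L (W.P j z) = W.P j (W.L z) := by
  simp [L_apply, W.P_P j]
theorem L_Q : W.L (W.Q j z) = W.Q j (W.L z) := by
  simp [L_apply, Q_P]
theorem H_U : W.H (W.U j z) = W.U j (W.H z) + (2 : ℝ) • W.Q j z := by
  simp [map_ite_zero, H_apply, Q_U, Finset.sum_add_distrib]; module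
theorem H_P : W.H (W.P j z) = W.P j (W.H z) := by
  simp [H_apply, Q_P]
theorem H_Q : W.H (W.Q j z) = W.Q j (W.H z) := by
  simp [H_apply, W.Q_Q j]
theorem H_C : W.H (W.C j z) = W.C j (W.H z) := by
  simp [H_apply, Q_C]
theorem Eu_U : W.Eu (W.U j z) = W.U j (W.Eu z) + W.U j z := by
  simp [map_ite_zero, Eu_apply, Q_U, W.U_U j, Finset.sum_add_distrib]
theorem Eu_Q : W.Eu (W.Q j z) = W.Q j (W.Eu z) - W.Q j z := by
  simp [Eu_apply, Q_U, W.Q_Q j, Finset.sum_add_distrib]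
theorem Eu_P : W.Eu (W.P j z) = W.P j (W.Eu z) := by
  simp [Eu_apply, P_U, Q_P]
theorem Eu_C : W.Eu (W.C j z) = W.C j (W.Eu z) := by
  simp [Eu_apply, C_U, Q_C]
theorem Q_R : W.Q j (W.R z) = W.R (W.Q j z) + (2 : ℝ) • W.U j z := by
  simp [map_ite_zero, R_apply, Q_U, Finset.sum_add_distrib]; module
theorem R_X : W.R (W.X j z) = W.X j (W.R z) := by
  simp [R_apply, U_X]
theorem R_U : W.R (W.U j z) = W.U j (W.R z) := by
  simp [R_apply, W.U_U j]
theorem R_C : W.R (W.C j z) = W.C j (W.R z) := by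
  simp [R_apply, C_U]
theorem R_P : W.R (W.P j z) = W.P j (W.R z) := by
  simp [R_apply, P_U]
theorem D_X : W.D (W.X j z) = W.X j (W.D z) + W.C j z := by
  simp [map_ite_zero, D_apply, P_X, C_X, Finset.sum_add_distrib]
theorem D_U : W.D (W.U j z) = W.U j (W.D z) := by
  simp [D_apply, P_U, C_U]
theorem D_P : W.D (W.P j z) = W.P j (W.D z) := by
  simp [D_apply, P_C, W.P_P j]
theorem D_Q : W.D (W.Q j z) = W.Q j (W.D z) := by
  simp [D_apply, Q_C, Q_P]
theorem D_C : W.D (W.C j z) = -W.C j (W.D z) - (2 : ℝ) • W.P j z := by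
  simp [D_apply, P_C, W.C_C _ j, Finset.sum_sub_distrib]
theorem G_P : W.G (W.P j z) = W.P j (W.G z) := by
  simp [G_apply, Q_P, P_C]
theorem G_Q : W.G (W.Q j z) = W.Q j (W.G z) := by
  simp [G_apply, Q_C, W.Q_Q j]
theorem G_C : W.G (W.C j z) = -W.C j (W.G z) - (2 : ℝ) • W.Q j z := by
  simp [G_apply, Q_C, W.C_C _ j, Finset.sum_sub_distrib]
theorem uh_C : W.uh (W.C j z) = -W.C j (W.uh z) - (2 : ℝ) • W.U j z := by
  simp [uh_apply, ← C_U, W.C_C _ j, Finset.sum_sub_distrib]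
theorem uh_X : W.uh (W.X j z) = W.X j (W.uh z) := by
  simp [uh_apply, U_X, C_X]
theorem uh_U : W.uh (W.U j z) = W.U j (W.uh z) := by
  simp [uh_apply, W.U_U _ j, C_U]
theorem P_uh : W.P j (W.uh z) = W.uh (W.P j z) := by
  simp [uh_apply, P_C, P_U]
theorem Q_uh : W.Q j (W.uh z) = W.uh (W.Q j z) + W.C j z := by
  simp [map_ite_zero, uh_apply, Q_C, Q_U, Finset.sum_add_distrib]

end Generators

theorem uv_apply (v : Fin m → ℝ) (z : M) : W.uv v z = ∑ i, v i • W.U i z := lin_apply ..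
theorem xv_apply (v : Fin m → ℝ) (z : M) : W.xv v z = ∑ i, v i • W.X i z := lin_apply ..
theorem pv_apply (v : Fin m → ℝ) (z : M) : W.pv v z = ∑ i, v i • W.P i z := lin_apply ..
theorem qv_apply (v : Fin m → ℝ) (z : M) : W.qv v z = ∑ i, v i • W.Q i z := lin_apply ..
theorem vh_apply (v : Fin m → ℝ) (z : M) : W.vh v z = ∑ i, v i • W.C i z := lin_apply ..

/-! #### Commutators of the invariant operators -/

section Invariant

variable (z : M) (v : Fin m → ℝ)

theorem A_Q (j : Fin m) : W.A (W.Q j z) = W.Q j (W.A z) - W.P j z := by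
  rw [Q_A, add_sub_cancel_right]
theorem R_Q (j : Fin m) : W.R (W.Q j z) = W.Q j (W.R z) - (2 : ℝ) • W.U j z := by
  rw [Q_R, add_sub_cancel_right]
theorem uh_Q (j : Fin m) : W.uh (W.Q j z) = W.Q j (W.uh z) - W.C j z := by
  rw [Q_uh, add_sub_cancel_right]
theorem C_sq (j : Fin m) : W.C j (W.C j z) = -z := by
  have h := W.C_C j j z
  rw [if_pos rfl, one_smul] at h
  have h2 : (2 : ℝ) • W.C j (W.C j z) = (2 : ℝ) • (-z) := by
    rw [two_smul]
    nth_rw 1 [h]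
    module
  exact smul_right_injective M (two_ne_zero : (2 : ℝ) ≠ 0) h2
theorem D_xv : W.D (W.xv v z) =
    W.xv v (W.D z) + W.vh v z := by
  simp [xv_apply, vh_apply, D_X, Finset.sum_add_distrib, smul_add]
theorem D_Ex : W.D (W.Ex z) =
    W.Ex (W.D z) + W.D z := by
  simp [Ex_apply, W.D_apply z, D_X, D_P, Finset.sum_add_distrib]
  exact Finset.sum_comm
theorem D_N : W.D (W.N z) =
    W.N (W.D z) + (2 : ℝ) • W.xh z := by
  simp [N_apply, xh_apply, D_X, C_X, Finset.sum_add_distrib]; module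
theorem D_pv : W.D (W.pv v z) =
    W.pv v (W.D z) := by
  simp [pv_apply, D_P]
theorem D_uv : W.D (W.uv v z) =
    W.uv v (W.D z) := by
  simp [uv_apply, D_U]
theorem D_qv : W.D (W.qv v z) =
    W.qv v (W.D z) := by
  simp [qv_apply, D_Q]
theorem D_XQ : W.D (W.XQ z) =
    W.XQ (W.D z) + W.G z := by
  simp [XQ_apply, G_apply, D_X, D_Q, Finset.sum_add_distrib]
theorem D_XU : W.D (W.XU z) =
    W.XU (W.D z) + W.uh z := by
  simp [XU_apply, uh_apply, D_X, D_U, Finset.sum_add_distrib]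
theorem D_xh : W.D (W.xh z) =
    -W.xh (W.D z) - (2 : ℝ) • W.Ex z - (m : ℝ) • z := by
  simp [xh_apply, Ex_apply, D_C, D_X, C_sq, P_X, ← Nat.cast_smul_eq_nsmul ℝ, Finset.sum_add_distrib, Finset.sum_sub_distrib, smul_add, ← Finset.smul_sum, smul_comm _ (2 : ℝ)]; module
theorem D_vh : W.D (W.vh v z) =
    -W.vh v (W.D z) - (2 : ℝ) • W.pv v z := by
  simp [vh_apply, pv_apply, D_C, Finset.sum_sub_distrib, smul_sub, ← Finset.smul_sum, smul_comm _ (2 : ℝ)]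
theorem D_L : W.D (W.L z) =
    W.L (W.D z) := by
  simp [L_apply, D_P]
theorem D_uh : W.D (W.uh z) =
    -W.uh (W.D z) - (2 : ℝ) • W.A z := by
  simp [uh_apply, A_apply, D_C, D_U, P_U, Finset.sum_sub_distrib, ← Finset.smul_sum]
theorem A_xv : W.A (W.xv v z) =
    W.xv v (W.A z) + W.uv v z := by
  simp [xv_apply, uv_apply, A_X, Finset.sum_add_distrib, smul_add]
theorem A_Ex : W.A (W.Ex z) =
    W.Ex (W.A z) + W.A z := by
  simp [Ex_apply, W.A_apply z, A_X, A_P, Finset.sum_add_distrib]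
  exact Finset.sum_comm
theorem A_N : W.A (W.N z) =
    W.N (W.A z) + (2 : ℝ) • W.XU z := by
  simp [N_apply, XU_apply, A_X, U_X, Finset.sum_add_distrib]; module
theorem A_pv : W.A (W.pv v z) =
    W.pv v (W.A z) := by
  simp [pv_apply, A_P]
theorem A_uv : W.A (W.uv v z) =
    W.uv v (W.A z) := by
  simp [uv_apply, A_U]
theorem A_XQ : W.A (W.XQ z) =
    W.XQ (W.A z) + W.Eu z - W.Ex z := by
  simp [XQ_apply, Eu_apply, Ex_apply, A_X, A_Q, Finset.sum_add_distrib, Finset.sum_sub_distrib]; module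
theorem A_XU : W.A (W.XU z) =
    W.XU (W.A z) + W.R z := by
  simp [XU_apply, R_apply, A_X, A_U, Finset.sum_add_distrib]
theorem A_xh : W.A (W.xh z) =
    W.xh (W.A z) + W.uh z := by
  simp [xh_apply, uh_apply, A_X, A_C, Finset.sum_add_distrib]
theorem A_vh : W.A (W.vh v z) =
    W.vh v (W.A z) := by
  simp [vh_apply, A_C]
theorem A_uh : W.A (W.uh z) =
    W.uh (W.A z) := by
  simp [uh_apply, A_U, A_C]
theorem A_D : W.A (W.D z) =
    W.D (W.A z) := by
  simp [D_apply, A_P, A_C]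
theorem A_R : W.A (W.R z) =
    W.R (W.A z) := by
  simp [R_apply, A_U]
theorem qv_A : W.qv v (W.A z) = W.A (W.qv v z) + W.pv v z := by
  simp [qv_apply, pv_apply, Q_A, Finset.sum_add_distrib]
theorem B_xv : W.B (W.xv v z) =
    W.xv v (W.B z) + W.qv v z := by
  simp [xv_apply, qv_apply, B_X, Finset.sum_add_distrib, smul_add]
theorem B_Ex : W.B (W.Ex z) =
    W.Ex (W.B z) + W.B z := by
  simp [Ex_apply, W.B_apply z, B_X, B_P, Finset.sum_add_distrib]
  exact Finset.sum_comm
theorem B_N : W.B (W.N z) =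
    W.N (W.B z) + (2 : ℝ) • W.XQ z := by
  simp [N_apply, XQ_apply, B_X, Q_X, Finset.sum_add_distrib]; module
theorem B_pv : W.B (W.pv v z) =
    W.pv v (W.B z) := by
  simp [pv_apply, B_P]
theorem B_uv : W.B (W.uv v z) =
    W.uv v (W.B z) + W.pv v z := by
  simp [uv_apply, pv_apply, B_U, Finset.sum_add_distrib, smul_add]
theorem B_qv : W.B (W.qv v z) =
    W.qv v (W.B z) := by
  simp [qv_apply, B_Q]
theorem B_XQ : W.B (W.XQ z) =
    W.XQ (W.B z) + W.H z := by
  simp [XQ_apply, H_apply, B_X, B_Q, Finset.sum_add_distrib]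
theorem B_XU : W.B (W.XU z) =
    W.XU (W.B z) + W.Ex z + W.Eu z + (m : ℝ) • z := by
  simp [XU_apply, Ex_apply, Eu_apply, B_X, B_U, Q_U, ← Nat.cast_smul_eq_nsmul ℝ, Finset.sum_add_distrib]; module
theorem B_xh : W.B (W.xh z) =
    W.xh (W.B z) + W.G z := by
  simp [xh_apply, G_apply, B_X, B_C, Finset.sum_add_distrib]
theorem B_vh : W.B (W.vh v z) =
    W.vh v (W.B z) := by
  simp [vh_apply, B_C]
theorem B_uh : W.B (W.uh z) =
    W.uh (W.B z) + W.D z := by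
  simp [uh_apply, D_apply, B_U, B_C, Finset.sum_add_distrib]
theorem B_R : W.B (W.R z) =
    W.R (W.B z) + (2 : ℝ) • W.A z := by
  simp [R_apply, A_apply, B_U, P_U, Finset.sum_add_distrib]; module
theorem B_A : W.B (W.A z) =
    W.A (W.B z) + W.L z := by
  simp [A_apply, L_apply, B_U, B_P, Finset.sum_add_distrib]
theorem B_D : W.B (W.D z) =
    W.D (W.B z) := by
  simp [D_apply, B_P, B_C]
theorem B_L : W.B (W.L z) =
    W.L (W.B z) := by
  simp [L_apply, B_P]
theorem L_xv : W.L (W.xv v z) =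
    W.xv v (W.L z) + (2 : ℝ) • W.pv v z := by
  simp [xv_apply, pv_apply, L_X, Finset.sum_add_distrib, smul_add, ← Finset.smul_sum, smul_comm _ (2 : ℝ)]
theorem L_Ex : W.L (W.Ex z) =
    W.Ex (W.L z) + (2 : ℝ) • W.L z := by
  simp [Ex_apply, W.L_apply z, L_X, L_P, Finset.sum_add_distrib, ← Finset.smul_sum]
  exact Finset.sum_comm
theorem L_N : W.L (W.N z) =
    W.N (W.L z) + (4 : ℝ) • W.Ex z + (2 * m : ℝ) • z := by
  simp [N_apply, Ex_apply, L_X, P_X, ← Nat.cast_smul_eq_nsmul ℝ, Finset.sum_add_distrib, smul_add, ← Finset.smul_sum, smul_comm _ (2 : ℝ)]; module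
theorem L_pv : W.L (W.pv v z) =
    W.pv v (W.L z) := by
  simp [pv_apply, L_P]
theorem L_uv : W.L (W.uv v z) =
    W.uv v (W.L z) := by
  simp [uv_apply, L_U]
theorem L_XQ : W.L (W.XQ z) =
    W.XQ (W.L z) + (2 : ℝ) • W.B z := by
  simp [XQ_apply, B_apply, L_X, L_Q, ← Q_P, Finset.sum_add_distrib, ← Finset.smul_sum]
theorem L_XU : W.L (W.XU z) =
    W.XU (W.L z) + (2 : ℝ) • W.A z := by
  simp [XU_apply, A_apply, L_X, L_U, P_U, Finset.sum_add_distrib, ← Finset.smul_sum]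
theorem L_qv : W.L (W.qv v z) =
    W.qv v (W.L z) := by
  simp [qv_apply, L_Q]
theorem L_A : W.L (W.A z) =
    W.A (W.L z) := by
  simp [A_apply, L_U, L_P]
theorem L_R : W.L (W.R z) =
    W.R (W.L z) := by
  simp [R_apply, L_U]
theorem R_xv : W.R (W.xv v z) =
    W.xv v (W.R z) := by
  simp [xv_apply, R_X]
theorem R_Ex : W.R (W.Ex z) =
    W.Ex (W.R z) := by
  simp [Ex_apply, R_X, R_P]
theorem R_N : W.R (W.N z) =
    W.N (W.R z) := by
  simp [N_apply, R_X]
theorem R_pv : W.R (W.pv v z) =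
    W.pv v (W.R z) := by
  simp [pv_apply, R_P]
theorem R_uv : W.R (W.uv v z) =
    W.uv v (W.R z) := by
  simp [uv_apply, R_U]
theorem R_XU : W.R (W.XU z) =
    W.XU (W.R z) := by
  simp [XU_apply, R_X, R_U]
theorem R_xh : W.R (W.xh z) =
    W.xh (W.R z) := by
  simp [xh_apply, R_X, R_C]
theorem R_vh : W.R (W.vh v z) =
    W.vh v (W.R z) := by
  simp [vh_apply, R_C]
theorem R_XQ : W.R (W.XQ z) =
    W.XQ (W.R z) - (2 : ℝ) • W.XU z := by
  simp [XQ_apply, XU_apply, R_X, R_Q, Finset.sum_sub_distrib, ← Finset.smul_sum]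
theorem R_qv : W.R (W.qv v z) =
    W.qv v (W.R z) - (2 : ℝ) • W.uv v z := by
  simp [qv_apply, uv_apply, R_Q, Finset.sum_sub_distrib, smul_sub, ← Finset.smul_sum, smul_comm _ (2 : ℝ)]
theorem uh_xv : W.uh (W.xv v z) =
    W.xv v (W.uh z) := by
  simp [xv_apply, uh_X]
theorem uh_N : W.uh (W.N z) =
    W.N (W.uh z) := by
  simp [N_apply, uh_X]
theorem uh_uv : W.uh (W.uv v z) =
    W.uv v (W.uh z) := by
  simp [uv_apply, uh_U]
theorem uh_XU : W.uh (W.XU z) =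
    W.XU (W.uh z) := by
  simp [XU_apply, uh_X, uh_U]
theorem uh_pv : W.uh (W.pv v z) =
    W.pv v (W.uh z) := by
  simp [pv_apply, ← P_uh]
theorem uh_Ex : W.uh (W.Ex z) =
    W.Ex (W.uh z) := by
  simp [Ex_apply, ← P_uh, uh_X]
theorem uh_R : W.uh (W.R z) =
    W.R (W.uh z) := by
  simp [R_apply, uh_U]
theorem uh_XQ : W.uh (W.XQ z) =
    W.XQ (W.uh z) - W.xh z := by
  simp [XQ_apply, xh_apply, uh_X, uh_Q, C_X, Finset.sum_sub_distrib]
theorem uh_qv : W.uh (W.qv v z) =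
    W.qv v (W.uh z) - W.vh v z := by
  simp [qv_apply, vh_apply, uh_Q, Finset.sum_sub_distrib, smul_sub]
theorem uh_xh : W.uh (W.xh z) =
    -W.xh (W.uh z) - (2 : ℝ) • W.XU z := by
  simp [xh_apply, XU_apply, uh_C, uh_X, U_X, Finset.sum_sub_distrib, ← Finset.smul_sum]
theorem uh_vh : W.uh (W.vh v z) =
    -W.vh v (W.uh z) - (2 : ℝ) • W.uv v z := by
  simp [vh_apply, uv_apply, uh_C, Finset.sum_sub_distrib, smul_sub, ← Finset.smul_sum, smul_comm _ (2 : ℝ)]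
theorem Eu_R : W.Eu (W.R z) =
    W.R (W.Eu z) + (2 : ℝ) • W.R z := by
  simp [R_apply, Eu_U, Finset.sum_add_distrib]; module
theorem Eu_A : W.Eu (W.A z) =
    W.A (W.Eu z) + W.A z := by
  simp [A_apply, Eu_U, Eu_P, Finset.sum_add_distrib]
theorem Eu_B : W.Eu (W.B z) =
    W.B (W.Eu z) - W.B z := by
  simp [B_apply, Eu_Q, Eu_P, Finset.sum_sub_distrib]
theorem Eu_D : W.Eu (W.D z) =
    W.D (W.Eu z) := by
  simp [D_apply, Eu_P, Eu_C]
theorem Eu_L : W.Eu (W.L z) =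
    W.L (W.Eu z) := by
  simp [L_apply, Eu_P]
theorem Eu_pv : W.Eu (W.pv v z) =
    W.pv v (W.Eu z) := by
  simp [pv_apply, Eu_P]
theorem Eu_uv : W.Eu (W.uv v z) =
    W.uv v (W.Eu z) + W.uv v z := by
  simp [uv_apply, Eu_U, Finset.sum_add_distrib, smul_add]
theorem Eu_qv : W.Eu (W.qv v z) =
    W.qv v (W.Eu z) - W.qv v z := by
  simp [qv_apply, Eu_Q, Finset.sum_sub_distrib, smul_sub]
theorem H_R : W.H (W.R z) =
    W.R (W.H z) + (4 : ℝ) • W.Eu z + (2 * m : ℝ) • z := by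
  simp [R_apply, Eu_apply, H_U, Q_U, ← Nat.cast_smul_eq_nsmul ℝ, Finset.sum_add_distrib, smul_add, ← Finset.smul_sum, smul_comm _ (2 : ℝ)]; module
theorem H_A : W.H (W.A z) =
    W.A (W.H z) + (2 : ℝ) • W.B z := by
  simp [A_apply, B_apply, H_U, H_P, Finset.sum_add_distrib, ← Finset.smul_sum]
theorem H_B : W.H (W.B z) =
    W.B (W.H z) := by
  simp [B_apply, H_Q, H_P]
theorem H_D : W.H (W.D z) =
    W.D (W.H z) := by
  simp [D_apply, H_P, H_C]
theorem H_L : W.H (W.L z) =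
    W.L (W.H z) := by
  simp [L_apply, H_P]
theorem G_D : W.G (W.D z) =
    -W.D (W.G z) - (2 : ℝ) • W.B z := by
  simp [D_apply, B_apply, G_C, G_P, Finset.sum_sub_distrib, ← Finset.smul_sum]
theorem G_vh : W.G (W.vh v z) =
    -W.vh v (W.G z) - (2 : ℝ) • W.qv v z := by
  simp [vh_apply, qv_apply, G_C, Finset.sum_sub_distrib, smul_sub, ← Finset.smul_sum, smul_comm _ (2 : ℝ)]
theorem G_B : W.G (W.B z) =
    W.B (W.G z) := by
  simp [B_apply, G_Q, G_P]
theorem G_L : W.G (W.L z) =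
    W.L (W.G z) := by
  simp [L_apply, G_P]
end Invariant

end WeylClifford
end HigherSpin

/-! ### Squares of the vector operators and the special conformal generators -/

namespace HigherSpin
namespace WeylClifford

variable {m : ℕ} {M : Type*} [AddCommGroup M] [Module ℝ M] (W : WeylClifford m M)

section Quadratic

variable (z : M) (v : Fin m → ℝ)

/-- Anticommuting the generators once gives D² = −D² − 2Δ; then 2 is cancelled. The same argument
gives `uh_uh` and `G_G`. -/
theorem D_D : W.D (W.D z) = -W.L z := by
  rw [W.D_apply z, L_apply, map_sum]
  have h : ∑ i, W.D (W.C i (W.P i z)) = -W.D (W.D z) - (2 : ℝ) • W.L z := by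
    simp only [D_C, D_P, Finset.sum_sub_distrib, Finset.sum_neg_distrib, ← Finset.smul_sum]
    rw [← W.D_apply (W.D z), ← L_apply]
  have h1 : ∑ i, W.D (W.C i (W.P i z)) = W.D (W.D z) := by
    rw [W.D_apply z, map_sum]
  rw [← h1] at h
  have h2 : (2 : ℝ) • ∑ i, W.D (W.C i (W.P i z)) = (2 : ℝ) • -∑ i, W.P i (W.P i z) := by
    rw [two_smul]
    nth_rw 1 [h]
    rw [L_apply]
    module
  exact smul_right_injective M (two_ne_zero : (2 : ℝ) ≠ 0) h2

theorem uh_uh : W.uh (W.uh z) = -W.R z := by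
  have h : W.uh (W.uh z) = -W.uh (W.uh z) - (2 : ℝ) • W.R z := by
    nth_rw 1 [W.uh_apply z]
    simp only [map_sum, uh_C, uh_U, Finset.sum_sub_distrib, Finset.sum_neg_distrib,
      ← Finset.smul_sum]
    rw [← W.uh_apply (W.uh z), ← R_apply]
  have h2 : (2 : ℝ) • W.uh (W.uh z) = (2 : ℝ) • -W.R z := by
    rw [two_smul]
    nth_rw 1 [h]
    module
  exact smul_right_injective M (two_ne_zero : (2 : ℝ) ≠ 0) h2

theorem G_G : W.G (W.G z) = -W.H z := by
  have h : W.G (W.G z) = -W.G (W.G z) - (2 : ℝ) • W.H z := by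
    nth_rw 1 [W.G_apply z]
    simp only [map_sum, G_C, G_Q, Finset.sum_sub_distrib, Finset.sum_neg_distrib,
      ← Finset.smul_sum]
    rw [← W.G_apply (W.G z), ← H_apply]
  have h2 : (2 : ℝ) • W.G (W.G z) = (2 : ℝ) • -W.H z := by
    rw [two_smul]
    nth_rw 1 [h]
    module
  exact smul_right_injective M (two_ne_zero : (2 : ℝ) ≠ 0) h2

theorem pv_XQ : W.pv v (W.XQ z) = W.XQ (W.pv v z) + W.qv v z := by
  simp [pv_apply, qv_apply, XQ_apply, P_X, ← Q_P, Finset.sum_add_distrib]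
  rw [Finset.sum_comm]
  simp [Finset.smul_sum]

theorem qv_Ex : W.qv v (W.Ex z) = W.Ex (W.qv v z) := by
  simp [qv_apply, Ex_apply, Q_X, Q_P, Finset.smul_sum]
  exact Finset.sum_comm

theorem vh_Ex : W.vh v (W.Ex z) = W.Ex (W.vh v z) := by
  simp [vh_apply, Ex_apply, C_X, P_C, Finset.smul_sum]
  exact Finset.sum_comm

theorem P_Ex (j : Fin m) : W.P j (W.Ex z) = W.Ex (W.P j z) + W.P j z := by
  simp [Ex_apply, P_X, W.P_P j, Finset.sum_add_distrib]

theorem pv_Ex : W.pv v (W.Ex z) = W.Ex (W.pv v z) + W.pv v z := by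
  simp [pv_apply, P_Ex, Finset.sum_add_distrib]

theorem uv_xh : W.uv v (W.xh z) = W.xh (W.uv v z) := by
  simp [uv_apply, xh_apply, ← C_U, U_X, Finset.smul_sum]
  exact Finset.sum_comm

theorem qv_R : W.qv v (W.R z) = W.R (W.qv v z) + (2 : ℝ) • W.uv v z := by
  rw [R_qv]; abel

theorem qv_uh : W.qv v (W.uh z) = W.uh (W.qv v z) + W.vh v z := by
  rw [uh_qv]; abel

end Quadratic

/-- The infinitesimal special conformal transformation in the direction `v`, on functions of
conformal weight `s`. -/
def K (v : Fin m → ℝ) (s : ℝ) (z : M) : M :=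
  (2 : ℝ) • W.xv v (W.Ex z) - W.N (W.pv v z) + (2 : ℝ) • W.uv v (W.XQ z)
    - (2 : ℝ) • W.XU (W.qv v z) + s • W.xv v z

/-- The infinitesimal special conformal transformation in the direction `v`, on spinor valued
functions. -/
def KS (v : Fin m → ℝ) (s : ℝ) (z : M) : M := W.K v s z + W.xh (W.vh v z)

section K

variable (v : Fin m → ℝ) (s : ℝ) (z z' : M) (r : ℝ)

/-- Like `B_K`, `L_K` and `D_KS`, this is covariance up to a multiple of ⟨v,x⟩ plus an error free of
x. The combinations `T3` and `T4` are those in which the errors cancel. -/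
theorem A_K : W.A (W.K v s z) = W.K v s (W.A z) + (2 : ℝ) • W.xv v (W.A z)
    + (2 : ℝ) • W.uv v (W.Eu z) - (2 : ℝ) • W.R (W.qv v z) + s • W.uv v z := by
  have h : W.A (W.qv v z) = W.qv v (W.A z) - W.pv v z := by rw [qv_A]; abel
  simp only [K, map_add, map_sub, map_smul, A_xv, A_Ex, A_N, A_pv, A_uv, A_XQ, A_XU, h]
  module

theorem B_K : W.B (W.K v s z) = W.K v s (W.B z) + (2 : ℝ) • W.xv v (W.B z)
    + (2 : ℝ) • W.uv v (W.H z) - (2 : ℝ) • W.Eu (W.qv v z) + (s + 2 - 2 * m) • W.qv v z := by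
  simp only [K, map_add, map_sub, map_smul, B_xv, B_Ex, B_N, B_pv, B_uv, B_XQ, B_XU, B_qv, pv_XQ,
    qv_Ex]
  module

/-- On functions independent of u the only error is the last term, which vanishes at s = m − 2, the
conformal weight of the classical Laplacian. -/
theorem L_K : W.L (W.K v s z) = W.K v s (W.L z) + (4 : ℝ) • W.xv v (W.L z)
    + (4 : ℝ) • W.uv v (W.B z) - (4 : ℝ) • W.A (W.qv v z) + (2 * s + 4 - 2 * m) • W.pv v z := by
  simp only [K, map_add, map_sub, map_smul, L_xv, L_Ex, L_N, L_pv, L_uv, L_XQ, L_XU, L_qv, pv_Ex]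
  module

/-- The u-part of K is an infinitesimal rotation, and ‖u‖² is rotation invariant. -/
theorem R_K : W.R (W.K v s z) = W.K v s (W.R z) := by
  have h (y : M) : W.XQ (W.R y) = W.R (W.XQ y) + (2 : ℝ) • W.XU y := by rw [R_XQ]; abel
  have h' (y : M) : W.XU (W.uv v y) = W.uv v (W.XU y) := by
    simp only [XU_apply, uv_apply, map_sum, map_smul, U_X, W.U_U, Finset.smul_sum]
    rw [Finset.sum_comm]
    simp only [W.U_U]
  simp only [K, map_add, map_sub, map_smul, R_xv, R_Ex, R_N, R_pv, R_uv, R_XU, qv_R, h, h']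
  module

theorem A_KS : W.A (W.KS v s z) = W.KS v s (W.A z) + (2 : ℝ) • W.xv v (W.A z)
    + (2 : ℝ) • W.uv v (W.Eu z) - (2 : ℝ) • W.R (W.qv v z) + s • W.uv v z
    + W.uh (W.vh v z) := by
  simp only [KS, map_add, A_K, A_xh, A_vh]
  module

theorem B_KS : W.B (W.KS v s z) = W.KS v s (W.B z) + (2 : ℝ) • W.xv v (W.B z)
    + (2 : ℝ) • W.uv v (W.H z) - (2 : ℝ) • W.Eu (W.qv v z) + (s + 2 - 2 * m) • W.qv v z
    + W.G (W.vh v z) := by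
  simp only [KS, map_add, B_K, B_xh, B_vh]
  module

theorem R_KS : W.R (W.KS v s z) = W.KS v s (W.R z) := by
  have h (y : M) : W.vh v (W.R y) = W.R (W.vh v y) := by rw [R_vh]
  simp only [KS, map_add, R_K, R_xh, h]

/-- On functions independent of u and for s = m this is the classical covariance of the Dirac
operator; the weight m − 2 used for 𝒟₃ leaves an error −2v, compensated by the higher order. -/
theorem D_KS : W.D (W.KS v s z) = W.KS v s (W.D z) + (2 : ℝ) • W.xv v (W.D z)
    + (2 : ℝ) • W.uv v (W.G z) - (2 : ℝ) • W.uh (W.qv v z) + (s - m) • W.vh v z := by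
  simp only [KS, K, map_add, map_sub, map_smul, map_neg, D_xv, D_Ex, D_N, D_pv, D_uv, D_XQ, D_XU,
    D_qv, D_xh, D_vh, vh_Ex]
  module

/-- Multiplication by the vector u does not commute with the rotation of u alone, but the spin term
xv rotates the Clifford factor along with it. -/
theorem uh_KS : W.uh (W.KS v s z) = W.KS v s (W.uh z) := by
  have h1 (y : M) : W.XQ (W.uh y) = W.uh (W.XQ y) + W.xh y := by rw [uh_XQ]; abel
  have h2 (y : M) : W.vh v (W.uh y) = -W.uh (W.vh v y) - (2 : ℝ) • W.uv v y := by
    rw [uh_vh]; abel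
  simp only [KS, K, map_add, map_sub, map_smul, map_neg, uh_xv, uh_Ex, uh_N, uh_pv, uh_uv, uh_XU,
    uh_xh, qv_uh, h1, h2, uv_xh]
  module

theorem K_add : W.K v s (z + z') = W.K v s z + W.K v s z' := by
  simp only [K, map_add]; module

theorem K_sub : W.K v s (z - z') = W.K v s z - W.K v s z' := by
  simp only [K, map_sub]; module

theorem K_smul : W.K v s (r • z) = r • W.K v s z := by
  simp only [K, map_smul]; module

theorem KS_add : W.KS v s (z + z') = W.KS v s z + W.KS v s z' := by
  simp only [KS, K_add, map_add]; module

theorem KS_sub : W.KS v s (z - z') = W.KS v s z - W.KS v s z' := by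
  simp only [KS, K_sub, map_sub]; module

theorem KS_smul : W.KS v s (r • z) = r • W.KS v s z := by
  simp only [KS, K_smul, map_smul]; module

theorem KS_zero : W.KS v s 0 = 0 := by
  simp [KS, K]

end K

end WeylClifford
end HigherSpin

/-! ### Covariance of the third and fourth order operators under the generators -/

namespace HigherSpin
namespace WeylClifford

variable {m : ℕ} {M : Type*} [AddCommGroup M] [Module ℝ M] (W : WeylClifford m M)

/-- The operator `𝒟₃`. -/
def T3 (k : ℕ) (z : M) : M :=
  W.D (W.D (W.D z))
    + (4 / ((m : ℝ) + 2 * k)) • W.A (W.B (W.D z))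
    - (4 / (((m : ℝ) + 2 * k) * (m + 2 * k - 2))) • W.R (W.B (W.B (W.D z)))
    - (2 / ((m : ℝ) + 2 * k)) • W.uh (W.B (W.D (W.D z)))
    - (8 / (((m : ℝ) + 2 * k) * (m + 2 * k - 2))) • W.uh (W.A (W.B (W.B z)))
    - (8 / (((m : ℝ) + 2 * k) * (m + 2 * k - 2) * (m + 2 * k - 4))) •
        W.uh (W.uh (W.uh (W.B (W.B (W.B z)))))

/-- The operator `𝒟₂`. -/
def T2 (k : ℕ) (z : M) : M :=
  W.L z - (4 / ((m : ℝ) + 2 * k - 2)) •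
    (W.A (W.B z) - (1 / ((m : ℝ) + 2 * k - 4)) • W.R (W.B (W.B z)))

/-- The operator `𝒟₄`. -/
def T4 (k : ℕ) (z : M) : M :=
  W.T2 k (W.T2 k z) - (8 / (((m : ℝ) + 2 * k - 2) * (m + 2 * k - 4))) • W.T2 k (W.L z)

variable (v : Fin m → ℝ) (z : M) (k : ℕ)

set_option maxHeartbeats 4000000 in
-- The right side is the generator of weight (m − 4) + 8 = m + 4 applied to 𝒟₄z, which is the weight
-- on the target side. Homogeneity and harmonicity turn `Eu` and `H` into scalars, after which every
-- error term is a multiple of an ordered word in the invariant operators.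
theorem T4_K (hm : (m : ℝ) + 2 * k - 2 ≠ 0) (hk : (m : ℝ) + 2 * k - 4 ≠ 0)
    (hE : W.Eu z = (k : ℝ) • z) (hH : W.H z = 0) :
    W.T4 k (W.K v (m - 4) z) = W.K v (m - 4) (W.T4 k z) + (8 : ℝ) • W.xv v (W.T4 k z) := by
  simp only [T4, T2, map_add, map_sub, map_smul, A_K, B_K, L_K, R_K, K_add, K_sub, K_smul,
    A_xv, B_xv, L_xv, R_xv, Eu_A, Eu_B, Eu_R, Eu_L, Eu_qv, Eu_uv, Eu_pv, H_A, H_B, H_R, H_L, hE, hH, B_A, B_R, B_uv, B_pv, B_qv, B_L, L_A, L_R, L_uv, L_pv, L_qv, qv_A, qv_R,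
    A_uv, A_pv, A_R, R_uv, R_pv, map_zero, smul_zero]
  -- All words are now in a common order, so only rational identities in m and k between their
  -- coefficients remain.
  match_scalars <;> field_simp <;> ring

set_option maxHeartbeats 4000000 in
-- As for 𝒟₄, with source weight m − 2 and target weight (m − 2) + 6 = m + 4; the Dirac equation in
-- u is used in place of harmonicity.
theorem T3_KS (hm : (m : ℝ) + 2 * k ≠ 0) (hm' : (m : ℝ) + 2 * k - 2 ≠ 0)
    (hk : (m : ℝ) + 2 * k - 4 ≠ 0)
    (hE : W.Eu z = (k : ℝ) • z) (hG : W.G z = 0) :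
    W.T3 k (W.KS v (m - 2) z) = W.KS v (m - 2) (W.T3 k z) + (6 : ℝ) • W.xv v (W.T3 k z) := by
  -- Monogenic functions are harmonic because the Dirac operator squares to −Δ_u.
  have hH : W.H z = 0 := by rw [← neg_eq_zero, ← G_G, hG, map_zero]
  have D_v (y : M) : W.D (W.vh v y) = -W.vh v (W.D y) - (2 : ℝ) • W.pv v y := W.D_vh y v
  have uh_v (y : M) : W.uh (W.vh v y) = -W.vh v (W.uh y) - (2 : ℝ) • W.uv v y := W.uh_vh y v
  have D_R (y : M) : W.D (W.R y) = W.R (W.D y) := by simp [R_apply, D_U]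
  simp only [T3, map_add, map_sub, map_smul, map_neg, A_KS, B_KS, D_KS, R_KS, uh_KS, KS_add, KS_sub,
    KS_smul, A_xv, B_xv, D_xv, R_xv, uh_xv, Eu_B, Eu_L, Eu_D, Eu_qv,
    H_B, H_L, H_D, G_B, G_L, G_D, G_vh,
    D_D, uh_uh, D_uh, B_uh, A_uh, uh_R, hE, hH, hG, B_A, B_D, B_vh, B_uv,
    B_pv, B_qv, B_L, A_D, A_vh, D_v, uh_v, ← D_qv, ← L_qv, D_uv, D_pv, D_L, uh_uv, uh_pv,
    R_vh, map_zero, smul_zero, neg_neg]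
  match_scalars <;> field_simp <;> ring

/-- Covers m = 4, k = 0, where the factor m + 2k − 4 vanishes and `T3_KS` does not apply. Without
dependence on u every term containing ⟨D_u, D_x⟩ dies, both on z and on its image under the
generator, and D_x³ alone is covariant. -/
theorem T3_KS_of_const (hQ : ∀ i, W.Q i z = 0) (k : ℕ) :
    W.T3 k (W.KS v (m - 2) z) = W.KS v (m - 2) (W.T3 k z) + (6 : ℝ) • W.xv v (W.T3 k z) := by
  have hE : W.Eu z = 0 := by simp [Eu_apply, hQ]
  have hG : W.G z = 0 := by simp [G_apply, hQ]
  have hq : W.qv v z = 0 := by simp [qv_apply, hQ]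
  have hB : W.B z = 0 := by simp [B_apply, Q_P, hQ]
  have hH : W.H z = 0 := by simp [H_apply, hQ]
  simp only [T3, map_add, map_sub, map_smul, map_neg, B_KS, D_KS, KS_add, KS_sub,
    B_xv, D_xv, H_L, H_D, G_L, G_D, G_vh, D_D,
    hH, hG, hq, hB, B_D, B_vh, B_pv, B_L, D_vh, ← D_qv, ← L_qv, D_pv, D_L,
    map_zero, smul_zero, neg_neg, neg_zero, KS_zero]
  match_scalars <;> ring

end WeylClifford
end HigherSpin

namespace HigherSpin

open TopologicalSpace
open scoped CliffordModule

/-! ### Smooth functions of `(t, x, u)` -/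

section FunctionSpace

variable {m : ℕ}

/-- The space of the variables `(t, x, u)`. -/
abbrev V (m : ℕ) : Type := ℝ × E m × E m

/-- Clifford valued functions which are smooth on the open set `O` and vanish outside `O`. -/
def Sp (O : Opens (V m)) : Submodule ℝ (V m → Cl m) where
  carrier := {F | ContDiffOn ℝ ∞ F O ∧ ∀ p ∉ O, F p = 0}
  add_mem' := fun hF hG => ⟨hF.1.add hG.1, fun p hp => by simp [hF.2 p hp, hG.2 p hp]⟩
  zero_mem' := ⟨contDiffOn_const, fun _ _ => rfl⟩
  smul_mem' := fun r F hF => ⟨hF.1.const_smul r, fun p hp => by simp [hF.2 p hp]⟩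

namespace Sp

variable {O : Opens (V m)}

instance : CoeFun (Sp O) (fun _ => V m → Cl m) := ⟨Subtype.val⟩

theorem ext' {F G : Sp O} (h : ∀ p ∈ O, F p = G p) : F = G := by
  apply Subtype.ext
  funext p
  by_cases hp : p ∈ O
  · exact h p hp
  · rw [F.2.2 p hp, G.2.2 p hp]

theorem add_apply (F G : Sp O) (p : V m) : (F + G) p = F p + G p := rfl
theorem sub_apply (F G : Sp O) (p : V m) : (F - G) p = F p - G p := rfl
theorem neg_apply (F : Sp O) (p : V m) : (-F) p = -F p := rfl
theorem zero_apply (p : V m) : (0 : Sp O) p = 0 := rfl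
theorem smul_apply (r : ℝ) (F : Sp O) (p : V m) : (r • F) p = r • F p := rfl

theorem sum_apply {ι : Type*} (s : Finset ι) (F : ι → Sp O) (p : V m) :
    (∑ i ∈ s, F i) p = ∑ i ∈ s, F i p := by
  induction s using Finset.cons_induction with
  | empty => simp [zero_apply]
  | cons a s ha ih => rw [Finset.sum_cons, Finset.sum_cons, add_apply, ih]

theorem nhds_mem {p : V m} (hp : p ∈ O) : (O : Set (V m)) ∈ nhds p := O.isOpen.mem_nhds hp

theorem contDiffAt (F : Sp O) {p : V m} (hp : p ∈ O) : ContDiffAt ℝ ∞ F p :=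
  F.2.1.contDiffAt (nhds_mem hp)

theorem differentiableAt (F : Sp O) {p : V m} (hp : p ∈ O) : DifferentiableAt ℝ F p :=
  (contDiffAt F hp).differentiableAt (by simp)

/-- Left multiplication by a Clifford number, as a continuous linear map. -/
def mulCLM (z : Cl m) : Cl m →L[ℝ] Cl m :=
  LinearMap.toContinuousLinearMap
    { toFun := fun y => z * y
      map_add' := mul_add z
      map_smul' := fun r y => mul_smul_comm r z y }

theorem mulCLM_apply (z y : Cl m) : mulCLM z y = z * y := rfl

open Classical in
/-- The derivative in the direction `w`. -/
def pd (w : V m) : Sp O →ₗ[ℝ] Sp O where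
  toFun F := ⟨fun p => if p ∈ O then fderiv ℝ F p w else 0, by
    refine ⟨?_, fun p hp => if_neg hp⟩
    have h : ContDiffOn ℝ ∞ (fun p => fderiv ℝ F p w) O :=
      (F.2.1.fderiv_of_isOpen O.isOpen (by simp)).clm_apply contDiffOn_const
    exact h.congr fun p hp => if_pos hp⟩
  map_add' F G := ext' fun p hp => by
    have : fderiv ℝ (F + G : Sp O) p = fderiv ℝ F p + fderiv ℝ G p :=
      fderiv_add (differentiableAt F hp) (differentiableAt G hp)
    simp only [hp, if_true, add_apply]
    rw [this]; rfl
  map_smul' r F := ext' fun p hp => by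
    have : fderiv ℝ (r • F : Sp O) p = r • fderiv ℝ F p :=
      fderiv_const_smul (differentiableAt F hp) r
    simp only [hp, if_true, smul_apply]
    rw [this]; rfl

theorem pd_apply (w : V m) (F : Sp O) {p : V m} (hp : p ∈ O) : pd w F p = fderiv ℝ F p w :=
  if_pos hp

theorem pd_eventuallyEq (w : V m) (F : Sp O) {p : V m} (hp : p ∈ O) :
    (pd w F : V m → Cl m) =ᶠ[nhds p] fun q => fderiv ℝ F q w := by
  filter_upwards [nhds_mem hp] with q hq using pd_apply w F hq

/-- Multiplication by a linear function. -/
def mu (ℓ : V m →L[ℝ] ℝ) : Sp O →ₗ[ℝ] Sp O where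
  toFun F := ⟨fun p => ℓ p • F p, ℓ.contDiff.contDiffOn.smul F.2.1, fun p hp => by
    simp [F.2.2 p hp]⟩
  map_add' F G := ext' fun p _ => smul_add (ℓ p) (F p) (G p)
  map_smul' r F := ext' fun p _ => smul_comm (ℓ p) r (F p)

theorem mu_apply (ℓ : V m →L[ℝ] ℝ) (F : Sp O) (p : V m) : mu ℓ F p = ℓ p • F p := rfl

/-- Left multiplication by a Clifford number. -/
def cl (z : Cl m) : Sp O →ₗ[ℝ] Sp O where
  toFun F := ⟨fun p => z * F p, (mulCLM z).contDiff.comp_contDiffOn F.2.1, fun p hp => by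
    simp [F.2.2 p hp]⟩
  map_add' F G := ext' fun p _ => mul_add z (F p) (G p)
  map_smul' r F := ext' fun p _ => mul_smul_comm r z (F p)

theorem cl_apply (z : Cl m) (F : Sp O) (p : V m) : cl z F p = z * F p := rfl

theorem pd_pd (w w' : V m) (F : Sp O) : pd w (pd w' F) = pd w' (pd w F) := by
  refine ext' fun p hp => ?_
  have key (a b : V m) : pd a (pd b F) p = fderiv ℝ (fderiv ℝ F) p a b := by
    rw [pd_apply _ _ hp, (pd_eventuallyEq b F hp).fderiv_eq, fderiv_clm_apply]
    · simp
    · exact ((contDiffAt F hp).fderiv_right (m := 1) (by norm_cast)).differentiableAt (by simp)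
    · exact differentiableAt_const _
  rw [key, key]
  exact (contDiffAt F hp).isSymmSndFDerivAt (by simpa using WithTop.coe_le_coe.2 (le_top : (2 : ℕ∞) ≤ ⊤)) _ _

theorem pd_mu (w : V m) (ℓ : V m →L[ℝ] ℝ) (F : Sp O) :
    pd w (mu ℓ F) = mu ℓ (pd w F) + ℓ w • F := by
  refine ext' fun p hp => ?_
  rw [pd_apply _ _ hp, add_apply, mu_apply, pd_apply _ _ hp, smul_apply]
  have : fderiv ℝ (mu ℓ F : Sp O) p = ℓ p • fderiv ℝ F p + (fderiv ℝ ℓ p).smulRight (F p) :=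
    fderiv_fun_smul ℓ.differentiableAt (differentiableAt F hp)
  rw [this]
  simp

theorem pd_cl (w : V m) (z : Cl m) (F : Sp O) : pd w (cl z F) = cl z (pd w F) := by
  refine ext' fun p hp => ?_
  rw [pd_apply _ _ hp, cl_apply, pd_apply _ _ hp]
  have : fderiv ℝ (cl z F : Sp O) p = (mulCLM z).comp (fderiv ℝ F p) :=
    (mulCLM z).hasFDerivAt.comp p (differentiableAt F hp).hasFDerivAt |>.fderiv
  rw [this]
  rfl

theorem mu_mu (ℓ ℓ' : V m →L[ℝ] ℝ) (F : Sp O) : mu ℓ (mu ℓ' F) = mu ℓ' (mu ℓ F) :=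
  ext' fun p _ => smul_comm (ℓ p) (ℓ' p) (F p)

theorem cl_mu (z : Cl m) (ℓ : V m →L[ℝ] ℝ) (F : Sp O) : cl z (mu ℓ F) = mu ℓ (cl z F) :=
  ext' fun p _ => mul_smul_comm (ℓ p) z (F p)

/-- The coordinate `x_i`. -/
def xc (i : Fin m) : V m →L[ℝ] ℝ :=
  (EuclideanSpace.proj i).comp ((ContinuousLinearMap.fst ℝ (E m) (E m)).comp
    (ContinuousLinearMap.snd ℝ ℝ (E m × E m)))

/-- The coordinate `u_i`. -/
def uc (i : Fin m) : V m →L[ℝ] ℝ :=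
  (EuclideanSpace.proj i).comp ((ContinuousLinearMap.snd ℝ (E m) (E m)).comp
    (ContinuousLinearMap.snd ℝ ℝ (E m × E m)))

theorem xc_apply (i : Fin m) (p : V m) : xc i p = p.2.1 i := rfl
theorem uc_apply (i : Fin m) (p : V m) : uc i p = p.2.2 i := rfl

theorem e_apply (i j : Fin m) : (e i : E m) j = if j = i then 1 else 0 := by
  simp [e]

theorem inner_e_e (i j : Fin m) : inner ℝ (e i : E m) (e j) = if i = j then (1 : ℝ) else 0 := by
  simp [e, EuclideanSpace.inner_single_left]

/-- The operators on `Sp O`. -/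
def ops (O : Opens (V m)) : WeylClifford m (Sp O) where
  X i := mu (xc i)
  U i := mu (uc i)
  C i := cl (vec (e i))
  P i := pd (0, e i, 0)
  Q i := pd (0, 0, e i)
  X_X _ _ _ := mu_mu _ _ _
  U_U _ _ _ := mu_mu _ _ _
  P_P _ _ _ := pd_pd _ _ _
  Q_Q _ _ _ := pd_pd _ _ _
  U_X _ _ _ := mu_mu _ _ _
  C_X _ _ _ := cl_mu _ _ _
  C_U _ _ _ := cl_mu _ _ _
  P_X i j z := by rw [pd_mu, xc_apply, e_apply]; simp only [eq_comm]
  P_U i j z := by rw [pd_mu, uc_apply]; simp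
  P_C _ _ _ := pd_cl _ _ _
  Q_X i j z := by rw [pd_mu, xc_apply]; simp
  Q_U i j z := by rw [pd_mu, uc_apply, e_apply]; simp only [eq_comm]
  Q_C _ _ _ := pd_cl _ _ _
  Q_P _ _ _ := pd_pd _ _ _
  C_C i j z := by
    refine ext' fun p _ => ?_
    simp only [sub_apply, neg_apply, smul_apply, cl_apply]
    rw [← mul_assoc, vec_mul_swap, inner_e_e, sub_mul, smul_mul_assoc, one_mul, mul_assoc,
      smul_smul]
    module

/-- The derivative in `t`. -/
def dt : Sp O →ₗ[ℝ] Sp O := pd (1, 0, 0)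

theorem dt_U (i : Fin m) (z : Sp O) : dt ((ops O).U i z) = (ops O).U i (dt z) := by
  change pd _ (mu _ _) = mu _ (pd _ _)
  rw [pd_mu, uc_apply]; simp

theorem dt_P (i : Fin m) (z : Sp O) : dt ((ops O).P i z) = (ops O).P i (dt z) := pd_pd _ _ _

theorem dt_Q (i : Fin m) (z : Sp O) : dt ((ops O).Q i z) = (ops O).Q i (dt z) := pd_pd _ _ _

theorem dt_C (i : Fin m) (z : Sp O) : dt ((ops O).C i z) = (ops O).C i (dt z) := pd_cl _ _ _

open WeylClifford

theorem dt_T3 (k : ℕ) (z : Sp O) : dt ((ops O).T3 k z) = (ops O).T3 k (dt z) := by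
  have hD (y : Sp O) : dt ((ops O).D y) = (ops O).D (dt y) := by
    simp [D_apply, dt_C, dt_P]
  have hA (y : Sp O) : dt ((ops O).A y) = (ops O).A (dt y) := by
    simp [A_apply, dt_U, dt_P]
  have hB (y : Sp O) : dt ((ops O).B y) = (ops O).B (dt y) := by
    simp [B_apply, dt_Q, dt_P]
  have hR (y : Sp O) : dt ((ops O).R y) = (ops O).R (dt y) := by
    simp [WeylClifford.R_apply, dt_U]
  have hu (y : Sp O) : dt ((ops O).uh y) = (ops O).uh (dt y) := by
    simp [uh_apply, dt_C, dt_U]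
  simp only [T3, map_add, map_sub, map_smul, hD, hA, hB, hR, hu]

theorem dt_T4 (k : ℕ) (z : Sp O) : dt ((ops O).T4 k z) = (ops O).T4 k (dt z) := by
  have hL (y : Sp O) : dt ((ops O).L y) = (ops O).L (dt y) := by
    simp [WeylClifford.L_apply, dt_P]
  have hA (y : Sp O) : dt ((ops O).A y) = (ops O).A (dt y) := by
    simp [A_apply, dt_U, dt_P]
  have hB (y : Sp O) : dt ((ops O).B y) = (ops O).B (dt y) := by
    simp [B_apply, dt_Q, dt_P]
  have hR (y : Sp O) : dt ((ops O).R y) = (ops O).R (dt y) := by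
    simp [WeylClifford.R_apply, dt_U]
  simp only [T4, T2, map_sub, map_smul, hL, hA, hB, hR]

end Sp

end FunctionSpace

end HigherSpin

/-! ### From operators on smooth functions of (t, x, u) to the pointwise differential operators -/

namespace HigherSpin

open TopologicalSpace WeylClifford Sp
open scoped CliffordModule

section Representation

variable {m : ℕ} {O : Opens (V m)}

theorem vec_eq_sum (u : E m) : vec u = ∑ i, u i • vec (e i) := by
  have h : u = ∑ i, u i • (e i : E m) := by
    ext j
    simp [e, Pi.single_apply]
  conv_lhs => rw [h, ← vecL_apply, map_sum]
  simp only [map_smul, vecL_apply]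

namespace Sp

theorem uh_eval (z : Sp O) (p : V m) : (ops O).uh z p = vec p.2.2 * z p := by
  rw [uh_apply, sum_apply, vec_eq_sum, Finset.sum_mul]
  refine Finset.sum_congr rfl fun i _ => ?_
  change vec (e i) * (p.2.2 i • z p) = _
  rw [mul_smul_comm, smul_mul_assoc]

theorem xh_eval (z : Sp O) (p : V m) : (ops O).xh z p = vec p.2.1 * z p := by
  rw [xh_apply, sum_apply, vec_eq_sum, Finset.sum_mul]
  refine Finset.sum_congr rfl fun i _ => ?_
  change vec (e i) * (p.2.1 i • z p) = _
  rw [mul_smul_comm, smul_mul_assoc]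

theorem R_eval (z : Sp O) (p : V m) : (ops O).R z p = (‖p.2.2‖ ^ 2) • z p := by
  rw [WeylClifford.R_apply, sum_apply, EuclideanSpace.norm_sq_eq, Finset.sum_smul]
  refine Finset.sum_congr rfl fun i _ => ?_
  change p.2.2 i • p.2.2 i • z p = _
  rw [smul_smul, Real.norm_eq_abs, sq_abs, sq]

theorem N_eval (z : Sp O) (p : V m) : (ops O).N z p = (‖p.2.1‖ ^ 2) • z p := by
  rw [WeylClifford.N_apply, sum_apply, EuclideanSpace.norm_sq_eq, Finset.sum_smul]
  refine Finset.sum_congr rfl fun i _ => ?_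
  change p.2.1 i • p.2.1 i • z p = _
  rw [smul_smul, Real.norm_eq_abs, sq_abs, sq]

end Sp

theorem D3_apply (k : ℕ) (F : E m → E m → Cl m) (x u : E m) : D3 k F x u =
    diracX (diracX (diracX F)) x u
      + (4 / ((m : ℝ) + 2 * k)) • uDx (duDx (diracX F)) x u
      - (4 * ‖u‖ ^ 2 / (((m : ℝ) + 2 * k) * (m + 2 * k - 2))) • duDx (duDx (diracX F)) x u
      - (2 / ((m : ℝ) + 2 * k)) • (vec u * duDx (diracX (diracX F)) x u)
      - (8 / (((m : ℝ) + 2 * k) * (m + 2 * k - 2))) • (vec u * uDx (duDx (duDx F)) x u)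
      - (8 / (((m : ℝ) + 2 * k) * (m + 2 * k - 2) * (m + 2 * k - 4))) •
          (vec u ^ 3 * duDx (duDx (duDx F)) x u) := rfl

theorem D2_apply (k : ℕ) (F : E m → E m → Cl m) (x u : E m) : D2 k F x u =
    lapX F x u
      - (4 / ((m : ℝ) + 2 * k - 2)) •
          (uDx (duDx F) x u - (‖u‖ ^ 2 / ((m : ℝ) + 2 * k - 4)) • duDx (duDx F) x u) := rfl

theorem D4_apply (k : ℕ) (F : E m → E m → Cl m) (x u : E m) : D4 k F x u =
    D2 k (D2 k F) x u
      - (8 / (((m : ℝ) + 2 * k - 2) * (m + 2 * k - 4))) • D2 k (lapX F) x u := rfl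

theorem uDx_apply (F : E m → E m → Cl m) (x u : E m) :
    uDx F x u = ∑ i, u i • dX i F x u := rfl

/-- `F` is given near `x₀` by the slice of `G` at time `t`. -/
def Rep (t : ℝ) (x₀ : E m) (F : E m → E m → Cl m) (G : Sp O) : Prop :=
  ∀ x u, (t, x, u) ∈ O → F (x₀ + x) u = G (t, x, u)

namespace Rep

variable {t : ℝ} {x₀ : E m} {F : E m → E m → Cl m} {G : Sp O}

/-- The derivative sees only the germ, and O is open. Hence F need not be smooth, or even
meaningful, elsewhere; this matters because the Möbius pullback has a pole. -/
theorem dX (h : Rep t x₀ F G) (i : Fin m) : Rep t x₀ (dX i F) ((ops O).P i G) := by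
  intro x u hp
  have h1 : (fun y : E m => F (x₀ + y) u) =ᶠ[nhds x] fun y => G (t, y, u) := by
    have hc : Continuous fun y : E m => ((t, y, u) : V m) := by fun_prop
    filter_upwards [hc.continuousAt.preimage_mem_nhds (nhds_mem hp)] with y hy using h y u hy
  have h2 := h1.fderiv_eq (𝕜 := ℝ)
  rw [fderiv_comp_add_left x₀ (f := fun y => F y u)] at h2
  have h3 : HasFDerivAt (fun y : E m => ((t, y, u) : V m))
      ((0 : E m →L[ℝ] ℝ).prod ((ContinuousLinearMap.id ℝ (E m)).prod 0)) x :=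
    (hasFDerivAt_const t x).prodMk ((hasFDerivAt_id x).prodMk (hasFDerivAt_const u x))
  have h4 := ((differentiableAt G hp).hasFDerivAt.comp x h3).fderiv
  change fderiv ℝ (fun y => F y u) (x₀ + x) (e i) = pd (0, e i, 0) G (t, x, u)
  rw [h2, pd_apply _ _ hp]
  change fderiv ℝ ((G : V m → Cl m) ∘ fun y : E m => ((t, y, u) : V m)) x (e i) = _
  rw [h4]
  rfl

theorem dU (h : Rep t x₀ F G) (i : Fin m) : Rep t x₀ (dU i F) ((ops O).Q i G) := by
  intro x u hp
  have h1 : (fun y : E m => F (x₀ + x) y) =ᶠ[nhds u] fun y => G (t, x, y) := by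
    have hc : Continuous fun y : E m => ((t, x, y) : V m) := by fun_prop
    filter_upwards [hc.continuousAt.preimage_mem_nhds (nhds_mem hp)] with y hy using h x y hy
  have h3 : HasFDerivAt (fun y : E m => ((t, x, y) : V m))
      ((0 : E m →L[ℝ] ℝ).prod ((0 : E m →L[ℝ] E m).prod (ContinuousLinearMap.id ℝ (E m)))) u :=
    (hasFDerivAt_const t u).prodMk ((hasFDerivAt_const x u).prodMk (hasFDerivAt_id u))
  have h4 := ((differentiableAt G hp).hasFDerivAt.comp u h3).fderiv
  change fderiv ℝ (fun y => F (x₀ + x) y) u (e i) = pd (0, 0, e i) G (t, x, u)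
  rw [h1.fderiv_eq, pd_apply _ _ hp]
  change fderiv ℝ ((G : V m → Cl m) ∘ fun y : E m => ((t, x, y) : V m)) u (e i) = _
  rw [h4]
  rfl

theorem diracX (h : Rep t x₀ F G) : Rep t x₀ (diracX F) ((ops O).D G) := by
  intro x u hp
  rw [D_apply, sum_apply]
  exact Finset.sum_congr rfl fun i _ => by rw [h.dX i x u hp]; rfl

theorem lapX (h : Rep t x₀ F G) : Rep t x₀ (lapX F) ((ops O).L G) := by
  intro x u hp
  rw [WeylClifford.L_apply, sum_apply]
  exact Finset.sum_congr rfl fun i _ => (h.dX i).dX i x u hp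

theorem duDx (h : Rep t x₀ F G) : Rep t x₀ (duDx F) ((ops O).B G) := by
  intro x u hp
  rw [B_apply, sum_apply]
  exact Finset.sum_congr rfl fun i _ => (h.dX i).dU i x u hp

theorem uDx (h : Rep t x₀ F G) : Rep t x₀ (uDx F) ((ops O).A G) := by
  intro x u hp
  rw [A_apply, sum_apply, uDx_apply]
  exact Finset.sum_congr rfl fun i _ => by rw [h.dX i x u hp]; rfl

theorem D3 (h : Rep t x₀ F G) (k : ℕ) : Rep t x₀ (D3 k F) ((ops O).T3 k G) := by
  intro x u hp
  simp only [D3_apply, T3, add_apply, sub_apply, smul_apply, uh_eval, R_eval]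
  rw [h.diracX.diracX.diracX x u hp, h.diracX.duDx.uDx x u hp, h.diracX.duDx.duDx x u hp,
    h.diracX.diracX.duDx x u hp, h.duDx.duDx.uDx x u hp, h.duDx.duDx.duDx x u hp, smul_smul,
    pow_three, mul_assoc (vec u) (vec u * vec u), mul_assoc (vec u) (vec u), div_mul_eq_mul_div]

theorem D2 (h : Rep t x₀ F G) (k : ℕ) : Rep t x₀ (D2 k F) ((ops O).T2 k G) := by
  intro x u hp
  simp only [D2_apply, T2, sub_apply, smul_apply, R_eval]
  rw [h.lapX x u hp, h.duDx.uDx x u hp, h.duDx.duDx x u hp, smul_smul, one_div,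
    div_eq_inv_mul (‖u‖ ^ 2)]

theorem D4 (h : Rep t x₀ F G) (k : ℕ) : Rep t x₀ (D4 k F) ((ops O).T4 k G) := by
  intro x u hp
  simp only [D4_apply, T4, sub_apply, smul_apply]
  rw [(h.D2 k).D2 k x u hp, h.lapX.D2 k x u hp]

end Rep

end Representation

end HigherSpin

/-! ### Equivariance under translations, dilations and rotations -/

namespace HigherSpin

open TopologicalSpace WeylClifford Sp
open scoped CliffordModule

section Equivariance

variable {m : ℕ}

theorem basisFun_eq_e (i : Fin m) : EuclideanSpace.basisFun (Fin m) ℝ i = e i := by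
  simp [e]

/-- The contraction of a bilinear map does not depend on the orthonormal basis. -/
theorem sum_isometry {M : Type*} [AddCommGroup M] [Module ℝ M] (R : E m →ₗᵢ[ℝ] E m)
    (β : E m →ₗ[ℝ] E m →ₗ[ℝ] M) : ∑ i, β (R (e i)) (R (e i)) = ∑ i, β (e i) (e i) := by
  let b := EuclideanSpace.basisFun (Fin m) ℝ
  let c : OrthonormalBasis (Fin m) ℝ (E m) := b.map (R.toLinearIsometryEquiv rfl)
  have hb (i) : b i = e i := basisFun_eq_e i
  have hc (i) : c i = R (e i) := by
    simp only [c, OrthonormalBasis.map_apply, hb]; rfl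
  have hexp (i) : R (e i) = ∑ j, (inner ℝ (b j) (c i) : ℝ) • (e j : E m) := by
    rw [← hc i]
    conv_lhs => rw [← b.sum_repr' (c i)]
    simp only [hb]
  have h1 (i) : β (R (e i)) (R (e i)) =
      ∑ j, ∑ l, ((inner ℝ (b j) (c i) : ℝ) * inner ℝ (c i) (b l)) • β (e j) (e l) := by
    rw [hexp i]
    simp only [map_sum, map_smul, LinearMap.sum_apply, LinearMap.smul_apply, Finset.smul_sum,
      smul_smul]
    rw [Finset.sum_comm]
    simp only [real_inner_comm, mul_comm]
  simp only [h1]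
  rw [Finset.sum_comm]
  refine Finset.sum_congr rfl fun j _ => ?_
  rw [Finset.sum_comm]
  have h2 (l) : ∑ i, ((inner ℝ (b j) (c i) : ℝ) * inner ℝ (c i) (b l)) • β (e j) (e l)
      = (if j = l then (1 : ℝ) else 0) • β (e j) (e l) := by
    rw [← Finset.sum_smul, c.sum_inner_mul_inner, hb, hb, inner_e_e]
  simp only [h2, ite_smul, one_smul, zero_smul, Finset.sum_ite_eq, Finset.mem_univ, if_true]

namespace Sp

variable {O : Opens (V m)}

theorem pd_add_dir (w w' : V m) (F : Sp O) : pd (w + w') F = pd w F + pd w' F :=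
  ext' fun p hp => by rw [add_apply, pd_apply _ _ hp, pd_apply _ _ hp, pd_apply _ _ hp, map_add]

theorem pd_smul_dir (r : ℝ) (w : V m) (F : Sp O) : pd (r • w) F = r • pd w F :=
  ext' fun p hp => by rw [smul_apply, pd_apply _ _ hp, pd_apply _ _ hp, map_smul]

/-- The derivative in `x` in the direction `a`. -/
def Pl (O : Opens (V m)) : E m →ₗ[ℝ] Sp O →ₗ[ℝ] Sp O where
  toFun a := pd (0, a, 0)
  map_add' a b := LinearMap.ext fun F => by
    rw [LinearMap.add_apply, ← pd_add_dir]; simp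
  map_smul' r a := LinearMap.ext fun F => by
    rw [LinearMap.smul_apply, RingHom.id_apply, ← pd_smul_dir]; simp

/-- The derivative in `u` in the direction `a`. -/
def Ql (O : Opens (V m)) : E m →ₗ[ℝ] Sp O →ₗ[ℝ] Sp O where
  toFun a := pd (0, 0, a)
  map_add' a b := LinearMap.ext fun F => by
    rw [LinearMap.add_apply, ← pd_add_dir]; simp
  map_smul' r a := LinearMap.ext fun F => by
    rw [LinearMap.smul_apply, RingHom.id_apply, ← pd_smul_dir]; simp

/-- Multiplication by the coordinate of `u` in the direction `a`. -/
def Ul (O : Opens (V m)) : E m →ₗ[ℝ] Sp O →ₗ[ℝ] Sp O where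
  toFun a := mu ((innerSL ℝ a).comp ((ContinuousLinearMap.snd ℝ (E m) (E m)).comp
    (ContinuousLinearMap.snd ℝ ℝ (E m × E m))))
  map_add' a b := LinearMap.ext fun F => ext' fun p _ => by
    simp only [LinearMap.add_apply, add_apply, mu_apply, ← add_smul, map_add,
      ContinuousLinearMap.add_comp, _root_.add_apply]
  map_smul' r a := LinearMap.ext fun F => ext' fun p _ => by
    simp only [LinearMap.smul_apply, smul_apply, mu_apply, smul_smul, map_smul,
      ContinuousLinearMap.smul_comp, RingHom.id_apply, _root_.smul_apply, smul_eq_mul]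

theorem Ul_apply (a : E m) (F : Sp O) (p : V m) : Ul O a F p = (inner ℝ a p.2.2 : ℝ) • F p := rfl

/-- Left multiplication by the vector `a`. -/
def Cll (O : Opens (V m)) : E m →ₗ[ℝ] Sp O →ₗ[ℝ] Sp O where
  toFun a := cl (vec a)
  map_add' a b := LinearMap.ext fun F => ext' fun p _ => by
    simp only [LinearMap.add_apply, add_apply, cl_apply, vec_add, add_mul]
  map_smul' r a := LinearMap.ext fun F => ext' fun p _ => by
    simp only [LinearMap.smul_apply, smul_apply, cl_apply, vec_smul, RingHom.id_apply,
      smul_mul_assoc]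

theorem Cll_apply (a : E m) (F : Sp O) (p : V m) : Cll O a F p = vec a * F p := rfl

theorem ops_P (i : Fin m) : (ops O).P i = Pl O (e i) := rfl
theorem ops_Q (i : Fin m) : (ops O).Q i = Ql O (e i) := rfl
theorem ops_C (i : Fin m) : (ops O).C i = Cll O (e i) := rfl
theorem ops_U (i : Fin m) : (ops O).U i = Ul O (e i) :=
  LinearMap.ext fun F => ext' fun p _ => by
    rw [Ul_apply, e, EuclideanSpace.inner_single_left]
    simp only [map_one, one_mul]
    rfl

/-- A linear map intertwining two operator families contracts accordingly. -/
theorem con_intertwine (R : E m →ₗᵢ[ℝ] E m) (Ψ : Sp O →ₗ[ℝ] Sp O)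
    (S T : E m →ₗ[ℝ] Sp O →ₗ[ℝ] Sp O) (r s : ℝ)
    (hS : ∀ a F, S a (Ψ F) = r • Ψ (S (R a) F)) (hT : ∀ a F, T a (Ψ F) = s • Ψ (T (R a) F))
    (F : Sp O) : ∑ i, S (e i) (T (e i) (Ψ F)) = (s * r) • Ψ (∑ i, S (e i) (T (e i) F)) := by
  let β : E m →ₗ[ℝ] E m →ₗ[ℝ] Sp O :=
    LinearMap.mk₂ ℝ (fun a b => S a (T b F)) (fun a a' b => by simp) (fun c a b => by simp)
      (fun a b b' => by simp) (fun c a b => by simp)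
  have := sum_isometry R β
  simp only [β, LinearMap.mk₂_apply] at this
  rw [← this, map_sum, Finset.smul_sum]
  refine Finset.sum_congr rfl fun i _ => ?_
  rw [hT, map_smul, hS, smul_smul]

/-- The linear part of `(t, x, u) ↦ (t, y + μ R x, R u)`. -/
def affineLin (R : E m →ₗᵢ[ℝ] E m) (μ : ℝ) : V m →L[ℝ] V m :=
  (ContinuousLinearMap.id ℝ ℝ).prodMap
    ((μ • R.toContinuousLinearMap).prodMap R.toContinuousLinearMap)

theorem affineLin_apply (R : E m →ₗᵢ[ℝ] E m) (μ : ℝ) (p : V m) :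
    affineLin R μ p = (p.1, μ • R p.2.1, R p.2.2) := rfl

/-- The operator `G ↦ z G(t, y + μ R x, R u)`. -/
def Psi (z : Cl m) (R : E m →ₗᵢ[ℝ] E m) (μ : ℝ) (y : E m) :
    Sp (⊤ : Opens (V m)) →ₗ[ℝ] Sp (⊤ : Opens (V m)) where
  toFun G := ⟨fun p => z * G (affineLin R μ p + (0, y, 0)),
    (mulCLM z).contDiff.comp_contDiffOn (G.2.1.comp
      ((affineLin R μ).contDiff.add contDiff_const).contDiffOn fun _ _ => trivial),
    fun _ hp => (hp trivial).elim⟩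
  map_add' _ _ := ext' fun _ _ => mul_add z _ _
  map_smul' r _ := ext' fun _ _ => mul_smul_comm r z _

variable {z : Cl m} {R : E m →ₗᵢ[ℝ] E m} {μ : ℝ} {y : E m} {σ : ℝ}

theorem Psi_apply (G : Sp (⊤ : Opens (V m))) (p : V m) :
    Psi z R μ y G p = z * G (affineLin R μ p + (0, y, 0)) := rfl

theorem pd_Psi (w : V m) (G : Sp (⊤ : Opens (V m))) :
    pd w (Psi z R μ y G) = Psi z R μ y (pd (affineLin R μ w) G) := by
  refine ext' fun p hp => ?_
  rw [pd_apply _ _ hp, Psi_apply,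
    pd_apply _ _ (Opens.mem_top (affineLin R μ p + ((0, y, 0) : V m)))]
  have h1 : HasFDerivAt (fun p => affineLin R μ p + (0, y, 0)) (affineLin R μ) p :=
    (affineLin R μ).hasFDerivAt.add_const _
  have h2 := (mulCLM z).hasFDerivAt.comp p
    (((differentiableAt G (p := affineLin R μ p + (0, y, 0)) trivial).hasFDerivAt).comp p h1)
  have : fderiv ℝ (Psi z R μ y G) p = _ := h2.fderiv
  rw [this]
  rfl

theorem Pl_Psi (a : E m) (G : Sp (⊤ : Opens (V m))) :
    Pl ⊤ a (Psi z R μ y G) = μ • Psi z R μ y (Pl ⊤ (R a) G) := by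
  change pd _ _ = μ • Psi z R μ y (pd _ _)
  rw [pd_Psi, ← map_smul, ← pd_smul_dir, affineLin_apply]
  simp

theorem Ql_Psi (a : E m) (G : Sp (⊤ : Opens (V m))) :
    Ql ⊤ a (Psi z R μ y G) = (1 : ℝ) • Psi z R μ y (Ql ⊤ (R a) G) := by
  change pd _ _ = (1 : ℝ) • Psi z R μ y (pd _ _)
  rw [pd_Psi, one_smul, affineLin_apply]
  simp

theorem Ul_Psi (a : E m) (G : Sp (⊤ : Opens (V m))) :
    Ul ⊤ a (Psi z R μ y G) = (1 : ℝ) • Psi z R μ y (Ul ⊤ (R a) G) := by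
  refine ext' fun p _ => ?_
  rw [one_smul, Ul_apply, Psi_apply, Psi_apply, Ul_apply, mul_smul_comm, affineLin_apply]
  simp only [Prod.snd_add, add_zero, LinearIsometry.inner_map_map]

/-- The hypothesis on z is what `IsLipschitz.vec_mul_reverse` provides for z = q̃. -/
theorem Cll_Psi (hz : ∀ a, vec a * z = σ • (z * vec (R a))) (a : E m)
    (G : Sp (⊤ : Opens (V m))) :
    Cll ⊤ a (Psi z R μ y G) = σ • Psi z R μ y (Cll ⊤ (R a) G) := by
  refine ext' fun p _ => ?_
  rw [smul_apply, Cll_apply, Psi_apply, Psi_apply, Cll_apply, ← mul_assoc, hz, smul_mul_assoc,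
    mul_assoc]

variable (G : Sp (⊤ : Opens (V m)))

theorem A_Psi : (ops ⊤).A (Psi z R μ y G) = μ • Psi z R μ y ((ops ⊤).A G) := by
  simp only [A_apply, ops_U, ops_P]
  rw [con_intertwine R _ (Ul ⊤) (Pl ⊤) 1 μ Ul_Psi Pl_Psi, mul_one]

theorem B_Psi : (ops ⊤).B (Psi z R μ y G) = μ • Psi z R μ y ((ops ⊤).B G) := by
  simp only [B_apply, ops_Q, ops_P]
  rw [con_intertwine R _ (Ql ⊤) (Pl ⊤) 1 μ Ql_Psi Pl_Psi, mul_one]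

theorem L_Psi : (ops ⊤).L (Psi z R μ y G) = (μ * μ) • Psi z R μ y ((ops ⊤).L G) := by
  simp only [WeylClifford.L_apply, ops_P]
  rw [con_intertwine R _ (Pl ⊤) (Pl ⊤) μ μ Pl_Psi Pl_Psi]

theorem R_Psi : (ops ⊤).R (Psi z R μ y G) = Psi z R μ y ((ops ⊤).R G) := by
  simp only [WeylClifford.R_apply, ops_U]
  rw [con_intertwine R _ (Ul ⊤) (Ul ⊤) 1 1 Ul_Psi Ul_Psi, mul_one, one_smul]

theorem Eu_Psi : (ops ⊤).Eu (Psi z R μ y G) = Psi z R μ y ((ops ⊤).Eu G) := by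
  simp only [Eu_apply, ops_U, ops_Q]
  rw [con_intertwine R _ (Ul ⊤) (Ql ⊤) 1 1 Ul_Psi Ql_Psi, mul_one, one_smul]

theorem H_Psi : (ops ⊤).H (Psi z R μ y G) = Psi z R μ y ((ops ⊤).H G) := by
  simp only [H_apply, ops_Q]
  rw [con_intertwine R _ (Ql ⊤) (Ql ⊤) 1 1 Ql_Psi Ql_Psi, mul_one, one_smul]

theorem D_Psi (hz : ∀ a, vec a * z = σ • (z * vec (R a))) :
    (ops ⊤).D (Psi z R μ y G) = (μ * σ) • Psi z R μ y ((ops ⊤).D G) := by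
  simp only [D_apply, ops_C, ops_P]
  rw [con_intertwine R _ (Cll ⊤) (Pl ⊤) σ μ (Cll_Psi hz) Pl_Psi]

theorem G_Psi (hz : ∀ a, vec a * z = σ • (z * vec (R a))) :
    (ops ⊤).G (Psi z R μ y G) = σ • Psi z R μ y ((ops ⊤).G G) := by
  simp only [G_apply, ops_C, ops_Q]
  rw [con_intertwine R _ (Cll ⊤) (Ql ⊤) σ 1 (Cll_Psi hz) Ql_Psi, one_mul]

theorem uh_Psi (hz : ∀ a, vec a * z = σ • (z * vec (R a))) :
    (ops ⊤).uh (Psi z R μ y G) = σ • Psi z R μ y ((ops ⊤).uh G) := by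
  simp only [uh_apply, ops_C, ops_U]
  rw [con_intertwine R _ (Cll ⊤) (Ul ⊤) σ 1 (Cll_Psi hz) Ul_Psi, one_mul]

/-- Each of the six terms has three x-derivatives and an odd number of Clifford vectors (one or
three), so all of them scale by the same factor σμ³. -/
theorem T3_Psi (hz : ∀ a, vec a * z = σ • (z * vec (R a)))
    (hσ : σ * σ = 1) (k : ℕ) :
    (ops ⊤).T3 k (Psi z R μ y G) = (σ * μ ^ 3) • Psi z R μ y ((ops ⊤).T3 k G) := by
  have hσ3 : σ ^ 3 = σ := by rw [pow_succ, sq, hσ, one_mul]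
  simp only [T3, map_smul, map_add, map_sub, D_Psi _ hz, uh_Psi _ hz, A_Psi, B_Psi, R_Psi]
  match_scalars <;> ring_nf <;> rw [hσ3]

/-- Every term has four x-derivatives and no Clifford vector, so no condition on z is needed. -/
theorem T4_Psi (k : ℕ) :
    (ops ⊤).T4 k (Psi z R μ y G) = (μ ^ 4) • Psi z R μ y ((ops ⊤).T4 k G) := by
  simp only [T4, T2, map_smul, map_sub, L_Psi, A_Psi, B_Psi, R_Psi]
  match_scalars <;> ring

end Sp

end Equivariance

end HigherSpin

/-! ### The generators as vector fields, and constancy along the fixed point x = 0 -/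

namespace HigherSpin

open TopologicalSpace WeylClifford Sp
open scoped CliffordModule

section Evaluation

variable {m : ℕ} {O : Opens (V m)}

theorem sum_smul_e (u : E m) : ∑ i, u i • (e i : E m) = u := by
  ext j
  simp [e, Pi.single_apply]

theorem inner_eq_sum (v x : E m) : (inner ℝ v x : ℝ) = ∑ i, v i * x i := by
  simp [PiLp.inner_apply, mul_comm]

namespace Sp

variable (z : Sp O) {p : V m} (v : E m)

theorem sum_Pl (a : E m) : ∑ i, a i • (ops O).P i z = Pl O a z := by
  conv_rhs => rw [← sum_smul_e a, map_sum, LinearMap.sum_apply]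
  exact Finset.sum_congr rfl fun i _ => by rw [ops_P, map_smul, LinearMap.smul_apply]

theorem sum_Ql (a : E m) : ∑ i, a i • (ops O).Q i z = Ql O a z := by
  conv_rhs => rw [← sum_smul_e a, map_sum, LinearMap.sum_apply]
  exact Finset.sum_congr rfl fun i _ => by rw [ops_Q, map_smul, LinearMap.smul_apply]

theorem Pl_apply (a : E m) (hp : p ∈ O) : Pl O a z p = fderiv ℝ z p (0, a, 0) := pd_apply _ _ hp

theorem Ql_apply (a : E m) (hp : p ∈ O) : Ql O a z p = fderiv ℝ z p (0, 0, a) := pd_apply _ _ hp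

theorem pv_eval : (ops O).pv v z = Pl O v z := by rw [pv_apply, sum_Pl]

theorem qv_eval : (ops O).qv v z = Ql O v z := by rw [qv_apply, sum_Ql]

theorem vh_eval (p : V m) : (ops O).vh v z p = vec v * z p := by
  rw [vh_apply, sum_apply, vec_eq_sum v, Finset.sum_mul]
  refine Finset.sum_congr rfl fun i _ => ?_
  rw [smul_mul_assoc]
  rfl

theorem xv_eval (p : V m) : (ops O).xv v z p = (inner ℝ v p.2.1 : ℝ) • z p := by
  rw [xv_apply, sum_apply, inner_eq_sum, Finset.sum_smul]
  exact Finset.sum_congr rfl fun i _ => smul_smul (v i) (p.2.1 i) (z p)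

theorem uv_eval (p : V m) : (ops O).uv v z p = (inner ℝ v p.2.2 : ℝ) • z p := by
  rw [uv_apply, sum_apply, inner_eq_sum, Finset.sum_smul]
  exact Finset.sum_congr rfl fun i _ => smul_smul (v i) (p.2.2 i) (z p)

theorem XU_eval (p : V m) : (ops O).XU z p = (inner ℝ p.2.1 p.2.2 : ℝ) • z p := by
  rw [XU_apply, sum_apply, inner_eq_sum, Finset.sum_smul]
  exact Finset.sum_congr rfl fun i _ => smul_smul (p.2.1 i) (p.2.2 i) (z p)

theorem Ex_eval (p : V m) : (ops O).Ex z p = Pl O p.2.1 z p := by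
  rw [Ex_apply, ← sum_Pl, sum_apply, sum_apply]
  rfl

theorem XQ_eval (p : V m) : (ops O).XQ z p = Ql O p.2.1 z p := by
  rw [XQ_apply, ← sum_Ql, sum_apply, sum_apply]
  rfl

theorem Eu_eval (p : V m) : (ops O).Eu z p = Ql O p.2.2 z p := by
  rw [Eu_apply, ← sum_Ql, sum_apply, sum_apply]
  rfl

/-- The `x`-component of the special conformal vector field. -/
def fieldX (v x : E m) : E m := (2 * inner ℝ v x : ℝ) • x - (‖x‖ ^ 2) • v

/-- The `u`-component of the special conformal vector field. -/
def fieldU (v x u : E m) : E m := (2 * inner ℝ v u : ℝ) • x - (2 * inner ℝ x u : ℝ) • v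

theorem K_eval (s : ℝ) (hp : p ∈ O) : (ops O).K v s z p =
    fderiv ℝ z p (0, fieldX v p.2.1, fieldU v p.2.1 p.2.2)
      + (s * inner ℝ v p.2.1 : ℝ) • z p := by
  have hw : ((0, fieldX v p.2.1, fieldU v p.2.1 p.2.2) : V m) =
      (2 * inner ℝ v p.2.1 : ℝ) • (0, p.2.1, 0) - (‖p.2.1‖ ^ 2) • (0, v, 0)
        + (2 * inner ℝ v p.2.2 : ℝ) • (0, 0, p.2.1)
        - (2 * inner ℝ p.2.1 p.2.2 : ℝ) • (0, 0, v) := by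
    simp [fieldX, fieldU]
  simp only [K, add_apply, sub_apply, smul_apply, xv_eval, uv_eval, XU_eval, Ex_eval, XQ_eval,
    N_eval, pv_eval, qv_eval, Pl_apply _ _ hp, Ql_apply _ _ hp]
  rw [hw, map_sub, map_add, map_sub, map_smul, map_smul, map_smul, map_smul]
  module

/-- The vector field and the weight term both vanish at x = 0, the fixed point of the special
conformal flow. -/
theorem K_eval_zero (s : ℝ) (hp : p ∈ O) (hx : p.2.1 = 0) : (ops O).K v s z p = 0 := by
  have hw : ((0, fieldX v p.2.1, fieldU v p.2.1 p.2.2) : V m) = 0 := by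
    simp [fieldX, fieldU, hx]
  rw [K_eval z v s hp, hw, map_zero, hx, inner_zero_right, mul_zero, zero_smul, add_zero]

theorem KS_eval_zero (s : ℝ) (hp : p ∈ O) (hx : p.2.1 = 0) : (ops O).KS v s z p = 0 := by
  rw [KS, add_apply, K_eval_zero z v s hp hx, xh_eval, hx, vec_zero, zero_mul, add_zero]

theorem xv_eval_zero (hx : p.2.1 = 0) : (ops O).xv v z p = 0 := by
  rw [xv_eval, hx, inner_zero_right, zero_smul]

/-- A function whose `t`-derivative vanishes on a line is constant there. -/
theorem eq_of_dt_eq_zero (x u : E m) (hO : ∀ t, (t, x, u) ∈ O) (h : ∀ t, dt z (t, x, u) = 0)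
    (t t' : ℝ) : z (t, x, u) = z (t', x, u) := by
  have hd (t : ℝ) : HasDerivAt (fun t => z (t, x, u)) 0 t := by
    have h1 : HasDerivAt (fun t : ℝ => ((t, x, u) : V m)) (1, 0, 0) t :=
      (hasDerivAt_id t).prodMk ((hasDerivAt_const t x).prodMk (hasDerivAt_const t u))
    have h2 := (differentiableAt z (hO t)).hasFDerivAt.comp_hasDerivAt t h1
    rw [← pd_apply (1, 0, 0) z (hO t)] at h2
    rw [← h t]
    exact h2
  exact is_const_of_deriv_eq_zero (fun t => (hd t).differentiableAt) (fun t => (hd t).deriv) t t'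

/-- The evolution equation passes from z to 𝒟₃z because 𝒟₃ commutes with ∂_t; its right side
vanishes at x = 0, so the value there is conserved. -/
theorem T3_const {z : Sp O} (hO : ∀ t u, (t, (0 : E m), u) ∈ O) (k : ℕ)
    (h1 : dt z = (ops O).KS v (m - 2) z)
    (h2 : (ops O).T3 k ((ops O).KS v (m - 2) z) =
      (ops O).KS v (m - 2) ((ops O).T3 k z) + (6 : ℝ) • (ops O).xv v ((ops O).T3 k z))
    (u : E m) (t t' : ℝ) : (ops O).T3 k z (t, 0, u) = (ops O).T3 k z (t', 0, u) := by
  refine eq_of_dt_eq_zero _ 0 u (fun t => hO t u) (fun t => ?_) t t'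
  rw [dt_T3, h1, h2, add_apply, smul_apply, KS_eval_zero _ _ _ (hO t u) rfl,
    xv_eval_zero _ _ rfl, smul_zero, add_zero]

theorem T4_const {z : Sp O} (hO : ∀ t u, (t, (0 : E m), u) ∈ O) (k : ℕ)
    (h1 : dt z = (ops O).K v (m - 4) z)
    (h2 : (ops O).T4 k ((ops O).K v (m - 4) z) =
      (ops O).K v (m - 4) ((ops O).T4 k z) + (8 : ℝ) • (ops O).xv v ((ops O).T4 k z))
    (u : E m) (t t' : ℝ) : (ops O).T4 k z (t, 0, u) = (ops O).T4 k z (t', 0, u) := by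
  refine eq_of_dt_eq_zero _ 0 u (fun t => hO t u) (fun t => ?_) t t'
  rw [dt_T4, h1, h2, add_apply, smul_apply, K_eval_zero _ _ _ (hO t u) rfl,
    xv_eval_zero _ _ rfl, smul_zero, add_zero]

end Sp

end Evaluation

end HigherSpin

/-! ### The special conformal flow and its evolution equation -/

namespace HigherSpin

open TopologicalSpace WeylClifford Sp CliffordAlgebra
open scoped CliffordModule

section Flow

variable {m : ℕ}

/-- `‖1 + t v x‖ ^ 2` -/
def scal (v : E m) (t : ℝ) (x : E m) : ℝ :=
  1 - 2 * t * inner ℝ v x + t ^ 2 * ‖v‖ ^ 2 * ‖x‖ ^ 2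

/-- `x (1 + t x v)` -/
def numX (v : E m) (t : ℝ) (x : E m) : E m := x - (t * ‖x‖ ^ 2) • v

/-- `(1 + t v x) u (1 + t x v)` -/
def numU (v : E m) (t : ℝ) (x u : E m) : E m :=
  u + t • ((-2 * inner ℝ v x : ℝ) • u - (2 * inner ℝ x u : ℝ) • v + (2 * inner ℝ v u : ℝ) • x)
    + t ^ 2 • (‖v‖ ^ 2 • (‖x‖ ^ 2 • u - (2 * inner ℝ x u : ℝ) • x)
      - (2 * (‖x‖ ^ 2 * inner ℝ v u - 2 * inner ℝ x u * inner ℝ v x) : ℝ) • v)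

/-- The Clifford number `1 + t v x`. -/
def fac (v : E m) (t : ℝ) (x : E m) : Cl m := 1 + t • (vec v * vec x)

theorem reverse_fac (v : E m) (t : ℝ) (x : E m) :
    reverse (fac v t x) = 1 + t • (vec x * vec v) := by
  rw [fac, map_add, reverse.map_one, reverse_real_smul, reverse.map_mul, reverse_vec, reverse_vec]

theorem involute_fac (v : E m) (t : ℝ) (x : E m) : involute (fac v t x) = fac v t x := by
  rw [fac, map_add, map_one, involute_real_smul, map_mul, involute_vec, involute_vec, neg_mul_neg]

theorem fac_mul_aux (v x : E m) (t : ℝ) :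
    (1 + t • (vec v * vec x)) * (1 + t • (vec x * vec v)) = scal v t x • (1 : Cl m) := by
  have h1 : vec v * vec x * (vec x * vec v) = (‖v‖ ^ 2 * ‖x‖ ^ 2) • (1 : Cl m) := by
    rw [mul_assoc, ← mul_assoc (vec x), vec_sq, smul_mul_assoc, one_mul, mul_smul_comm, vec_sq,
      smul_smul]
    congr 1; ring
  rw [add_mul, mul_add, mul_add, smul_mul_smul_comm, h1, one_mul, one_mul, mul_one,
    vec_mul_swap v x, scal]
  module

theorem conj_aux (v x u : E m) (t : ℝ) :
    (1 + t • (vec v * vec x)) * vec u * (1 + t • (vec x * vec v)) = vec (numU v t x u) := by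
  have h1 : vec v * vec x * vec u * (vec x * vec v) = vec (‖v‖ ^ 2 • (‖x‖ ^ 2 • u -
      (2 * inner ℝ x u : ℝ) • x)
      - (2 * (‖x‖ ^ 2 * inner ℝ v u - 2 * inner ℝ x u * inner ℝ v x) : ℝ) • v) := by
    have : vec v * vec x * vec u * (vec x * vec v) = vec v * (vec x * vec u * vec x) * vec v := by
      simp only [mul_assoc]
    rw [this, vec_mul_vec_mul_vec, vec_mul_vec_mul_vec, inner_sub_right, inner_smul_right,
      inner_smul_right]
  have h2 : vec v * vec x * vec u + vec u * (vec x * vec v) = vec ((-2 * inner ℝ v x : ℝ) • u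
      - (2 * inner ℝ x u : ℝ) • v + (2 * inner ℝ v u : ℝ) • x) := by
    rw [← mul_assoc, vec_mul_swap u x, sub_mul, smul_mul_assoc, one_mul, mul_assoc (vec x),
      vec_mul_swap u v, mul_sub, mul_smul_comm, mul_one, ← mul_assoc, ← sub_add,
      real_inner_comm u x, real_inner_comm u v, vec_add, vec_sub, vec_smul, vec_smul, vec_smul]
    have h3 : vec v * vec x * vec u + vec x * vec v * vec u = (-2 * inner ℝ v x : ℝ) • vec u := by
      rw [← add_mul, vec_mul_add_swap, smul_mul_assoc, one_mul]
    rw [← h3]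
    simp only [real_inner_comm]
    module
  rw [numU, vec_add, vec_add, vec_smul, vec_smul, ← h1, ← h2]
  simp only [add_mul, mul_add, one_mul, mul_one, smul_mul_assoc, mul_smul_comm, smul_add]
  module

theorem scal_swap (v x : E m) (t : ℝ) : scal x t v = scal v t x := by
  rw [scal, scal, real_inner_comm]; ring

/-- The factor 1 + tvx is an even element, so its parity sign is 1 and it does not affect ε. -/
theorem isLipschitz_fac {v x : E m} {t : ℝ} (h : 0 < scal v t x) :
    IsLipschitz (fac v t x) 1 (scal v t x) where
  pos := h
  sign := Or.inl rfl
  mul_reverse := by rw [reverse_fac, fac, fac_mul_aux, one_mul]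
  reverse_mul := by rw [reverse_fac, fac, fac_mul_aux, one_mul, scal_swap]
  involute_eq := by rw [involute_fac, one_smul]
  conj u := ⟨_, by rw [reverse_fac, fac, conj_aux]⟩
  conj' u := ⟨_, by rw [reverse_fac, fac, conj_aux]⟩

theorem rot_fac {v x : E m} {t : ℝ} (h : 0 < scal v t x) (u : E m) :
    (isLipschitz_fac h).rot u = (scal v t x)⁻¹ • numU v t x u := by
  apply vec_injective
  rw [IsLipschitz.rot_apply, (isLipschitz_fac h).vec_rotate, reverse_fac, fac, conj_aux, vec_smul]

theorem vec_mul_reverse_fac (v x : E m) (t : ℝ) :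
    vec x * reverse (fac v t x) = vec (numX v t x) := by
  rw [reverse_fac, mul_add, mul_one, mul_smul_comm, ← mul_assoc, vec_sq, smul_mul_assoc, one_mul,
    numX, vec_sub, vec_smul]
  module

/-- The domain of the special conformal flow. -/
def dom (v : E m) : Opens (V m) where
  carrier := {p | 0 < scal v p.1 p.2.1}
  is_open' := isOpen_lt continuous_const (by unfold scal; fun_prop)

theorem mem_dom {v : E m} {p : V m} : p ∈ dom v ↔ 0 < scal v p.1 p.2.1 := Iff.rfl

/-- The whole line x = 0 lies in the domain, so the conservation argument can run from t = 0 to t =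
1 without meeting a pole. -/
theorem mem_dom_zero (v : E m) (t : ℝ) (u : E m) : (t, (0 : E m), u) ∈ dom v := by
  rw [mem_dom]; simp [scal]

/-- The special conformal flow on `(t, x, u)`. -/
def theta (v : E m) (p : V m) : V m :=
  (0, (scal v p.1 p.2.1)⁻¹ • numX v p.1 p.2.1, (scal v p.1 p.2.1)⁻¹ • numU v p.1 p.2.1 p.2.2)

theorem contDiff_scal (v : E m) : ContDiff ℝ ∞ fun p : V m => scal v p.1 p.2.1 := by
  have h : ContDiff ℝ ∞ fun p : V m => ‖p.2.1‖ ^ 2 := ContDiff.norm_sq ℝ (by fun_prop)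
  have h1 : ContDiff ℝ ∞ fun p : V m => (inner ℝ v p.2.1 : ℝ) :=
    ContDiff.inner ℝ (by fun_prop) (by fun_prop)
  unfold scal
  fun_prop

theorem contDiff_numX (v : E m) : ContDiff ℝ ∞ fun p : V m => numX v p.1 p.2.1 := by
  have h : ContDiff ℝ ∞ fun p : V m => ‖p.2.1‖ ^ 2 := ContDiff.norm_sq ℝ (by fun_prop)
  unfold numX
  fun_prop

theorem contDiff_numU (v : E m) : ContDiff ℝ ∞ fun p : V m => numU v p.1 p.2.1 p.2.2 := by
  have h : ContDiff ℝ ∞ fun p : V m => ‖p.2.1‖ ^ 2 := ContDiff.norm_sq ℝ (by fun_prop)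
  have h1 : ContDiff ℝ ∞ fun p : V m => (inner ℝ v p.2.1 : ℝ) :=
    ContDiff.inner ℝ (by fun_prop) (by fun_prop)
  have h2 : ContDiff ℝ ∞ fun p : V m => (inner ℝ v p.2.2 : ℝ) :=
    ContDiff.inner ℝ (by fun_prop) (by fun_prop)
  have h3 : ContDiff ℝ ∞ fun p : V m => (inner ℝ p.2.1 p.2.2 : ℝ) :=
    ContDiff.inner ℝ (by fun_prop) (by fun_prop)
  unfold numU
  fun_prop

theorem contDiffAt_theta {v : E m} {p : V m} (hp : p ∈ dom v) :
    ContDiffAt ℝ ∞ (theta v) p := by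
  have h := ((contDiff_scal v).contDiffAt (x := p)).inv (mem_dom.1 hp).ne'
  exact contDiffAt_const.prodMk ((h.smul (contDiff_numX v).contDiffAt).prodMk
    (h.smul (contDiff_numU v).contDiffAt))

theorem contDiffAt_weight {v : E m} (s : ℤ) {p : V m} (hp : p ∈ dom v) :
    ContDiffAt ℝ ∞ (fun p : V m => Real.sqrt (scal v p.1 p.2.1) ^ s) p := by
  have h := ((contDiff_scal v).contDiffAt (x := p)).sqrt (mem_dom.1 hp).ne'
  have h0 : Real.sqrt (scal v p.1 p.2.1) ≠ 0 := (Real.sqrt_pos.2 (mem_dom.1 hp)).ne'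
  cases s with
  | ofNat n => simpa using h.pow n
  | negSucc n =>
    simp only [zpow_negSucc]
    exact (h.pow (n + 1)).inv (pow_ne_zero _ h0)

open Classical in
/-- The weighted pullback of `G` by the special conformal flow. -/
def flow (v : E m) (s : ℤ) (G : Sp (⊤ : Opens (V m))) : Sp (dom v) :=
  ⟨fun p => if p ∈ dom v then Real.sqrt (scal v p.1 p.2.1) ^ s • G (theta v p) else 0, by
    refine ⟨fun p hp => ?_, fun p hp => if_neg hp⟩
    have h : ContDiffAt ℝ ∞ (fun p => Real.sqrt (scal v p.1 p.2.1) ^ s • G (theta v p)) p :=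
      (contDiffAt_weight s hp).smul
        ((contDiffAt G (p := theta v p) trivial).comp p (contDiffAt_theta hp))
    refine (h.congr_of_eventuallyEq ?_).contDiffWithinAt
    filter_upwards [nhds_mem hp] with q hq using if_pos hq⟩

variable {v : E m} {p : V m} (s : ℤ) (G : Sp (⊤ : Opens (V m)))

theorem flow_apply (hp : p ∈ dom v) :
    flow v s G p = Real.sqrt (scal v p.1 p.2.1) ^ s • G (theta v p) := if_pos hp

theorem theta_eq (hp : p ∈ dom v) : theta v p =
    (0, (scal v p.1 p.2.1)⁻¹ • numX v p.1 p.2.1, (isLipschitz_fac (mem_dom.1 hp)).rot p.2.2) := by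
  rw [rot_fac (mem_dom.1 hp)]; rfl

/-! #### Derivatives of the flow -/

theorem mem_dom_add (hp : p ∈ dom v) (a : E m) (τ : ℝ) :
    p + τ • ((0, 0, a) : V m) ∈ dom v := by
  rw [mem_dom] at hp ⊢; simpa using hp

theorem scal_add (a : E m) (τ : ℝ) :
    scal v (p + τ • ((0, 0, a) : V m)).1 (p + τ • ((0, 0, a) : V m)).2.1 = scal v p.1 p.2.1 := by
  simp

theorem numU_add (x u a : E m) (t τ : ℝ) :
    numU v t x (u + τ • a) = numU v t x u + τ • numU v t x a := by
  simp only [numU, inner_add_right, inner_smul_right]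
  module

theorem theta_add (hp : p ∈ dom v) (a : E m) (τ : ℝ) :
    theta v (p + τ • ((0, 0, a) : V m)) = theta v p +
      τ • ((0, 0, (isLipschitz_fac (mem_dom.1 hp)).rot a) : V m) := by
  rw [rot_fac (mem_dom.1 hp)]
  simp only [theta, Prod.fst_add, Prod.snd_add, Prod.smul_mk, smul_zero, add_zero, numU_add,
    Prod.mk_add_mk, smul_add, smul_comm τ]

theorem Sp.hasDerivAt_line {O : Opens (V m)} (F : Sp O) {p : V m} (hp : p ∈ O) (w : V m) :
    HasDerivAt (fun τ : ℝ => F (p + τ • w)) (fderiv ℝ F p w) 0 :=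
  ((differentiableAt F hp).hasFDerivAt.hasLineDerivAt w)

/-- For fixed t and x the flow acts on u by a linear isometry. This is why the Euler equation and
harmonicity in u survive the pullback. -/
theorem Ql_flow (hp : p ∈ dom v) (a : E m) : Ql (dom v) a (flow v s G) p =
    Real.sqrt (scal v p.1 p.2.1) ^ s •
      Ql ⊤ ((isLipschitz_fac (mem_dom.1 hp)).rot a) G (theta v p) := by
  rw [Ql_apply _ _ hp, Ql_apply _ _ (Opens.mem_top _)]
  refine (hasDerivAt_line (flow v s G) hp _).unique ?_
  have h := (hasDerivAt_line G (Opens.mem_top (theta v p))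
    (0, 0, (isLipschitz_fac (mem_dom.1 hp)).rot a)).const_smul (Real.sqrt (scal v p.1 p.2.1) ^ s)
  refine h.congr_of_eventuallyEq (Filter.Eventually.of_forall fun τ => ?_)
  simp only [flow_apply s G (mem_dom_add hp a τ), scal_add, theta_add hp]
  rfl

theorem Ql_Ql_flow (hp : p ∈ dom v) (a : E m) : Ql (dom v) a (Ql (dom v) a (flow v s G)) p =
    Real.sqrt (scal v p.1 p.2.1) ^ s •
      Ql ⊤ ((isLipschitz_fac (mem_dom.1 hp)).rot a)
        (Ql ⊤ ((isLipschitz_fac (mem_dom.1 hp)).rot a) G) (theta v p) := by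
  rw [Ql_apply _ _ hp, Ql_apply _ _ (Opens.mem_top _)]
  refine (hasDerivAt_line (Ql (dom v) a (flow v s G)) hp _).unique ?_
  have h := (hasDerivAt_line (Ql ⊤ ((isLipschitz_fac (mem_dom.1 hp)).rot a) G)
    (Opens.mem_top (theta v p)) (0, 0, (isLipschitz_fac (mem_dom.1 hp)).rot a)).const_smul
      (Real.sqrt (scal v p.1 p.2.1) ^ s)
  refine h.congr_of_eventuallyEq (Filter.Eventually.of_forall fun τ => ?_)
  have hR (q : V m) (hq : q ∈ dom v) (h1 : q.1 = p.1) (h2 : q.2.1 = p.2.1) :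
      (isLipschitz_fac (mem_dom.1 hq)).rot a = (isLipschitz_fac (mem_dom.1 hp)).rot a := by
    rw [rot_fac (mem_dom.1 hq), rot_fac (mem_dom.1 hp), h1, h2]
  simp only [Ql_flow s G (mem_dom_add hp a τ)]
  rw [hR _ (mem_dom_add hp a τ) (by simp) (by simp), scal_add, theta_add hp]
  rfl

theorem Eu_flow {k : ℕ} (hG : (ops ⊤).Eu G = (k : ℝ) • G) :
    (ops (dom v)).Eu (flow v s G) = (k : ℝ) • flow v s G := by
  refine ext' fun p hp => ?_
  have h : (ops ⊤).Eu G (theta v p) = (k : ℝ) • G (theta v p) := by rw [hG]; rfl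
  rw [Eu_eval, Ql_flow s G hp, smul_apply, flow_apply s G hp, smul_comm, ← h, Eu_eval,
    theta_eq hp]

theorem Q_flow_eq_zero (hG : ∀ i, (ops ⊤).Q i G = 0) (i : Fin m) :
    (ops (dom v)).Q i (flow v s G) = 0 := by
  refine ext' fun p hp => ?_
  rw [ops_Q, Ql_flow s G hp, ← sum_Ql]
  simp only [hG, smul_zero, Finset.sum_const_zero, zero_apply]

theorem H_flow (hG : (ops ⊤).H G = 0) : (ops (dom v)).H (flow v s G) = 0 := by
  refine ext' fun p hp => ?_
  rw [H_apply, sum_apply]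
  simp only [ops_Q, Ql_Ql_flow s G hp]
  let β : E m →ₗ[ℝ] E m →ₗ[ℝ] Sp (⊤ : Opens (V m)) :=
    LinearMap.mk₂ ℝ (fun a b => Ql ⊤ a (Ql ⊤ b G)) (fun a a' b => by simp) (fun c a b => by simp)
      (fun a b b' => by simp) (fun c a b => by simp)
  have h := sum_isometry (isLipschitz_fac (mem_dom.1 hp)).rot β
  simp only [β, LinearMap.mk₂_apply] at h
  rw [← Finset.smul_sum, ← sum_apply, h]
  have h' : ∑ i, Ql ⊤ (e i) (Ql ⊤ (e i) G) = 0 := by rw [← hG, H_apply]; rfl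
  rw [h', zero_apply, smul_zero, zero_apply]

/-! #### The flow equation -/

section Curve

variable (v x u : E m) (t : ℝ)

/-- The line through `(t, x, u)` in the direction in which the flow is constant. -/
def lineX (τ : ℝ) : E m := x + τ • -fieldX v x

/-- The `u`-component of that line. -/
def lineU (τ : ℝ) : E m := u + τ • -fieldU v x u

theorem hasDerivAt_lineX : HasDerivAt (lineX v x) (-fieldX v x) 0 :=
  (((hasDerivAt_id (0 : ℝ)).smul_const (-fieldX v x)).const_add x).congr_deriv (one_smul _ _)

theorem hasDerivAt_lineU : HasDerivAt (lineU v x u) (-fieldU v x u) 0 :=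
  (((hasDerivAt_id (0 : ℝ)).smul_const (-fieldU v x u)).const_add u).congr_deriv (one_smul _ _)

theorem lineX_zero : lineX v x 0 = x := by simp [lineX]

theorem lineU_zero : lineU v x u 0 = u := by simp [lineU]

theorem hasDerivAt_line_t : HasDerivAt (fun τ : ℝ => t + τ) 1 0 := (hasDerivAt_id 0).const_add t

theorem hasDerivAt_inner_v_x : HasDerivAt (fun τ => (inner ℝ v (lineX v x τ) : ℝ))
    (-(2 * inner ℝ v x ^ 2 - ‖x‖ ^ 2 * ‖v‖ ^ 2)) 0 := by
  have h := (hasDerivAt_const (0 : ℝ) v).inner ℝ (hasDerivAt_lineX v x)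
  refine h.congr_deriv ?_
  simp only [fieldX, inner_neg_right, inner_sub_right, inner_smul_right, inner_zero_left,
    real_inner_self_eq_norm_sq]
  ring

theorem hasDerivAt_inner_v_u : HasDerivAt (fun τ => (inner ℝ v (lineU v x u τ) : ℝ))
    (-(2 * inner ℝ v u * inner ℝ v x - 2 * inner ℝ x u * ‖v‖ ^ 2)) 0 := by
  have h := (hasDerivAt_const (0 : ℝ) v).inner ℝ (hasDerivAt_lineU v x u)
  refine h.congr_deriv ?_
  simp only [fieldU, inner_neg_right, inner_sub_right, inner_smul_right, inner_zero_left,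
    real_inner_self_eq_norm_sq]
  ring

theorem hasDerivAt_norm_sq_x : HasDerivAt (fun τ => ‖lineX v x τ‖ ^ 2)
    (-(2 * ‖x‖ ^ 2 * inner ℝ v x)) 0 := by
  have h := (hasDerivAt_lineX v x).inner ℝ (hasDerivAt_lineX v x)
  simp only [real_inner_self_eq_norm_sq] at h
  refine h.congr_deriv ?_
  simp only [fieldX, lineX_zero, inner_neg_right, inner_neg_left, inner_sub_right, inner_sub_left,
    inner_smul_right, inner_smul_left, real_inner_self_eq_norm_sq, real_inner_comm v x,
    conj_trivial]
  ring

theorem hasDerivAt_inner_x_u : HasDerivAt (fun τ => (inner ℝ (lineX v x τ) (lineU v x u τ) : ℝ))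
    (-(‖x‖ ^ 2 * inner ℝ v u)) 0 := by
  have h := (hasDerivAt_lineX v x).inner ℝ (hasDerivAt_lineU v x u)
  refine h.congr_deriv ?_
  simp only [fieldX, fieldU, lineX_zero, lineU_zero, inner_neg_right, inner_neg_left,
    inner_sub_right, inner_sub_left, inner_smul_right, inner_smul_left,
    real_inner_self_eq_norm_sq, real_inner_comm v x, conj_trivial]
  ring

/-- `scal`, `numX` and `numU` have the same logarithmic derivative −2⟨v,x⟩ in the direction (1, −X,
−U), with X and U the components of the vector field; their quotients are therefore stationary. -/
theorem hasDerivAt_scal : HasDerivAt (fun τ => scal v (t + τ) (lineX v x τ))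
    (-2 * inner ℝ v x * scal v t x) 0 := by
  have h1 := hasDerivAt_line_t t
  have h := ((hasDerivAt_const (0 : ℝ) (1 : ℝ)).sub
    ((h1.const_mul 2).mul (hasDerivAt_inner_v_x v x))).add
    (((h1.pow 2).mul_const (‖v‖ ^ 2)).mul (hasDerivAt_norm_sq_x v x))
  refine (h.congr_deriv ?_)
  simp only [lineX_zero, scal]
  norm_num
  ring

theorem hasDerivAt_numX : HasDerivAt (fun τ => numX v (t + τ) (lineX v x τ))
    ((-2 * inner ℝ v x : ℝ) • numX v t x) 0 := by
  have h := (hasDerivAt_lineX v x).sub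
    (((hasDerivAt_line_t t).mul (hasDerivAt_norm_sq_x v x)).smul_const v)
  refine (h.congr_deriv ?_)
  simp only [lineX_zero, numX, fieldX]
  module

theorem hasDerivAt_numU : HasDerivAt (fun τ => numU v (t + τ) (lineX v x τ) (lineU v x u τ))
    ((-2 * inner ℝ v x : ℝ) • numU v t x u) 0 := by
  have ht := hasDerivAt_line_t t
  have hX := hasDerivAt_lineX v x
  have hU := hasDerivAt_lineU v x u
  have hα := hasDerivAt_inner_v_x v x
  have hβ := hasDerivAt_norm_sq_x v x
  have hγ := hasDerivAt_inner_x_u v x u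
  have hδ := hasDerivAt_inner_v_u v x u
  have h := (hU.add (ht.smul ((((hα.const_mul (-2)).smul hU).sub
      ((hγ.const_mul 2).smul_const v)).add ((hδ.const_mul 2).smul hX)))).add
    ((ht.pow 2).smul ((((hβ.smul hU).sub ((hγ.const_mul 2).smul hX)).const_smul (‖v‖ ^ 2)).sub
      ((((hβ.mul hδ).sub ((hγ.const_mul 2).mul hα)).const_mul 2).smul_const v)))
  refine (h.congr_deriv ?_)
  norm_num [Pi.smul_apply']
  simp only [lineX_zero, lineU_zero, numU, fieldX, fieldU]
  module

end Curve

theorem smul_hasDerivAt_zero {f : ℝ → E m} {n : ℝ → ℝ} {c : ℝ} (hn : HasDerivAt n (c * n 0) 0)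
    (hf : HasDerivAt f (c • f 0) 0) (h0 : n 0 ≠ 0) :
    HasDerivAt (fun τ => (n τ)⁻¹ • f τ) 0 0 := by
  refine ((hn.inv h0).smul hf).congr_deriv ?_
  rw [smul_smul, ← add_smul]
  have : (n 0)⁻¹ * c + -(c * n 0) / n 0 ^ 2 = 0 := by field_simp; ring
  rw [Pi.inv_apply, this, zero_smul]

/-- `theta` is stationary in this direction, so only the weight, the power s of the root of `scal`,
is differentiated. -/
theorem fderiv_flow (hp : p ∈ dom v) :
    fderiv ℝ (flow v s G) p (1, -fieldX v p.2.1, -fieldU v p.2.1 p.2.2) =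
      (-(s * inner ℝ v p.2.1) : ℝ) • flow v s G p := by
  obtain ⟨t, x, u⟩ := p
  have h0 : 0 < scal v t x := mem_dom.1 hp
  have hline (τ : ℝ) : ((t, x, u) : V m) + τ • ((1, -fieldX v x, -fieldU v x u) : V m) =
      (t + τ, lineX v x τ, lineU v x u τ) := by
    simp [lineX, lineU]
  have hs := hasDerivAt_scal v x t
  have hs0 : scal v (t + 0) (lineX v x 0) = scal v t x := by rw [add_zero, lineX_zero]
  have hX := smul_hasDerivAt_zero (n := fun τ => scal v (t + τ) (lineX v x τ))
    (f := fun τ => numX v (t + τ) (lineX v x τ)) (c := -2 * inner ℝ v x)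
    (hs.congr_deriv (by rw [hs0]))
    ((hasDerivAt_numX v x t).congr_deriv (by simp only [add_zero, lineX_zero]))
    (by rw [hs0]; exact h0.ne')
  have hU := smul_hasDerivAt_zero (n := fun τ => scal v (t + τ) (lineX v x τ))
    (f := fun τ => numU v (t + τ) (lineX v x τ) (lineU v x u τ)) (c := -2 * inner ℝ v x)
    (hs.congr_deriv (by rw [hs0]))
    ((hasDerivAt_numU v x u t).congr_deriv (by simp only [add_zero, lineX_zero, lineU_zero]))
    (by rw [hs0]; exact h0.ne')
  have hθ : HasDerivAt (fun τ => theta v (t + τ, lineX v x τ, lineU v x u τ)) (0, 0, 0) 0 :=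
    (hasDerivAt_const (0 : ℝ) (0 : ℝ)).prodMk (hX.prodMk hU)
  have hGθ := (differentiableAt G (p := theta v (t + 0, lineX v x 0, lineU v x u 0))
    (Opens.mem_top _)).hasFDerivAt.comp_hasDerivAt (0 : ℝ) hθ
  have hsq := hs.sqrt (by simpa [lineX_zero] using h0.ne')
  have hq0 : Real.sqrt (scal v (t + 0) (lineX v x 0)) ≠ 0 := by
    simpa [lineX_zero] using (Real.sqrt_pos.2 h0).ne'
  have hw := (hasDerivAt_zpow s _ (Or.inl hq0)).comp (0 : ℝ) hsq
  have hF := hw.smul hGθ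
  have hF' := hasDerivAt_line (flow v s G) hp (1, -fieldX v x, -fieldU v x u)
  refine hF'.unique ((hF.congr_of_eventuallyEq ?_).congr_deriv ?_)
  · have hc : Continuous fun τ : ℝ =>
        ((t, x, u) : V m) + τ • ((1, -fieldX v x, -fieldU v x u) : V m) := by fun_prop
    have hm := hc.continuousAt (x := 0) |>.preimage_mem_nhds
      (t := (dom v : Set (V m))) (nhds_mem (by simpa using hp))
    filter_upwards [hm] with τ hτ
    rw [flow_apply s G hτ]
    simp only [hline]
    rfl
  · rw [flow_apply s G hp]
    have hz : ((0, 0, 0) : V m) = 0 := rfl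
    rw [hz, map_zero, smul_zero, zero_add]
    simp only [Function.comp_apply, add_zero, lineX_zero, lineU_zero, smul_smul]
    congr 1
    have hq : Real.sqrt (scal v t x) ≠ 0 := (Real.sqrt_pos.2 h0).ne'
    -- With w the root of `scal`, the chain rule gives s·w^(s−1)·(−2⟨v,x⟩w²)/(2w) = −s⟨v,x⟩w^s.
    have hq2 : scal v t x = Real.sqrt (scal v t x) ^ 2 := (Real.sq_sqrt h0.le).symm
    rw [zpow_sub_one₀ hq]
    nth_rw 3 [hq2]
    field_simp

theorem dt_flow : dt (flow v s G) = (ops (dom v)).K v (-s) (flow v s G) := by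
  refine ext' fun p hp => ?_
  have h := fderiv_flow s G hp
  have hw : ((1, -fieldX v p.2.1, -fieldU v p.2.1 p.2.2) : V m) =
      (1, 0, 0) - (0, fieldX v p.2.1, fieldU v p.2.1 p.2.2) := by simp
  rw [hw, map_sub, sub_eq_iff_eq_add] at h
  rw [K_eval _ _ _ hp, dt, pd_apply _ _ hp, h]
  module

end Flow

end HigherSpin

/-! ### The spinor factor of the flow -/

namespace HigherSpin

open TopologicalSpace WeylClifford Sp CliffordAlgebra
open scoped CliffordModule

section SpinorFlow

variable {m : ℕ}

/-- The coordinate `t`. -/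
def tc : V m →L[ℝ] ℝ := ContinuousLinearMap.fst ℝ ℝ (E m × E m)

/-- Left multiplication by `1 + t x v`. -/
def twist (v : E m) (W : Sp (dom v)) : Sp (dom v) := W + mu tc ((ops _).xh ((ops _).vh v W))

variable {v : E m} {p : V m} (W : Sp (dom v))

theorem twist_apply' (p : V m) : twist v W p = W p + p.1 • (vec p.2.1 * (vec v * W p)) := by
  rw [twist, add_apply, mu_apply, xh_eval, vh_eval]; rfl

theorem twist_apply (p : V m) : twist v W p = reverse (fac v p.1 p.2.1) * W p := by
  rw [twist_apply', reverse_fac, add_mul, one_mul, smul_mul_assoc, mul_assoc]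

theorem Ql_twist (hp : p ∈ dom v) (a : E m) : Ql (dom v) a (twist v W) p =
    reverse (fac v p.1 p.2.1) * Ql (dom v) a W p := by
  rw [Ql_apply _ _ hp, Ql_apply _ _ hp]
  refine (hasDerivAt_line (twist v W) hp _).unique ?_
  have h := (mulCLM (reverse (fac v p.1 p.2.1))).hasFDerivAt.comp_hasDerivAt (0 : ℝ)
    (hasDerivAt_line W hp (0, 0, a))
  refine h.congr_of_eventuallyEq (Filter.Eventually.of_forall fun τ => ?_)
  simp only [twist_apply, Function.comp_apply, mulCLM_apply]
  simp

theorem Eu_twist {k : ℕ} (hW : (ops (dom v)).Eu W = (k : ℝ) • W) :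
    (ops (dom v)).Eu (twist v W) = (k : ℝ) • twist v W := by
  refine ext' fun p hp => ?_
  rw [Eu_eval, Ql_twist W hp, smul_apply, twist_apply, ← mul_smul_comm, ← smul_apply, ← hW, Eu_eval]

theorem Q_twist_eq_zero (hW : ∀ i, (ops (dom v)).Q i W = 0) (i : Fin m) :
    (ops (dom v)).Q i (twist v W) = 0 := by
  refine ext' fun p hp => ?_
  rw [ops_Q, Ql_twist W hp, ← ops_Q, hW, zero_apply, mul_zero]

/-- Rotating u alone destroys monogenicity. The factor 1 + txv, the reversion of 1 + tvx, restores
it: basis vectors moved past it are rotated in the same way as the derivatives. -/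
theorem G_twist_flow (s : ℤ) (G : Sp (⊤ : Opens (V m))) (hG : (ops ⊤).G G = 0) :
    (ops (dom v)).G (twist v (flow v s G)) = 0 := by
  refine ext' fun p hp => ?_
  have hL := isLipschitz_fac (mem_dom.1 hp)
  let β : E m →ₗ[ℝ] E m →ₗ[ℝ] Sp (⊤ : Opens (V m)) :=
    LinearMap.mk₂ ℝ (fun a b => Cll ⊤ a (Ql ⊤ b G)) (fun a a' b => by simp) (fun c a b => by simp)
      (fun a b b' => by simp) (fun c a b => by simp)
  have h := sum_isometry hL.rot β
  simp only [β, LinearMap.mk₂_apply] at h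
  have h' : ∑ i, Cll ⊤ (e i) (Ql ⊤ (e i) G) = 0 := by rw [← hG, G_apply]; rfl
  rw [G_apply, sum_apply, zero_apply]
  have hterm (i : Fin m) : (ops (dom v)).C i ((ops (dom v)).Q i (twist v (flow v s G))) p =
      reverse (fac v p.1 p.2.1) * (Real.sqrt (scal v p.1 p.2.1) ^ s •
        Cll ⊤ (hL.rot (e i)) (Ql ⊤ (hL.rot (e i)) G) (theta v p)) := by
    rw [ops_Q, ops_C, Cll_apply, Ql_twist _ hp, Ql_flow s G hp, ← mul_assoc, hL.vec_mul_reverse,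
      one_smul, Cll_apply, mul_assoc, mul_smul_comm]
  rw [Finset.sum_congr rfl fun i _ => hterm i, ← Finset.mul_sum, ← Finset.smul_sum, ← sum_apply, h,
    h', zero_apply, smul_zero, mul_zero]

theorem fderiv_twist (hp : p ∈ dom v) {r : ℝ}
    (hW : fderiv ℝ W p (1, -fieldX v p.2.1, -fieldU v p.2.1 p.2.2) = r • W p) :
    fderiv ℝ (twist v W) p (1, -fieldX v p.2.1, -fieldU v p.2.1 p.2.2) =
      r • twist v W p + vec p.2.1 * (vec v * twist v W p) := by
  obtain ⟨t, x, u⟩ := p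
  have h := hasDerivAt_line W hp (1, -fieldX v x, -fieldU v x u)
  have hl (y : Cl m) := (mulCLM y).hasFDerivAt.comp_hasDerivAt (0 : ℝ) h
  have hF := h.add ((hasDerivAt_line_t t).smul ((hl (vec x * vec v)).sub
    ((hasDerivAt_id (0 : ℝ)).smul (hl (vec (fieldX v x) * vec v)))))
  have hF' := hasDerivAt_line (twist v W) hp (1, -fieldX v x, -fieldU v x u)
  refine hF'.unique ((hF.congr_of_eventuallyEq (Filter.Eventually.of_forall fun τ => ?_)).congr_deriv
    ?_)
  · change twist v W _ = W _ + (t + τ) • ((vec x * vec v) * W _ -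
      τ • (vec (fieldX v x) * vec v * W _))
    rw [twist_apply']
    simp only [Prod.fst_add, Prod.snd_add, Prod.smul_fst, Prod.smul_snd, smul_eq_mul, mul_one,
      vec_add, vec_smul, vec_neg, add_mul, smul_mul_assoc, neg_mul, mul_assoc]
    module
  -- Since xvx = −X, with X the x-component of the vector field, differentiating 1 + txv yields xv −
  -- tXv = xv(1 + txv). This is the term by which `KS` exceeds `K`.
  · have h1 : vec x * (vec v * (vec x * (vec v * W (t, x, u)))) =
        -(vec (fieldX v x) * vec v * W (t, x, u)) := by
      have : vec x * vec v * vec x = -vec (fieldX v x) := by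
        rw [vec_mul_vec_mul_vec, ← vec_neg, fieldX, real_inner_comm]
        congr 1
        module
      rw [← neg_mul, ← neg_mul, ← this]
      simp only [mul_assoc]
    simp only [twist_apply', Function.comp_apply, mulCLM_apply, hW, mul_add, mul_smul_comm, h1,
      Pi.sub_apply, Pi.smul_apply', id, zero_smul, add_zero, sub_zero, zero_add, one_smul, smul_add,
      mul_assoc]
    module

theorem dt_twist_flow (s : ℤ) (G : Sp (⊤ : Opens (V m))) : dt (twist v (flow v s G)) =
    (ops (dom v)).KS v (-s) (twist v (flow v s G)) := by
  refine ext' fun p hp => ?_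
  have h := fderiv_twist (flow v s G) hp (fderiv_flow s G hp)
  have hw : ((1, -fieldX v p.2.1, -fieldU v p.2.1 p.2.2) : V m) =
      (1, 0, 0) - (0, fieldX v p.2.1, fieldU v p.2.1 p.2.2) := by simp
  rw [hw, map_sub, sub_eq_iff_eq_add] at h
  rw [KS, add_apply, K_eval _ _ _ hp, xh_eval, vh_eval, dt, pd_apply _ _ hp, h]
  module

end SpinorFlow

end HigherSpin

/-! ### The target spaces, the local form of the Möbius map, and the conclusion -/

namespace HigherSpin

open TopologicalSpace WeylClifford Sp CliffordAlgebra
open scoped CliffordModule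

section Targets

variable {m k : ℕ}

theorem IsHomogPoly.map_smul {g : E m → Cl m} (h : IsHomogPoly k g) (r : ℝ) (u : E m) :
    g (r • u) = r ^ k • g u := by
  obtain ⟨coeff, hc⟩ := h
  rw [hc, hc, Finset.smul_sum]
  refine Finset.sum_congr rfl fun α hα => ?_
  have hk : ∑ i, α i = k := (Finset.mem_piAntidiag.1 hα).1
  change (∏ i, (r • u) i ^ α i : ℝ) • coeff α = r ^ k • (∏ i, u i ^ α i : ℝ) • coeff α
  rw [smul_smul]
  congr 1
  simp only [PiLp.smul_apply, smul_eq_mul, mul_pow, Finset.prod_mul_distrib,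
    Finset.prod_pow_eq_pow_sum, hk]

/-- A smooth function of `(x, u)` as a function of `(t, x, u)`. -/
def ofSmooth (f : E m → E m → Cl m) (hf : ContDiff ℝ ∞ fun p : E m × E m => f p.1 p.2) :
    Sp (⊤ : Opens (V m)) :=
  ⟨fun p => f p.2.1 p.2.2, (hf.comp contDiff_snd).contDiffOn, fun _ hp => (hp trivial).elim⟩

variable {f : E m → E m → Cl m} (hf : ContDiff ℝ ∞ fun p : E m × E m => f p.1 p.2)

theorem ofSmooth_apply (p : V m) : ofSmooth f hf p = f p.2.1 p.2.2 := rfl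

theorem rep_ofSmooth (t : ℝ) : Rep t 0 f (ofSmooth f hf) := fun x u _ => by
  rw [zero_add, ofSmooth_apply]

theorem Eu_ofSmooth (h : ∀ x, IsHomogPoly k (f x)) :
    (ops ⊤).Eu (ofSmooth f hf) = (k : ℝ) • ofSmooth f hf := by
  refine ext' fun p hp => ?_
  rw [Eu_eval, Ql_apply _ _ hp]
  refine (hasDerivAt_line (ofSmooth f hf) hp _).unique ?_
  have h1 := (((hasDerivAt_line_t 1).pow k).smul_const (f p.2.1 p.2.2))
  refine (h1.congr_of_eventuallyEq (Filter.Eventually.of_forall fun τ => ?_)).congr_deriv ?_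
  · have h2 : p.2.2 + τ • p.2.2 = (1 + τ) • p.2.2 := by module
    simp only [ofSmooth_apply, Prod.snd_add, Prod.fst_add, Prod.smul_snd, Prod.smul_fst, smul_zero,
      add_zero, h2, (h p.2.1).map_smul]
    rfl
  · simp [smul_apply, ofSmooth_apply]

theorem G_ofSmooth (h : ∀ x u, ∑ i, vec (e i) * fderiv ℝ (f x) u (e i) = 0) :
    (ops ⊤).G (ofSmooth f hf) = 0 := by
  refine ext' fun p hp => ?_
  rw [G_apply, sum_apply, zero_apply, ← h p.2.1 p.2.2]
  refine Finset.sum_congr rfl fun i _ => ?_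
  have := (rep_ofSmooth hf p.1).dU i p.2.1 p.2.2 hp
  rw [zero_add] at this
  exact congrArg (vec (e i) * ·) this.symm

theorem H_ofSmooth
    (h : ∀ x u, ∑ i, fderiv ℝ (fun v => fderiv ℝ (f x) v (e i)) u (e i) = 0) :
    (ops ⊤).H (ofSmooth f hf) = 0 := by
  refine ext' fun p hp => ?_
  rw [H_apply, sum_apply, zero_apply, ← h p.2.1 p.2.2]
  refine Finset.sum_congr rfl fun i _ => ?_
  have := ((rep_ofSmooth hf p.1).dU i).dU i p.2.1 p.2.2 hp
  rw [zero_add] at this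
  exact this.symm

theorem Ql_ofSmooth_eq_zero (h : ∀ x, IsHomogPoly 0 (f x)) (a : E m) :
    Ql ⊤ a (ofSmooth f hf) = 0 := by
  refine ext' fun p hp => ?_
  rw [Ql_apply _ _ hp]
  refine (hasDerivAt_line (ofSmooth f hf) hp _).unique ?_
  refine (hasDerivAt_const (0 : ℝ) (f p.2.1 0)).congr_of_eventuallyEq
    (Filter.Eventually.of_forall fun τ => ?_)
  -- Homogeneity with scalar 0 and the convention 0⁰ = 1.
  have h0 (x u : E m) : f x u = f x 0 := by
    simpa using ((h x).map_smul 0 u).symm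
  change f (p.2.1 + τ • 0) _ = _
  rw [smul_zero, add_zero, h0]

end Targets

section Local

variable {m : ℕ} {a b c d : Cl m} {δ σ n : ℝ} {x y v : E m}

theorem denominator_eq (hc : c = (c * vec x + d) * vec v) (h : E m) :
    c * vec (x + h) + d = (c * vec x + d) * fac v 1 h := by
  rw [fac, one_smul, mul_add, mul_one, ← mul_assoc, ← hc, vec_add, mul_add]
  abel

/-- Since a = yc + δσn⁻¹q, the numerator is y times the denominator plus δσn⁻¹qh. Dividing by q(1 +
vh) leaves the conjugate by q of h(1 + vh)⁻¹, whose inverse factor is the reversion of 1 + vh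
divided by `scal`. -/
theorem moebius_eq (hq : IsLipschitz (c * vec x + d) σ n)
    (hc : c = (c * vec x + d) * vec v) (hab : a * vec x + b = vec y * (c * vec x + d))
    (ha : a = vec y * c + (δ * (σ * n⁻¹)) • (c * vec x + d)) {h : E m} (hh : 0 < scal v 1 h) :
    moebius a b c d (x + h) = y + (δ * n⁻¹) • hq.rot ((scal v 1 h)⁻¹ • numX v 1 h) := by
  have hp := isLipschitz_fac hh
  have hden := denominator_eq hc h
  rw [moebius, hden, (hq.mul hp).ring_inverse]
  have hnum : a * vec (x + h) + b = vec y * ((c * vec x + d) * fac v 1 h) +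
      (δ * (σ * n⁻¹)) • ((c * vec x + d) * vec h) := by
    rw [← hden, vec_add, mul_add, add_right_comm, hab]
    nth_rw 1 [ha]
    rw [add_mul, smul_mul_assoc]
    simp only [mul_add, mul_assoc]
    abel
  have key : (a * vec (x + h) + b) * ((σ * 1 * (n * scal v 1 h)⁻¹) •
      reverse ((c * vec x + d) * fac v 1 h)) =
      vec (y + (δ * n⁻¹) • hq.rot ((scal v 1 h)⁻¹ • numX v 1 h)) := by
    rw [hnum, add_mul, mul_assoc (vec y), (hq.mul hp).mul_inv, mul_one, vec_add, vec_smul,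
      hq.rot_apply, hq.vec_rotate, vec_smul, ← vec_mul_reverse_fac, reverse.map_mul]
    simp only [mul_smul_comm, smul_mul_assoc, smul_smul, mul_assoc]
    congr 2
    have := hq.sign_sq
    rw [_root_.mul_inv]
    linear_combination (δ * n⁻¹ * n⁻¹ * (scal v 1 h)⁻¹) * this
  change toVec (_ * ((σ * 1 * (n * scal v 1 h)⁻¹) • reverse ((c * vec x + d) * fac v 1 h))) = _
  rw [key, toVec_vec]

theorem scal_zero (v : E m) (t : ℝ) : scal v t 0 = 1 := by simp [scal]

theorem moebius_eq_zero (hq : IsLipschitz (c * vec x + d) σ n)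
    (hc : c = (c * vec x + d) * vec v) (hab : a * vec x + b = vec y * (c * vec x + d))
    (ha : a = vec y * c + (δ * (σ * n⁻¹)) • (c * vec x + d)) : moebius a b c d x = y := by
  have h := moebius_eq (h := 0) hq hc hab ha (by rw [scal_zero]; exact one_pos)
  simpa [numX] using h

theorem theta_zero (v x u : E m) : theta v (0, x, u) = (0, x, u) := by
  simp [theta, scal, numX, numU]

theorem mem_dom_time_zero (v x u : E m) : (0, x, u) ∈ dom v := by
  rw [mem_dom]; simp [scal]

theorem flow_zero (s : ℤ) (G : Sp (⊤ : Opens (V m))) (x u : E m) :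
    flow v s G (0, x, u) = G (0, x, u) := by
  rw [flow_apply s G (mem_dom_time_zero v x u), theta_zero]
  simp [scal]

theorem twist_zero (W : Sp (dom v)) (x u : E m) : twist v W (0, x, u) = W (0, x, u) := by
  rw [twist_apply', zero_smul, add_zero]

theorem flow_Psi_one (hq : IsLipschitz (c * vec x + d) σ n)
    (hc : c = (c * vec x + d) * vec v) (hab : a * vec x + b = vec y * (c * vec x + d))
    (ha : a = vec y * c + (δ * (σ * n⁻¹)) • (c * vec x + d)) (s : ℤ) (z : Cl m)
    {f : E m → E m → Cl m} (hf : ContDiff ℝ ∞ fun p : E m × E m => f p.1 p.2) {h u : E m}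
    (hh : (1, h, u) ∈ dom v) :
    flow v s (Psi z hq.rot (δ * n⁻¹) y (ofSmooth f hf)) (1, h, u) =
      Real.sqrt (scal v 1 h) ^ s • (z * f (moebius a b c d (x + h))
        (rotate (c * vec (x + h) + d) u)) := by
  rw [flow_apply _ _ hh, Psi_apply, ofSmooth_apply, theta_eq hh, affineLin_apply,
    moebius_eq hq hc hab ha hh, denominator_eq hc, hq.rotate_mul (isLipschitz_fac hh)]
  simp only [Prod.snd_add, Prod.fst_add, add_zero, hq.rot_apply, IsLipschitz.rot_apply,
    add_comm y]

theorem clNorm_denominator (hq : IsLipschitz (c * vec x + d) σ n)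
    (hc : c = (c * vec x + d) * vec v) {h : E m} (hh : 0 < scal v 1 h) :
    clNorm (c * vec (x + h) + d) = clNorm (c * vec x + d) * Real.sqrt (scal v 1 h) := by
  rw [denominator_eq hc, (hq.mul (isLipschitz_fac hh)).clNorm_eq, hq.clNorm_eq,
    Real.sqrt_mul hq.pos.le]

theorem D4_local (hm : 3 ≤ m) (hq : IsLipschitz (c * vec x + d) σ n)
    (hc : c = (c * vec x + d) * vec v) (hab : a * vec x + b = vec y * (c * vec x + d))
    (ha : a = vec y * c + (δ * (σ * n⁻¹)) • (c * vec x + d)) (hδ : δ = 1 ∨ δ = -1)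
    {k : ℕ} {f : E m → E m → Cl m} (hk : m + 2 * k ≠ 4) (hf : IsSmoothHarmonic k f) (u : E m) :
    clNorm (c * vec x + d) ^ (-(m : ℤ) - 4) •
        D4 k f (moebius a b c d x) (rotate (c * vec x + d) u) =
      D4 k (fun x' u' => clNorm (c * vec x' + d) ^ (4 - (m : ℤ)) •
        f (moebius a b c d x') (rotate (c * vec x' + d) u')) x u := by
  have hm' : (3 : ℝ) ≤ m := by exact_mod_cast hm
  have hk' : (m : ℝ) + 2 * k - 4 ≠ 0 := by
    rw [sub_ne_zero]; exact_mod_cast hk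
  have hk2 : (m : ℝ) + 2 * k - 2 ≠ 0 := by
    have hk0 : (0 : ℝ) ≤ k := k.cast_nonneg
    exact ne_of_gt (by linarith)
  set q := c * vec x + d
  set G := ofSmooth f hf.1
  set g := Psi 1 hq.rot (δ * n⁻¹) y G
  set W := flow v (4 - m) g
  have hE : (ops _).Eu W = (k : ℝ) • W :=
    Eu_flow _ _ (by rw [Eu_Psi, Eu_ofSmooth hf.1 fun x => (hf.2 x).1, map_smul])
  have hH : (ops _).H W = 0 :=
    H_flow _ _ (by rw [H_Psi, H_ofSmooth hf.1 fun x => (hf.2 x).2, map_zero])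
  have hdt : dt W = (ops _).K v (m - 4) W := by
    rw [dt_flow]; congr 1; push_cast; ring
  -- Transport along x = 0 from the Möbius pullback at t = 1 to the similarity pullback at t = 0.
  have hconst := T4_const v (mem_dom_zero v) k hdt ((ops _).T4_K v W k hk2 hk' hE hH) u 1 0
  -- At t = 0 the flow is the identity, so W and g share a time slice and 𝒟₄ takes the same values
  -- on both.
  have h0 : Rep 0 0 (fun x u => g (0, x, u)) g := fun x u _ => by rw [zero_add]
  have h0W : Rep 0 0 (fun x u => g (0, x, u)) W := fun x u _ => by rw [zero_add, flow_zero]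
  -- The norm of q(1 + vh) is ‖q‖ times the weight base of the flow, so only the constant ‖q‖^(4−m)
  -- has to be supplied.
  have h1 : Rep 1 x (fun x' u' => clNorm (c * vec x' + d) ^ (4 - (m : ℤ)) •
      f (moebius a b c d x') (rotate (c * vec x' + d) u'))
      (clNorm (c * vec x + d) ^ (4 - (m : ℤ)) • W) := fun h w hh => by
    change clNorm (c * vec (x + h) + d) ^ (4 - (m : ℤ)) •
      f (moebius a b c d (x + h)) (rotate (c * vec (x + h) + d) w) = _
    rw [Sp.smul_apply, flow_Psi_one hq hc hab ha _ _ hf.1 hh, clNorm_denominator hq hc (h := h) hh, mul_zpow,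
      smul_smul, one_mul]
  have e1 := h1.D4 k 0 u (mem_dom_zero v 1 u)
  have e2 := h0W.D4 k 0 u (mem_dom_zero v 0 u)
  have e3 := h0.D4 k 0 u (Opens.mem_top _)
  rw [add_zero] at e1
  have e4 : (ops _).T4 k g (0, 0, u) = (δ * n⁻¹) ^ 4 • D4 k f y (rotate q u) := by
    rw [T4_Psi, Sp.smul_apply, Psi_apply, one_mul, affineLin_apply]
    have := (rep_ofSmooth hf.1 0).D4 k y (rotate q u) (Opens.mem_top _)
    rw [zero_add] at this
    rw [this]
    simp [G, ← hq.rot_apply]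
  have hT : (ops _).T4 k (clNorm q ^ (4 - (m : ℤ)) • W) =
      clNorm q ^ (4 - (m : ℤ)) • (ops _).T4 k W := by
    simp only [T4, T2, map_smul, map_sub]
    module
  rw [e1, hT, Sp.smul_apply, hconst, ← e2, e3, e4, smul_smul, moebius_eq_zero hq hc hab ha]
  congr 1
  have hδ4 : δ ^ 4 = 1 := by rcases hδ with h | h <;> rw [h] <;> norm_num
  have hpos := hq.clNorm_pos.ne'
  -- μ⁴ = ‖q‖⁻⁸ because n = ‖q‖², and (4 − m) − 8 = −m − 4.
  rw [mul_pow, hδ4, one_mul, ← hq.clNorm_sq, ← zpow_natCast, ← zpow_natCast, ← zpow_neg_one,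
    ← zpow_mul, ← zpow_mul, ← zpow_add₀ hpos]
  congr 1
  push_cast
  ring

theorem D3_local (hm : 3 ≤ m) (hq : IsLipschitz (c * vec x + d) σ n)
    (hc : c = (c * vec x + d) * vec v) (hab : a * vec x + b = vec y * (c * vec x + d))
    (ha : a = vec y * c + (δ * (σ * n⁻¹)) • (c * vec x + d)) (hδ : δ = 1 ∨ δ = -1)
    {k : ℕ} {f : E m → E m → Cl m} (hf : IsSmoothMonogenic k f) (u : E m) :
    (δ * σ) • ((clNorm (c * vec x + d) ^ (m + 4))⁻¹ • (reverse (c * vec x + d) *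
        D3 k f (moebius a b c d x) (rotate (c * vec x + d) u))) =
      D3 k (fun x' u' => (clNorm (c * vec x' + d) ^ (m - 2))⁻¹ •
        (reverse (c * vec x' + d) *
          f (moebius a b c d x') (rotate (c * vec x' + d) u'))) x u := by
  have hm' : (3 : ℝ) ≤ m := by exact_mod_cast hm
  set q := c * vec x + d
  set G := ofSmooth f hf.1
  set g := Psi (reverse q) hq.rot (δ * n⁻¹) y G
  set W := twist v (flow v (2 - m) g)
  set C := (clNorm q ^ (m - 2))⁻¹
  have hE : (ops _).Eu W = (k : ℝ) • W :=
    Eu_twist _ (Eu_flow _ _ (by rw [Eu_Psi, Eu_ofSmooth hf.1 fun x => (hf.2 x).1, map_smul]))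
  have hG : (ops _).G W = 0 :=
    G_twist_flow _ _ (by
      rw [G_Psi _ hq.vec_mul_reverse, G_ofSmooth hf.1 fun x => (hf.2 x).2, map_zero, smul_zero])
  have hdt : dt W = (ops _).KS v (m - 2) W := by
    rw [dt_twist_flow]; congr 1; push_cast; ring
  have hcomm : (ops _).T3 k ((ops _).KS v (m - 2) W) =
      (ops _).KS v (m - 2) ((ops _).T3 k W) + (6 : ℝ) • (ops _).xv v ((ops _).T3 k W) := by
    -- As m ≥ 3, the excluded value occurs only for k = 0, where f does not depend on u.
    by_cases hk : m + 2 * k = 4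
    · obtain rfl : k = 0 := by omega
      refine (ops _).T3_KS_of_const v W (Q_twist_eq_zero _ (Q_flow_eq_zero _ _ fun i => ?_)) 0
      rw [ops_Q, Ql_Psi, Ql_ofSmooth_eq_zero hf.1 fun x => (hf.2 x).1, map_zero, smul_zero]
    · have hk' : (m : ℝ) + 2 * k - 4 ≠ 0 := by
        rw [sub_ne_zero]; exact_mod_cast hk
      have hk0 : (0 : ℝ) ≤ k := k.cast_nonneg
      exact (ops _).T3_KS v W k (ne_of_gt (by linarith)) (ne_of_gt (by linarith)) hk' hE hG
  have hconst := T3_const v (mem_dom_zero v) k hdt hcomm u 1 0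
  have h0 : Rep 0 0 (fun x u => g (0, x, u)) g := fun x u _ => by rw [zero_add]
  have h0W : Rep 0 0 (fun x u => g (0, x, u)) W := fun x u _ => by
    rw [zero_add, twist_zero, flow_zero]
  have h1 : Rep 1 x (fun x' u' => (clNorm (c * vec x' + d) ^ (m - 2))⁻¹ •
      (reverse (c * vec x' + d) * f (moebius a b c d x') (rotate (c * vec x' + d) u')))
      (C • W) := fun h w hh => by
    have h2 : ((2 : ℤ) - m) = -((m - 2 : ℕ) : ℤ) := by omega
    change (clNorm (c * vec (x + h) + d) ^ (m - 2))⁻¹ • (reverse (c * vec (x + h) + d) *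
      f (moebius a b c d (x + h)) (rotate (c * vec (x + h) + d) w)) = _
    rw [Sp.smul_apply, twist_apply, flow_Psi_one hq hc hab ha _ _ hf.1 hh, clNorm_denominator hq hc (h := h) hh,
      denominator_eq hc h, reverse.map_mul, mul_pow, _root_.mul_inv, h2, zpow_neg, zpow_natCast,
      mul_smul_comm, smul_smul, mul_assoc (reverse _)]
  have e1 := h1.D3 k 0 u (mem_dom_zero v 1 u)
  have e2 := h0W.D3 k 0 u (mem_dom_zero v 0 u)
  have e3 := h0.D3 k 0 u (Opens.mem_top _)
  rw [add_zero] at e1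
  have e4 : (ops _).T3 k g (0, 0, u) =
      (σ * (δ * n⁻¹) ^ 3) • (reverse q * D3 k f y (rotate q u)) := by
    rw [T3_Psi _ hq.vec_mul_reverse hq.sign_sq, Sp.smul_apply, Psi_apply, affineLin_apply]
    have := (rep_ofSmooth hf.1 0).D3 k y (rotate q u) (Opens.mem_top _)
    rw [zero_add] at this
    rw [this]
    simp [G, ← hq.rot_apply]
  have hT : (ops _).T3 k (C • W) = C • (ops _).T3 k W := by
    simp only [T3, map_smul]
    module
  rw [e1, hT, Sp.smul_apply, hconst, ← e2, e3, e4, smul_smul, smul_smul, moebius_eq_zero hq hc hab ha]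
  congr 1
  have hδ3 : δ ^ 3 = δ := by rcases hδ with h | h <;> rw [h] <;> norm_num
  have hpos := hq.clNorm_pos.ne'
  -- The factor σμ³ contributes δσ‖q‖⁻⁶ on top of ‖q‖^(−(m−2)).
  have hexp : m + 4 = (m - 2) + 2 * 3 := by omega
  rw [mul_pow, hδ3, ← hq.clNorm_sq, hexp, pow_add, pow_mul, _root_.mul_inv, inv_pow]
  ring

/-- Any two denominators differ by an even factor 1 + vh on the right, so the parity sign at one
regular point holds for all x', poles included. -/
theorem involute_denominator (hq : IsLipschitz (c * vec x + d) σ n)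
    (hc : c = (c * vec x + d) * vec v) (x' : E m) :
    involute (c * vec x' + d) = σ • (c * vec x' + d) := by
  obtain ⟨h, rfl⟩ : ∃ h, x' = x + h := ⟨x' - x, (add_sub_cancel x x').symm⟩
  rw [denominator_eq hc, map_mul, involute_fac, hq.involute_eq, smul_mul_assoc]

theorem IsVahlen.exists_sign (hV : IsVahlen a b c d) : ∃ δ : ℝ, (δ = 1 ∨ δ = -1) ∧
    a * reverse d - b * reverse c = δ • (1 : Cl m) := by
  rcases hV.det with h | h
  · exact ⟨1, Or.inl rfl, by rw [h, one_smul]⟩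
  · exact ⟨-1, Or.inr rfl, by rw [h, neg_one_smul]⟩

end Local

end HigherSpin

end

theorem mainTheorem8 (m : ℕ) (hm : 3 ≤ m) (a b c d : Cl m) (hV : IsVahlen a b c d) :
    -- off the pole, `φ(x)` and `ω` are honest vectors given by the stated formulas
    (∀ x : E m, c * vec x + d ≠ 0 →
      IsUnit (c * vec x + d) ∧ 0 < clNorm (c * vec x + d) ∧
      vec (moebius a b c d x) = (a * vec x + b) * Ring.inverse (c * vec x + d) ∧
      ∀ u : E m, vec (rotate (c * vec x + d) u) =
        (clNorm (c * vec x + d) ^ 2)⁻¹ •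
          ((c * vec x + d) * vec u * CliffordAlgebra.reverse (c * vec x + d))) ∧
    -- the intertwining relation for `𝒟₃`
    (∃ ε : ℝ, (ε = 1 ∨ ε = -1) ∧
      (∀ x : E m,
        (a * CliffordAlgebra.reverse d - b * CliffordAlgebra.reverse c) *
          CliffordAlgebra.involute (c * vec x + d) = ε • (c * vec x + d)) ∧
      ∀ (k : ℕ) (f : E m → E m → Cl m), IsSmoothMonogenic k f →
        ∀ x u : E m, c * vec x + d ≠ 0 →
          ε • ((clNorm (c * vec x + d) ^ (m + 4))⁻¹ •
            (CliffordAlgebra.reverse (c * vec x + d) *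
              D3 k f (moebius a b c d x) (rotate (c * vec x + d) u))) =
          D3 k (fun x' u' =>
            (clNorm (c * vec x' + d) ^ (m - 2))⁻¹ •
              (CliffordAlgebra.reverse (c * vec x' + d) *
                f (moebius a b c d x') (rotate (c * vec x' + d) u'))) x u) ∧
    -- the intertwining relation for `𝒟₄`
    (∀ (k : ℕ) (f : E m → E m → Cl m), m + 2 * k ≠ 4 → IsSmoothHarmonic k f →
      ∀ x u : E m, c * vec x + d ≠ 0 →
        clNorm (c * vec x + d) ^ (-(m : ℤ) - 4) •
          D4 k f (moebius a b c d x) (rotate (c * vec x + d) u) =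
        D4 k (fun x' u' =>
          clNorm (c * vec x' + d) ^ (4 - (m : ℤ)) •
            f (moebius a b c d x') (rotate (c * vec x' + d) u')) x u) := by
  have hm0 : 0 < m := by omega
  obtain ⟨δ, hδ, hdet⟩ := hV.exists_sign
  obtain ⟨x₀, hx₀⟩ := hV.exists_regular hm0 hδ hdet
  -- The base point fixes the parity σ once and for all; ε = δσ.
  obtain ⟨σ, n, y₀, v₀, hq₀, hc₀, -, -⟩ := hV.exists_local hdet x₀ hx₀
  refine ⟨fun x hx => ?_, ⟨δ * σ, ?_, fun x => ?_, fun k f hf x u hx => ?_⟩,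
    fun k f hk hf x u hx => ?_⟩
  · obtain ⟨τ, l, y, v, hq, hc, hab, ha⟩ := hV.exists_local hdet x hx
    refine ⟨hq.isUnit, hq.clNorm_pos, ?_, fun u => ?_⟩
    · rw [moebius_eq_zero hq hc hab ha, hab, mul_assoc, Ring.mul_inverse_cancel _ hq.isUnit, mul_one]
    · rw [hq.clNorm_sq]
      exact hq.vec_rotate u
  · rcases hδ with h | h <;> rcases hq₀.sign with h' | h' <;> simp [h, h']
  · rw [hdet, involute_denominator hq₀ hc₀, smul_mul_smul_comm, one_mul]
    rfl
  · obtain ⟨τ, l, y, v, hq, hc, hab, ha⟩ := hV.exists_local hdet x hx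
    -- The parity at x agrees with that at the base point because the denominator at x is nonzero.
    have hτ : τ = σ := by
      have h := hq.involute_eq
      rw [involute_denominator hq₀ hc₀] at h
      exact (smul_left_injective ℝ hq.ne_zero h).symm
    subst hτ
    exact D3_local hm hq hc hab ha hδ hf u
  · obtain ⟨τ, l, y, v, hq, hc, hab, ha⟩ := hV.exists_local hdet x hx
    exact D4_local hm hq hc hab ha hδ hk hf u
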